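/- Let $d\ge 1$, let $\boldsymbol p=(p_1,\dots,p_d)$ be a probability distribution with all $p_j>0$, and let $\boldsymbol u=(u^{(0)},\dots,u^{(d-1)})$ be real functions on $\{1,\dots,d\}$ with $u^{(0)}\equiv 1$, $\sum_{j=1}^d u^{(k)}_ju^{(l)}_jp_j=\delta_{kl}a_k$, and $u^{(r)}_d=1$ for all $r$. Suppose that $\boldsymbol u$ has the hypergroup property $$\mathfrak s(j,k,l)=\sum_{r=0}^{d-1}a_r^{-1}u^{(r)}_ju^{(r)}_ku^{(r)}_l\ge 0,\qquad j,k,l=1,\dots,d.$$ Fix $\theta>0$ and write $|\boldsymbol z|=\sum_i z_i$. For $\alpha>0$ and $\boldsymbol x\in\mathbb Z_+^d$ let $$P(\boldsymbol x;\alpha,\theta,\boldsymbol p)=\frac{\Gamma(\alpha+|\boldsymbol x|)}{\Gamma(\alpha)\,|\boldsymbol x|!}\,\frac{\theta^{|\boldsymbol x|}}{(1+\theta)^{\alpha+|\boldsymbol x|}}\binom{|\boldsymbol x|}{\boldsymbol x}\prod_{i=1}^dp_i^{x_i}$$ be the multivariate negative binomial (Meixner) distribution. For $\boldsymbol n=(n_0,\dots,n_{d-1})\in\mathbb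 Z_+^d$ let the multivariate Meixner polynomial $M_{\boldsymbol n}(\boldsymbol x)$ be the coefficient of $w_0^{n_0}\cdots w_{d-1}^{n_{d-1}}$ in $$(1-w_0)^{-(|\boldsymbol x|+\alpha)}\prod_{i=1}^d\Bigl(1-w_0\tfrac{1+\theta}{\theta}+\sum_{j=1}^{d-1}u^{(j)}_iw_j\Bigr)^{x_i},$$ and let $$h_{\boldsymbol n}^{-1}=\frac{\Gamma(|\boldsymbol n|+\alpha)}{\Gamma(\alpha)\,n_0!\cdots n_{d-1}!}\Bigl(\frac{1+\theta}{\theta}\Bigr)^{n_0}\theta^{|\boldsymbol n|-n_0}\prod_{j=1}^{d-1}a_j^{n_j}$$ be its squared norm under $P(\cdot;\alpha,\theta,\boldsymbol p)$. Consider the expansion $$q_\alpha(\boldsymbol x,\boldsymbol y)=P(\boldsymbol x;\alpha,\theta,\boldsymbol p)\,P(\boldsymbol y;\alpha,\theta,\boldsymbol p)\Bigl\{1+\sum_{|\boldsymbol n|\ge1}\rho_{\boldsymbol n}h_{\boldsymbol n}M_{\boldsymbol n}(\boldsymbol x)M_{\boldsymbol n}(\boldsymbol y)\Bigr\},\qquad(*)$$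 where the real numbers $\rho_{\boldsymbol n}$, with $\rho_{\boldsymbol 0}=1$, do not depend on $\alpha$. Convergence of $(*)$ is understood in mean square: for each fixed $\boldsymbol x$ the orthogonal series in $\boldsymbol y$ converges in $L^2(P)$, that is, $\sum_{\boldsymbol n}\rho_{\boldsymbol n}^2h_{\boldsymbol n}M_{\boldsymbol n}(\boldsymbol x)^2<\infty$. The unit simplex is $\{\boldsymbol\xi\in\mathbb R^d:\xi_i\ge0,\ |\boldsymbol\xi|\le1\}$, and $\rho_j(\boldsymbol\xi)=\sum_{i=1}^du^{(j)}_i\xi_i$ for $j=0,\dots,d-1$. (1) For every $\alpha>0$, if $(*)$ converges in mean square and is non-negative, then it converges absolutely at every $(\boldsymbol x,\boldsymbol y)$ and is a proper bivariate distribution: it is the joint probability function of a pair $(\boldsymbol X,\boldsymbol Y)$ with both marginals $P(\cdot;\alpha,\theta,\boldsymbol p)$ and $\mathbb E[M_{\boldsymbol m}(\boldsymbol X)M_{\boldsymbol n}(\boldsymbol Y)]=\delta_{\boldsymbol m\boldsymbol n}\rho_{\boldsymbol n}h_{\boldsymbol n}^{-1}$. (2) If $(*)$ converges in mean square and is non-negative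 for all $\alpha>0$, then there is a random vector $\boldsymbol\xi$ in the unit simplex such that $$\rho_{\boldsymbol n}=\mathbb E_{\boldsymbol\xi}\Bigl[\prod_{j=0}^{d-1}\rho_j(\boldsymbol\xi)^{n_j}\Bigr]\qquad\text{for all }\boldsymbol n\in\mathbb Z_+^d.\qquad(**)$$ Conversely, for every $\rho$ of the form $(**)$ the expansion $(*)$ converges in mean square for all $\alpha>0$. (3) For $\boldsymbol\xi\ne\boldsymbol 0$ let $\boldsymbol\omega=\boldsymbol\xi/|\boldsymbol\xi|$ and $p_{ij}(\boldsymbol\omega)=p_ip_j\sum_{l=1}^d\omega_l\,\mathfrak s(i,j,l)$. For a non-random $\boldsymbol\xi$ in the unit simplex and $\rho_{\boldsymbol n}=\prod_j\rho_j(\boldsymbol\xi)^{n_j}$, the expansion $(*)$ is non-negative for all $\alpha>0$ if and only if $\boldsymbol\xi=\boldsymbol 0$ or $$p_{ij}(\boldsymbol\omega)\ge\frac{\theta(1-|\boldsymbol\xi|)}{1+\theta(1-|\boldsymbol\xi|)}\,p_ip_j,\qquad i,j=1,\dots,d.\qquad(***)$$ (4) If $\boldsymbol\xi$ is a random vector in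 the unit simplex that almost surely is $\boldsymbol 0$ or satisfies $(***)$, then with $\rho$ given by $(**)$ the expansion $(*)$ is, for all $\alpha>0$, non-negative and a proper bivariate distribution in the sense of (1). -/

import Mathlib

open scoped Nat
open MeasureTheory

noncomputable section

namespace MultivariateMeixner

/-- The functions `u 0, …, u m` on the `m + 1` points (`u r j` is the value of the `r`-th function
at the `j`-th point) form an orthogonal basis on the probability distribution `p`, with `u 0 = 1`,
scaled so that every function takes the value `1` at the last point. -/
structure IsOrthogonalBasis {m : ℕ} (p : Fin (m + 1) → ℝ) (u : Fin (m + 1) → Fin (m + 1) → ℝ) :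
    Prop where
  p_pos : ∀ j, 0 < p j
  p_sum : ∑ j, p j = 1
  u_zero : ∀ j, u 0 j = 1
  orth : ∀ k l, k ≠ l → ∑ j, u k j * u l j * p j = 0
  u_last : ∀ r, u r (Fin.last m) = 1

/-- The squared norm `a_k` of the `k`-th basis function. -/
def sqNorm {m : ℕ} (p : Fin (m + 1) → ℝ) (u : Fin (m + 1) → Fin (m + 1) → ℝ)
    (k : Fin (m + 1)) : ℝ :=
  ∑ j, u k j * u k j * p j

/-- `𝔰(j,k,l) = ∑_r a_r⁻¹ u_j^{(r)} u_k^{(r)} u_l^{(r)}`. -/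
def hyperS {m : ℕ} (p : Fin (m + 1) → ℝ) (u : Fin (m + 1) → Fin (m + 1) → ℝ)
    (j k l : Fin (m + 1)) : ℝ :=
  ∑ r, (sqNorm p u r)⁻¹ * u r j * u r k * u r l

/-- The hypergroup property of the basis. -/
def IsHypergroup {m : ℕ} (p : Fin (m + 1) → ℝ) (u : Fin (m + 1) → Fin (m + 1) → ℝ) : Prop :=
  ∀ j k l, 0 ≤ hyperS p u j k l

/-- The multivariate Meixner (negative binomial) probability of `x ∈ ℕ^{m+1}`. -/
def meixnerProb {m : ℕ} (α θ : ℝ) (p : Fin (m + 1) → ℝ) (x : Fin (m + 1) → ℕ) : ℝ :=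
  Real.Gamma (α + (∑ i, x i : ℕ)) / (Real.Gamma α * ((∑ i, x i) ! : ℕ))
    * (θ ^ (∑ i, x i) / (1 + θ) ^ (α + (∑ i, x i : ℕ)))
    * (Nat.multinomial Finset.univ x : ℝ) * ∏ i, p i ^ x i

/-- The expansion of `(1 - w₀)^{-c}`, as a formal power series in `w₀, …, w_m`. -/
def negBinSeries (m : ℕ) (c : ℝ) : MvPowerSeries (Fin (m + 1)) ℝ := fun n =>
  if n = Finsupp.single 0 (n 0) then (ascPochhammer ℝ (n 0)).eval c / ((n 0) ! : ℝ) else 0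

/-- The generating function
`(1 - w₀)^{-(|x| + α)} ∏_i (1 - w₀ (1 + θ)/θ + ∑_{j ≥ 1} u_i^{(j)} w_j)^{x_i}`
of the multivariate Meixner polynomials at `x`, a formal power series in `w₀, …, w_m`. -/
def meixnerGen {m : ℕ} (α θ : ℝ) (u : Fin (m + 1) → Fin (m + 1) → ℝ) (x : Fin (m + 1) → ℕ) :
    MvPowerSeries (Fin (m + 1)) ℝ :=
  negBinSeries m ((∑ i, x i : ℕ) + α) *
    ∏ i, (1 - MvPowerSeries.C ((1 + θ) / θ) * MvPowerSeries.X 0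
      + ∑ j : Fin m, MvPowerSeries.C (u j.succ i) * MvPowerSeries.X j.succ) ^ x i

/-- The multivariate Meixner polynomial `M_n(x; α, θ, p, u)`: the coefficient of `w^n` in the
generating function. -/
def meixnerPoly {m : ℕ} (α θ : ℝ) (u : Fin (m + 1) → Fin (m + 1) → ℝ)
    (n : Fin (m + 1) →₀ ℕ) (x : Fin (m + 1) → ℕ) : ℝ :=
  MvPowerSeries.coeff n (meixnerGen α θ u x)

/-- The squared norm of `M_n` under the multivariate Meixner distribution,
`Γ(|n| + α) / (Γ(α) n₀! ⋯ n_m!) * ((1 + θ)/θ)^{n₀} * θ^{|n| - n₀} * ∏_{j ≥ 1} a_j^{n_j}`. -/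
def meixnerSqNorm {m : ℕ} (α θ : ℝ) (p : Fin (m + 1) → ℝ) (u : Fin (m + 1) → Fin (m + 1) → ℝ)
    (n : Fin (m + 1) →₀ ℕ) : ℝ :=
  Real.Gamma ((∑ j, n j : ℕ) + α) / (Real.Gamma α * ∏ j, ((n j) ! : ℝ))
    * ((1 + θ) / θ) ^ n 0 * θ ^ (∑ j : Fin m, n j.succ)
    * ∏ j : Fin m, sqNorm p u j.succ ^ n j.succ

/-- `h_n(α, θ, u)`, the inverse of the squared norm of `M_n`. -/
def meixnerH {m : ℕ} (α θ : ℝ) (p : Fin (m + 1) → ℝ) (u : Fin (m + 1) → Fin (m + 1) → ℝ)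
    (n : Fin (m + 1) →₀ ℕ) : ℝ :=
  (meixnerSqNorm α θ p u n)⁻¹

/-- The diagonal expansion
`P(x) P(y) {1 + ∑_{|n| ≥ 1} ρ_n h_n M_n(x) M_n(y)}`. -/
def expansion {m : ℕ} (α θ : ℝ) (p : Fin (m + 1) → ℝ) (u : Fin (m + 1) → Fin (m + 1) → ℝ)
    (ρ : (Fin (m + 1) →₀ ℕ) → ℝ) (x y : Fin (m + 1) → ℕ) : ℝ :=
  meixnerProb α θ p x * meixnerProb α θ p y *
    (1 + ∑' n : {n : Fin (m + 1) →₀ ℕ // n ≠ 0},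
      ρ n * meixnerH α θ p u n * meixnerPoly α θ u n x * meixnerPoly α θ u n y)

/-- For every fixed `x` the expansion `∑ ρ_n h_n M_n(x) M_n(y)` converges in mean square in `y`:
its coefficients `ρ_n h_n^{1/2} M_n(x)` with respect to the orthonormal functions
`h_n^{1/2} M_n(y)` are square summable. -/
def MeanSquareConvergent {m : ℕ} (α θ : ℝ) (p : Fin (m + 1) → ℝ)
    (u : Fin (m + 1) → Fin (m + 1) → ℝ) (ρ : (Fin (m + 1) →₀ ℕ) → ℝ) : Prop :=
  ∀ x, Summable fun n => ρ n ^ 2 * meixnerH α θ p u n * meixnerPoly α θ u n x ^ 2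

/-- The expansion is non-negative at all pairs of points. -/
def IsNonnegExpansion {m : ℕ} (α θ : ℝ) (p : Fin (m + 1) → ℝ)
    (u : Fin (m + 1) → Fin (m + 1) → ℝ) (ρ : (Fin (m + 1) →₀ ℕ) → ℝ) : Prop :=
  ∀ x y, 0 ≤ expansion α θ p u ρ x y

/-- The expansion converges absolutely at all pairs of points and is a proper bivariate
distribution: the joint probability function of a pair `(X, Y)` whose two marginals are multivariate
Meixner distributions, with `E[M_k(X) M_n(Y)] = δ_{kn} ρ_n / h_n`. -/
structure IsLancasterDistribution {m : ℕ} (α θ : ℝ) (p : Fin (m + 1) → ℝ)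
    (u : Fin (m + 1) → Fin (m + 1) → ℝ) (ρ : (Fin (m + 1) →₀ ℕ) → ℝ) : Prop where
  summable : ∀ x y, Summable fun n =>
    ρ n * meixnerH α θ p u n * meixnerPoly α θ u n x * meixnerPoly α θ u n y
  nonneg : ∀ x y, 0 ≤ expansion α θ p u ρ x y
  total : HasSum (fun z : (Fin (m + 1) → ℕ) × (Fin (m + 1) → ℕ) => expansion α θ p u ρ z.1 z.2) 1
  marginal_left : ∀ x, HasSum (fun y => expansion α θ p u ρ x y) (meixnerProb α θ p x)
  marginal_right : ∀ y, HasSum (fun x => expansion α θ p u ρ x y) (meixnerProb α θ p y)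
  correlation : ∀ k n, HasSum
    (fun z : (Fin (m + 1) → ℕ) × (Fin (m + 1) → ℕ) =>
      expansion α θ p u ρ z.1 z.2 * (meixnerPoly α θ u k z.1 * meixnerPoly α θ u n z.2))
    (if k = n then ρ n / meixnerH α θ p u n else 0)

/-- The unit simplex `{ξ : ξ_i ≥ 0, |ξ| ≤ 1}`. -/
def unitSimplex (m : ℕ) : Set (Fin (m + 1) → ℝ) :=
  {ξ | (∀ i, 0 ≤ ξ i) ∧ ∑ i, ξ i ≤ 1}

/-- `ρ_j(ξ) = ∑_i u_i^{(j)} ξ_i`. -/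
def rhoForm {m : ℕ} (u : Fin (m + 1) → Fin (m + 1) → ℝ) (j : Fin (m + 1))
    (ξ : Fin (m + 1) → ℝ) : ℝ :=
  ∑ i, u j i * ξ i

/-- `∏_{j=0}^m ρ_j(ξ)^{n_j}`. -/
def rhoMonomial {m : ℕ} (u : Fin (m + 1) → Fin (m + 1) → ℝ) (n : Fin (m + 1) →₀ ℕ)
    (ξ : Fin (m + 1) → ℝ) : ℝ :=
  ∏ j, rhoForm u j ξ ^ n j

/-- `p_{ij}(ω) = p_i p_j ∑_l ω_l 𝔰(i,j,l)`. -/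
def pairProb {m : ℕ} (p : Fin (m + 1) → ℝ) (u : Fin (m + 1) → Fin (m + 1) → ℝ)
    (ω : Fin (m + 1) → ℝ) (i j : Fin (m + 1)) : ℝ :=
  p i * p j * ∑ l, ω l * hyperS p u i j l

/-- The condition `p_{ij}(ω) ≥ θ(1 - |ξ|) / (1 + θ(1 - |ξ|)) p_i p_j` for all `i, j`, where
`ω = ξ / |ξ|`. It is void for `ξ = 0`, where `ω` is undefined. -/
def ExtremeCondition {m : ℕ} (θ : ℝ) (p : Fin (m + 1) → ℝ) (u : Fin (m + 1) → Fin (m + 1) → ℝ)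
    (ξ : Fin (m + 1) → ℝ) : Prop :=
  ξ ≠ 0 → ∀ i j,
    θ * (1 - ∑ l, ξ l) / (1 + θ * (1 - ∑ l, ξ l)) * (p i * p j)
      ≤ pairProb p u (fun l => ξ l / ∑ k, ξ k) i j

end MultivariateMeixner

end

open MultivariateMeixner

namespace MultivariateMeixner

/-! ### Multivariate power series with real coefficients: rearrangement by degree, uniqueness. -/

section PowerSeries

open Filter Topology

variable {σ : Type*} [Fintype σ]

/-! Everything rests on generating functions. Write `G_i(w)` for `genFactor`, so that `∑_n M_n(x)
w^n = (1 - w₀)^{-α} ∏ G_i(w)^{x_i}`. The base of the probability generating function of `P` is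
affine in `s`, and replacing `s_i` by `s_i G_i(w)` turns it into `1 - ∑ T_j(s) w_j` up to simple
factors (`pgfBase_mul_genFactor`). Hence `∑_x P(x) s^x M_n(x)` is a constant times a monomial in the
vector `T(s)` (`hasSum_meixner_transform`), and the substitution `s = G(z)` gives orthogonality of
the `M_n`.

Proper distribution. The functions `h_n^{1/2} M_n` are orthonormal, so Bessel's inequality at a
point mass gives `∑ h_n M_n(x)² < ∞`. Mean square convergence therefore implies absolute
convergence, and integration of `M_k(y)` against the expansion multiplies `M_k` by `ρ_k`
(`hasSum_expansion_mul_meixnerPoly`). Non-negativity then permits Tonelli's theorem and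
Cauchy-Schwarz, which also gives `|ρ_n| ≤ 1`.

Moment representation. Condition on `X = K e_d`. The leading part of `M_n` is a non-zero constant
times `∏ ρ_j(x)^{n_j}`, equal to that constant times `K^{|n|}` at `K e_d` because `u^{(j)}_d = 1`.
So `E[M_n(Y) | X] = ρ_n M_n(X)` yields `E[∏ ρ_j(Y/K)^{n_j}] → ρ_n`. Taking `n` a multiple of the
index `0`, all moments of `|Y|/K` have limits at most `1`, so nothing is lost by retracting `Y/K` to
the unit simplex, where compactness supplies a limit law (`exists_moment_representation`).

Fixed `ξ`. The hypergroup property makes each `u^{(r)}_j²` an average of values of `u^{(r)}`, so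
`|u| ≤ 1` and `|ρ_j(ξ)| ≤ |ξ|`; this gives convergence. The bivariate generating function is
`B(s,t)^{-α}`, where `B = C (1 - bS)(1 - bT) - θ ∑ e_{ij} s_i t_j`, `S = ∑ p_i s_i`, `T = ∑ p_i
t_i`, `b` is `thinning`, and `e_{ij}` is `excess`, whose non-negativity is exactly the stated
condition (`bivBase_eq`, `extremeCondition_iff`). If all `e_{ij} ≥ 0`, factoring out the marginal
terms and expanding binomial series exhibits non-negative coefficients. Conversely, a mixed second
difference of `B^{-α}` is non-negative for all `α > 0`; its derivative at `α = 0` is a comparison of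
logarithms which amounts to `e_{ij} ≥ 0`. Random `ξ` follow by mixing. -/

/-- The value `∏ i, w i ^ n i` of the monomial with exponent `n` at `w`. -/
def mon (w : σ → ℝ) (n : σ → ℕ) : ℝ := ∏ i, w i ^ n i

lemma mon_abs (w : σ → ℝ) (n : σ → ℕ) : |mon w n| = mon (fun i => |w i|) n := by
  simp [mon, Finset.abs_prod, abs_pow]

lemma mon_nonneg {w : σ → ℝ} (hw : ∀ i, 0 ≤ w i) (n : σ → ℕ) : 0 ≤ mon w n :=
  Finset.prod_nonneg fun i _ => pow_nonneg (hw i) _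

lemma mon_pos {w : σ → ℝ} (hw : ∀ i, 0 < w i) (n : σ → ℕ) : 0 < mon w n :=
  Finset.prod_pos fun i _ => pow_pos (hw i) _

lemma mon_add (w : σ → ℝ) (n k : σ → ℕ) : mon w (n + k) = mon w n * mon w k := by
  simp [mon, pow_add, Finset.prod_mul_distrib]

lemma mon_zero (w : σ → ℝ) : mon w 0 = 1 := by simp [mon]

lemma mon_mul (w z : σ → ℝ) (n : σ → ℕ) :
    mon (fun i => w i * z i) n = mon w n * mon z n := by
  simp [mon, mul_pow, Finset.prod_mul_distrib]

lemma mon_smul (t : ℝ) (w : σ → ℝ) (n : σ → ℕ) :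
    mon (fun i => t * w i) n = t ^ (∑ i, n i) * mon w n := by
  rw [mon_mul]; congr 1; simp [mon, Finset.prod_pow_eq_pow_sum]

lemma mon_mono {w z : σ → ℝ} (h : ∀ i, |w i| ≤ z i) (n : σ → ℕ) : |mon w n| ≤ mon z n := by
  rw [mon_abs]
  exact Finset.prod_le_prod (fun i _ => pow_nonneg (abs_nonneg _) _)
    fun i _ => pow_le_pow_left₀ (abs_nonneg _) (h i) _

lemma ringChoose_eq_ascPochhammer (c : ℝ) (n : ℕ) :
    Ring.choose (c + n - 1) n = (ascPochhammer ℝ n).eval c / n ! := by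
  have h := Ring.factorial_nsmul_multichoose_eq_ascPochhammer c n
  rw [Ring.choose, show c + n - 1 - n + 1 = c by ring, eq_div_iff (by positivity)]
  rw [nsmul_eq_mul, Polynomial.ascPochhammer_smeval_eq_eval] at h
  linarith

/-- The binomial series. -/
lemma hasSum_one_sub_rpow_neg (c : ℝ) {z : ℝ} (hz : |z| < 1) :
    HasSum (fun k : ℕ => (ascPochhammer ℝ k).eval c / k ! * z ^ k) ((1 - z) ^ (-c)) := by
  have h := (Real.one_div_one_sub_rpow_hasFPowerSeriesOnBall_zero c).hasSum (y := z)
    (by simpa [enorm_eq_nnnorm] using! hz)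
  have h1 : (0 : ℝ) ≤ 1 - z := by linarith [(abs_lt.1 hz).2]
  rw [zero_add, one_div, ← Real.rpow_neg h1] at h
  refine h.congr_fun fun k => ?_
  simp [FormalMultilinearSeries.ofScalars, ringChoose_eq_ascPochhammer, mul_comm]

lemma summable_abs_binomial (c : ℝ) {z : ℝ} (h0 : 0 ≤ z) (hz : z < 1) :
    Summable fun k : ℕ => |(ascPochhammer ℝ k).eval c| / k ! * z ^ k := by
  have h := (hasSum_one_sub_rpow_neg c (z := z) (by rwa [abs_of_nonneg h0])).summable.abs
  refine h.congr fun k => ?_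
  rw [abs_mul, abs_div, abs_of_nonneg (pow_nonneg h0 k), Nat.abs_cast]

lemma sum_pow_div_factorial [DecidableEq σ] (z : σ → ℝ) (k : ℕ) :
    (∑ i, z i) ^ k / k ! =
      ∑ n ∈ Finset.univ.piAntidiag k, ∏ i, z i ^ n i / ((n i) ! : ℝ) := by
  rw [Finset.sum_pow_eq_sum_piAntidiag, Finset.sum_div]
  refine Finset.sum_congr rfl fun n hn => ?_
  have hk : ∑ i, n i = k := (Finset.mem_piAntidiag.1 hn).1
  have h := Nat.multinomial_spec Finset.univ n
  rw [hk] at h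
  have h' : (∏ i, ((n i) ! : ℝ)) * (Nat.multinomial Finset.univ n : ℝ) = k ! := by exact_mod_cast h
  rw [Finset.prod_div_distrib, ← h']
  have : (∏ i, ((n i) ! : ℝ)) ≠ 0 := Finset.prod_ne_zero_iff.2 fun i _ => by positivity
  have h2 : (Nat.multinomial Finset.univ n : ℝ) ≠ 0 := by
    intro h0; rw [h0, mul_zero] at h'; exact (by positivity : (0:ℝ) < k !).ne h'
  field_simp

/-- A function on exponents whose partial sums over the exponents of each degree are summable
can be summed degree by degree. -/
lemma hasSum_fiber_degree {f : (σ → ℕ) → ℝ} (hf : Summable f) [DecidableEq σ] :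
    HasSum (fun k => ∑ n ∈ Finset.univ.piAntidiag k, f n) (∑' n, f n) := by
  have h := (Equiv.sigmaFiberEquiv fun n : σ → ℕ => ∑ i, n i).hasSum_iff.2 hf.hasSum
  have h2 := h.sigma (g := fun k => ∑ n ∈ Finset.univ.piAntidiag k, f n) ?_
  · exact h2
  · intro k
    have : HasSum (fun n : {n // n ∈ Finset.univ.piAntidiag (ι := σ) k} => f n)
        (∑ n ∈ Finset.univ.piAntidiag k, f n) := by
      rw [← Finset.sum_attach]; exact hasSum_fintype _
    let e : {n : σ → ℕ // ∑ i, n i = k} ≃ {n // n ∈ Finset.univ.piAntidiag (ι := σ) k} :=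
      Equiv.subtypeEquivRight fun n => by simp
    exact e.hasSum_iff.2 this

lemma summable_of_fiber_degree {f : (σ → ℕ) → ℝ} (hf : ∀ n, 0 ≤ f n) [DecidableEq σ]
    (h : Summable fun k => ∑ n ∈ Finset.univ.piAntidiag k, f n) : Summable f := by
  refine summable_of_sum_le (c := ∑' k, ∑ n ∈ Finset.univ.piAntidiag k, f n) hf fun s => ?_
  classical
  let t := s.image fun n => ∑ i, n i
  calc ∑ n ∈ s, f n = ∑ k ∈ t, ∑ n ∈ s with ∑ i, n i = k, f n :=
        (Finset.sum_fiberwise_of_maps_to (fun n hn => Finset.mem_image_of_mem _ hn) _).symm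
    _ ≤ ∑ k ∈ t, ∑ n ∈ Finset.univ.piAntidiag k, f n := by
        refine Finset.sum_le_sum fun k _ => ?_
        refine Finset.sum_le_sum_of_subset_of_nonneg (fun n hn => ?_) fun n _ _ => hf n
        simpa using (Finset.mem_filter.1 hn).2
    _ ≤ _ := h.sum_le_tsum _ fun k _ => Finset.sum_nonneg fun n _ => hf n

/-- By the multinomial theorem the terms of degree `k` add up to `a_k (∑ z_i)^k / k!`; the same
computation with absolute values gives summability. Both the negative multinomial and the
exponential series are instances. -/
lemma hasSum_multinomial (a : ℕ → ℝ) (z : σ → ℝ)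
    (h : Summable fun k => |a k| / k ! * (∑ i, |z i|) ^ k) :
    HasSum (fun n : σ → ℕ => a (∑ i, n i) * ∏ i, z i ^ n i / ((n i) ! : ℝ))
      (∑' k, a k / k ! * (∑ i, z i) ^ k) := by
  classical
  have key : ∀ (b : ℕ → ℝ) (y : σ → ℝ) (k : ℕ), ∑ n ∈ Finset.univ.piAntidiag k,
      b (∑ i, n i) * ∏ i, y i ^ n i / ((n i) ! : ℝ) = b k / k ! * (∑ i, y i) ^ k := by
    intro b y k
    rw [div_mul_eq_mul_div, mul_div_assoc, sum_pow_div_factorial, Finset.mul_sum]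
    refine Finset.sum_congr rfl fun n hn => ?_
    rw [(Finset.mem_piAntidiag.1 hn).1]
  have hs : Summable fun n : σ → ℕ => |a (∑ i, n i)| * ∏ i, |z i| ^ n i / ((n i) ! : ℝ) := by
    refine summable_of_fiber_degree (fun n => by positivity) ?_
    refine h.congr fun k => ?_
    rw [key (fun k => |a k|)]
  have hs' : Summable fun n : σ → ℕ => a (∑ i, n i) * ∏ i, z i ^ n i / ((n i) ! : ℝ) := by
    refine Summable.of_abs (hs.congr fun n => ?_)
    simp [abs_mul, Finset.abs_prod, abs_div]
  have h3 := hasSum_fiber_degree hs'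
  simp only [key] at h3
  rw [h3.tsum_eq]
  exact hs'.hasSum

/-- The negative multinomial series. -/
lemma hasSum_negMultinomial (c : ℝ) (z : σ → ℝ) (h : ∑ i, |z i| < 1) :
    HasSum (fun n : σ → ℕ =>
      (ascPochhammer ℝ (∑ i, n i)).eval c * ∏ i, z i ^ n i / ((n i) ! : ℝ))
      ((1 - ∑ i, z i) ^ (-c)) := by
  have h1 := hasSum_multinomial (fun k => (ascPochhammer ℝ k).eval c) z
    (summable_abs_binomial c (Finset.sum_nonneg fun i _ => abs_nonneg _) h)
  rwa [(hasSum_one_sub_rpow_neg c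
    ((Finset.abs_sum_le_sum_abs _ _).trans_lt h)).tsum_eq] at h1

lemma hasSum_exp_sum (z : σ → ℝ) :
    HasSum (fun n : σ → ℕ => ∏ i, z i ^ n i / ((n i) ! : ℝ)) (Real.exp (∑ i, z i)) := by
  have h0 : ∀ x : ℝ, HasSum (fun k : ℕ => 1 / (k ! : ℝ) * x ^ k) (Real.exp x) := by
    intro x
    have := NormedSpace.expSeries_div_hasSum_exp (𝔸 := ℝ) x
    rw [← Real.exp_eq_exp_ℝ] at this
    exact this.congr_fun fun k => by ring
  have h1 := hasSum_multinomial (fun _ => 1) z (by simpa using (h0 _).summable)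
  rw [(h0 _).tsum_eq] at h1
  simpa using h1

lemma powerSeries_coeff_eq_zero {c : ℕ → ℝ} {ε : ℝ} (hε : 0 < ε)
    (h : ∀ t, |t| ≤ ε → HasSum (fun k => c k * t ^ k) 0) (k : ℕ) : c k = 0 := by
  have : HasFPowerSeriesAt (0 : ℝ → ℝ) (FormalMultilinearSeries.ofScalars ℝ c) 0 := by
    rw [hasFPowerSeriesAt_iff]
    filter_upwards [Metric.closedBall_mem_nhds (0:ℝ) hε] with t ht
    simpa [mul_comm] using h t (by simpa using ht)
  have h2 := congrArg (fun p => p.coeff k) this.eq_zero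
  rw [FormalMultilinearSeries.coeff_ofScalars] at h2
  rw [h2]
  simp [FormalMultilinearSeries.coeff]

/-- Coefficients of a multivariate power series vanish if its sums vanish on a box. -/
lemma coeff_eq_zero_of_hasSum_zero {F : (σ → ℕ) → ℝ} {ε : ℝ} (hε : 0 < ε)
    (h : ∀ w : σ → ℝ, (∀ i, |w i| ≤ ε) → HasSum (fun n => F n * mon w n) 0) (n : σ → ℕ) :
    F n = 0 := by
  classical
  -- Along the ray `t ↦ t w` uniqueness in one variable isolates each homogeneous part.
  have hom : ∀ w : σ → ℝ, (∀ i, |w i| ≤ ε) → ∀ k,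
      ∑ n ∈ Finset.univ.piAntidiag k, F n * mon w n = 0 := by
    intro w hw
    refine powerSeries_coeff_eq_zero (ε := 1) one_pos fun t ht => ?_
    have h1 := h (fun i => t * w i) fun i => by
      rw [abs_mul]
      calc |t| * |w i| ≤ 1 * |w i| := by gcongr
        _ ≤ ε := by simpa using hw i
    have h2 := hasSum_fiber_degree h1.summable
    rw [h1.tsum_eq] at h2
    refine h2.congr_fun fun k => ?_
    rw [Finset.sum_mul]
    refine Finset.sum_congr rfl fun n hn => ?_
    rw [mon_smul, (Finset.mem_piAntidiag.1 hn).1]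
    ring
  let p : MvPolynomial σ ℝ := ∑ k ∈ Finset.univ.piAntidiag (∑ i, n i),
    MvPolynomial.monomial (Finsupp.equivFunOnFinite.symm k) (F k)
  -- A polynomial vanishing on a product of infinite sets is zero.
  have hp : p = 0 := by
    refine MvPolynomial.funext_set (fun _ => Set.Icc (-ε) ε) (fun _ => Set.Icc_infinite (by linarith)) ?_
    intro w hw
    have := hom w (fun i => abs_le.2 (hw i (Set.mem_univ i))) (∑ i, n i)
    simp only [p, map_sum, map_zero, MvPolynomial.eval_monomial]
    rw [← this]
    refine Finset.sum_congr rfl fun k _ => ?_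
    rw [Finsupp.prod_fintype _ _ (by simp)]
    simp [mon]
  have := congrArg (MvPolynomial.coeff (Finsupp.equivFunOnFinite.symm n)) hp
  simp only [p, MvPolynomial.coeff_sum, MvPolynomial.coeff_monomial, MvPolynomial.coeff_zero,
    EmbeddingLike.apply_eq_iff_eq] at this
  simpa using this

end PowerSeries

end MultivariateMeixner

namespace MultivariateMeixner

/-! ### Closure properties of power series with non-negative coefficients. -/

section NonnegCoeffs

variable {σ : Type*} [Fintype σ]

/-- On the box `|s i| ≤ δ`, the function `f` is the sum of a power series with non-negative
coefficients. -/
def HasNonnegCoeffs (δ : ℝ) (f : (σ → ℝ) → ℝ) : Prop :=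
  ∃ F : (σ → ℕ) → ℝ, (∀ n, 0 ≤ F n) ∧
    ∀ s : σ → ℝ, (∀ i, |s i| ≤ δ) → HasSum (fun n => F n * mon s n) (f s)

namespace HasNonnegCoeffs

variable {δ : ℝ} {f g : (σ → ℝ) → ℝ}

/-- Terms sharing an exponent are collected into one coefficient. The collected sums converge
because the whole series converges at the corner `(δ, …, δ)`, where the monomials are positive. -/
lemma of_hasSum_mon (hδ : 0 < δ) {ι : Type*} (a : ι → ℝ) (e : ι → σ → ℕ) (ha : ∀ i, 0 ≤ a i)
    (h : ∀ s : σ → ℝ, (∀ i, |s i| ≤ δ) → HasSum (fun i => a i * mon s (e i)) (f s)) :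
    HasNonnegCoeffs δ f := by
  have h0 := (h (fun _ => δ) fun i => (abs_of_pos hδ).le).summable
  have hfib : ∀ n, Summable fun i : {i // e i = n} => a i := by
    intro n
    have h1 : Summable fun i : {i // e i = n} => a i * mon (fun _ => δ) (e i) :=
      h0.comp_injective Subtype.val_injective
    have h2 := h1.mul_right (mon (fun _ => δ) n)⁻¹
    refine h2.congr fun i => ?_
    rw [i.2, mul_assoc, mul_inv_cancel₀ (mon_pos (fun _ => hδ) n).ne', mul_one]
  refine ⟨fun n => ∑' i : {i // e i = n}, a i, fun n => tsum_nonneg fun i => ha i, fun s hs => ?_⟩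
  have h1 := (Equiv.sigmaFiberEquiv e).hasSum_iff.2 (h s hs)
  refine h1.sigma fun n => ?_
  refine ((hfib n).hasSum.mul_right (mon s n)).congr_fun fun i => ?_
  simp [Equiv.sigmaFiberEquiv, i.2]

lemma const (hδ : 0 < δ) {c : ℝ} (hc : 0 ≤ c) : HasNonnegCoeffs (σ := σ) δ fun _ => c :=
  of_hasSum_mon hδ (ι := Unit) (fun _ => c) (fun _ => 0) (fun _ => hc) fun s _ => by
    simp [mon_zero]

lemma coord [DecidableEq σ] (hδ : 0 < δ) (j : σ) : HasNonnegCoeffs (σ := σ) δ fun s => s j :=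
  of_hasSum_mon hδ (ι := Unit) (fun _ => 1) (fun _ => Pi.single j 1) (fun _ => zero_le_one)
    fun s _ => by
      have : mon s (Pi.single j 1) = s j := by
        rw [mon, Finset.prod_eq_single j] <;> simp +contextual
      simp [this]

lemma mul (hδ : 0 < δ) (hf : HasNonnegCoeffs δ f) (hg : HasNonnegCoeffs δ g) :
    HasNonnegCoeffs δ fun s => f s * g s := by
  obtain ⟨F, hF, hF'⟩ := hf
  obtain ⟨G, hG, hG'⟩ := hg
  refine of_hasSum_mon hδ (ι := (σ → ℕ) × (σ → ℕ)) (fun i => F i.1 * G i.2)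
    (fun i => i.1 + i.2) (fun i => mul_nonneg (hF _) (hG _)) fun s hs => ?_
  have hsum := summable_mul_of_summable_norm (hF' s hs).summable.norm (hG' s hs).summable.norm
  have h1 := (hF' s hs).mul (hG' s hs) hsum
  refine h1.congr_fun fun i => ?_
  rw [mon_add]; ring

/-- With non-negative coefficients the double series at the corner `(δ, …, δ)` dominates the one at
every point of the box, so the order of summation is immaterial. -/
lemma hasSum (hδ : 0 < δ) {ι : Type*} {fs : ι → (σ → ℝ) → ℝ}
    (hfs : ∀ k, HasNonnegCoeffs δ (fs k))
    (h : ∀ s : σ → ℝ, (∀ i, |s i| ≤ δ) → HasSum (fun k => fs k s) (f s)) :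
    HasNonnegCoeffs δ f := by
  choose F hF hF' using hfs
  refine of_hasSum_mon hδ (ι := ι × (σ → ℕ)) (fun i => F i.1 i.2) (fun i => i.2)
    (fun i => hF _ _) fun s hs => ?_
  have hδ' : ∀ i : σ, |(fun _ : σ => δ) i| ≤ δ := fun i => (abs_of_pos hδ).le
  have h0 : Summable fun i : ι × (σ → ℕ) => F i.1 i.2 * mon (fun _ => δ) i.2 := by
    rw [summable_prod_of_nonneg fun i => mul_nonneg (hF _ _) (mon_nonneg (fun _ => hδ.le) _)]
    refine ⟨fun k => (hF' k _ hδ').summable, ?_⟩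
    refine (h _ hδ').summable.congr fun k => ?_
    rw [(hF' k _ hδ').tsum_eq]
  have h1 : Summable fun i : ι × (σ → ℕ) => F i.1 i.2 * mon s i.2 := by
    refine Summable.of_norm_bounded h0 fun i => ?_
    rw [Real.norm_eq_abs, abs_mul, abs_of_nonneg (hF _ _)]
    exact mul_le_mul_of_nonneg_left (mon_mono hs _) (hF _ _)
  have h2 := h1.hasSum.prod_fiberwise fun k => hF' k s hs
  rw [(h s hs).unique h2]
  exact h1.hasSum

lemma sum (hδ : 0 < δ) {ι : Type*} [Fintype ι] {fs : ι → (σ → ℝ) → ℝ}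
    (hfs : ∀ k, HasNonnegCoeffs δ (fs k)) : HasNonnegCoeffs δ fun s => ∑ k, fs k s :=
  hasSum hδ hfs fun _ _ => hasSum_fintype _

lemma pow (hδ : 0 < δ) (hf : HasNonnegCoeffs δ f) (k : ℕ) :
    HasNonnegCoeffs δ fun s => f s ^ k := by
  induction k with
  | zero => simpa using const hδ zero_le_one
  | succ k ih => simpa only [pow_succ] using mul hδ ih hf

lemma abs_le (hf : HasNonnegCoeffs δ f) (hδ : 0 ≤ δ) {s : σ → ℝ} (hs : ∀ i, |s i| ≤ δ) :
    |f s| ≤ f fun _ => δ := by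
  obtain ⟨F, hF, hF'⟩ := hf
  rw [← (hF' s hs).tsum_eq]
  have h := hF' (fun _ => δ) fun i => (abs_of_nonneg hδ).le
  rw [← Real.norm_eq_abs]
  refine tsum_of_norm_bounded h fun n => ?_
  rw [Real.norm_eq_abs, abs_mul, abs_of_nonneg (hF _)]
  exact mul_le_mul_of_nonneg_left (mon_mono hs _) (hF _)

/-- The binomial series of exponent `-β` has positive coefficients `(β)_k / k!`. The bound is needed
only at the corner, where `|f|` is largest. -/
lemma one_sub_rpow_neg (hδ : 0 < δ) (hf : HasNonnegCoeffs δ f) (h1 : f (fun _ => δ) < 1) {β : ℝ}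
    (hβ : 0 < β) : HasNonnegCoeffs δ fun s => (1 - f s) ^ (-β) := by
  refine hasSum hδ (fs := fun k s => (ascPochhammer ℝ k).eval β / k ! * f s ^ k) (fun k => ?_)
    fun s hs => hasSum_one_sub_rpow_neg β ((hf.abs_le hδ.le hs).trans_lt h1)
  exact mul hδ (const hδ (div_nonneg ((ascPochhammer_pos k β hβ).le) (by positivity)))
    (pow hδ hf k)

end HasNonnegCoeffs

end NonnegCoeffs

/-! ### Evaluation and majorants of formal power series. -/

section Evaluation

variable {σ : Type*} [Fintype σ]

/-- The weighted `ℓ¹` norm of the power series `F` at the polyradius `r` is at most `B`. -/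
def IsMajorized (r : σ → ℝ) (F : MvPowerSeries σ ℝ) (B : ℝ) : Prop :=
  (Summable fun n : σ →₀ ℕ => |MvPowerSeries.coeff n F| * mon r n) ∧
    ∑' n : σ →₀ ℕ, |MvPowerSeries.coeff n F| * mon r n ≤ B

/-- The power series `F` sums to `v` at `w`. -/
def HasEval (w : σ → ℝ) (F : MvPowerSeries σ ℝ) (v : ℝ) : Prop :=
  HasSum (fun n : σ →₀ ℕ => MvPowerSeries.coeff n F * mon w n) v

variable {r w : σ → ℝ} {F G : MvPowerSeries σ ℝ} {B B' v v' : ℝ}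

lemma IsMajorized.nonneg (hr : ∀ i, 0 ≤ r i) (h : IsMajorized r F B) : 0 ≤ B :=
  (tsum_nonneg fun _ => mul_nonneg (abs_nonneg _) (mon_nonneg hr _)).trans h.2

lemma IsMajorized.mono (h : IsMajorized r F B) (hB : B ≤ B') : IsMajorized r F B' :=
  ⟨h.1, h.2.trans hB⟩

lemma IsMajorized.of_hasSum {g : (σ →₀ ℕ) → ℝ} (hr : ∀ i, 0 ≤ r i) (h : HasSum g B)
    (hg : ∀ n : σ →₀ ℕ, |MvPowerSeries.coeff n F| * mon r n ≤ g n) : IsMajorized r F B := by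
  have hs : Summable fun n : σ →₀ ℕ => |MvPowerSeries.coeff n F| * mon r n :=
    Summable.of_nonneg_of_le (fun n => mul_nonneg (abs_nonneg _) (mon_nonneg hr _)) hg h.summable
  exact ⟨hs, hasSum_le hg hs.hasSum h⟩

lemma IsMajorized.coeff_le (h : IsMajorized r F B) (hr : ∀ i, 0 ≤ r i) (n : σ →₀ ℕ) :
    |MvPowerSeries.coeff n F| * mon r n ≤ B :=
  (h.1.le_tsum n fun _ _ => mul_nonneg (abs_nonneg _) (mon_nonneg hr _)).trans h.2

lemma IsMajorized.add (hr : ∀ i, 0 ≤ r i) (hF : IsMajorized r F B) (hG : IsMajorized r G B') :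
    IsMajorized r (F + G) (B + B') := by
  refine (IsMajorized.of_hasSum hr (hF.1.hasSum.add hG.1.hasSum) fun n => ?_).mono
    (add_le_add hF.2 hG.2)
  rw [map_add, ← add_mul]
  exact mul_le_mul_of_nonneg_right (abs_add_le _ _) (mon_nonneg hr _)

lemma hasSum_mul_antidiagonal {τ : Type*} [DecidableEq τ] {f g : (τ →₀ ℕ) → ℝ} {a b : ℝ} (hf : HasSum f a)
    (hg : HasSum g b) :
    HasSum (fun n => ∑ p ∈ Finset.HasAntidiagonal.antidiagonal n, f p.1 * g p.2) (a * b) := by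
  have hmul := summable_mul_of_summable_norm hf.summable.norm hg.summable.norm
  have h2 := (summable_sum_mul_antidiagonal_of_summable_mul hmul).hasSum
  have h3 := hf.summable.tsum_mul_tsum_eq_tsum_sum_antidiagonal hg.summable hmul
  rw [hf.tsum_eq, hg.tsum_eq] at h3
  rwa [← h3] at h2

lemma mul_mon_antidiagonal [DecidableEq σ] (f g : (σ →₀ ℕ) → ℝ) (w : σ → ℝ) (n : σ →₀ ℕ) :
    (∑ p ∈ Finset.HasAntidiagonal.antidiagonal n, f p.1 * g p.2) * mon w n =
      ∑ p ∈ Finset.HasAntidiagonal.antidiagonal n, f p.1 * mon w p.1 * (g p.2 * mon w p.2) := by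
  rw [Finset.sum_mul]
  refine Finset.sum_congr rfl fun p hp => ?_
  rw [← Finset.HasAntidiagonal.mem_antidiagonal.1 hp, Finsupp.coe_add, mon_add]
  ring

/-- The weighted `ℓ¹` norm is submultiplicative: the triangle inequality bounds the Cauchy product
by the Cauchy product of the absolute values. -/
lemma IsMajorized.mul (hr : ∀ i, 0 ≤ r i) (hF : IsMajorized r F B) (hG : IsMajorized r G B') :
    IsMajorized r (F * G) (B * B') := by
  classical
  refine (IsMajorized.of_hasSum hr (hasSum_mul_antidiagonal hF.1.hasSum hG.1.hasSum)
    fun n => ?_).mono (mul_le_mul hF.2 hG.2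
      (tsum_nonneg fun _ => mul_nonneg (abs_nonneg _) (mon_nonneg hr _)) (hF.nonneg hr))
  rw [← mul_mon_antidiagonal (fun n => |MvPowerSeries.coeff n F|)
    (fun n => |MvPowerSeries.coeff n G|), MvPowerSeries.coeff_mul]
  refine mul_le_mul_of_nonneg_right ?_ (mon_nonneg hr _)
  refine (Finset.abs_sum_le_sum_abs _ _).trans (le_of_eq ?_)
  simp only [abs_mul]

lemma HasEval.mul (hF : HasEval w F v) (hG : HasEval w G v') : HasEval w (F * G) (v * v') := by
  classical
  refine (hasSum_mul_antidiagonal hF hG).congr_fun fun n => ?_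
  rw [MvPowerSeries.coeff_mul, mul_mon_antidiagonal (fun n => MvPowerSeries.coeff n F)
    (fun n => MvPowerSeries.coeff n G)]

lemma HasEval.add (hF : HasEval w F v) (hG : HasEval w G v') : HasEval w (F + G) (v + v') :=
  (HasSum.add hF hG).congr_fun fun n => by rw [map_add, add_mul]

lemma hasEval_C_mul_X [DecidableEq σ] (a : ℝ) (j : σ) :
    HasEval w (MvPowerSeries.C a * MvPowerSeries.X j) (a * w j) := by
  have hm : mon w (Finsupp.single j 1) = w j := by
    rw [mon, Finset.prod_eq_single j] <;> simp +contextual [eq_comm]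
  have := hasSum_single (f := fun n : σ →₀ ℕ =>
    MvPowerSeries.coeff n (MvPowerSeries.C a * MvPowerSeries.X j) * mon w n)
    (Finsupp.single j 1) fun n hn => by
      simp [MvPowerSeries.coeff_C_mul, MvPowerSeries.coeff_X, hn]
  simpa [HasEval, MvPowerSeries.coeff_C_mul, MvPowerSeries.coeff_X, hm] using this

lemma isMajorized_C_mul_X [DecidableEq σ] (hr : ∀ i, 0 ≤ r i) (a : ℝ) (j : σ) :
    IsMajorized r (MvPowerSeries.C a * MvPowerSeries.X j) (|a| * r j) := by
  refine IsMajorized.of_hasSum hr (hasEval_C_mul_X |a| j) fun n => le_of_eq ?_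
  rw [MvPowerSeries.coeff_C_mul, MvPowerSeries.coeff_C_mul, MvPowerSeries.coeff_X]
  split_ifs <;> simp

lemma hasEval_one : HasEval w 1 1 := by
  classical
  have := hasSum_single (f := fun n : σ →₀ ℕ => MvPowerSeries.coeff n 1 * mon w n)
    0 fun n hn => by simp [MvPowerSeries.coeff_one, hn]
  simpa [HasEval, mon_zero] using this

lemma isMajorized_one (hr : ∀ i, 0 ≤ r i) : IsMajorized r 1 1 := by
  classical
  refine IsMajorized.of_hasSum hr (hasEval_one (w := r)) fun n => le_of_eq ?_
  rw [MvPowerSeries.coeff_one]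
  split_ifs <;> simp

lemma HasEval.pow (hF : HasEval w F v) (k : ℕ) : HasEval w (F ^ k) (v ^ k) := by
  induction k with
  | zero => simpa using hasEval_one
  | succ k ih => simpa only [pow_succ] using ih.mul hF

lemma IsMajorized.pow (hr : ∀ i, 0 ≤ r i) (hF : IsMajorized r F B) (k : ℕ) :
    IsMajorized r (F ^ k) (B ^ k) := by
  induction k with
  | zero => simpa using isMajorized_one hr
  | succ k ih => simpa only [pow_succ] using ih.mul hr hF

lemma HasEval.sum {ι : Type*} (s : Finset ι) {Fs : ι → MvPowerSeries σ ℝ} {vs : ι → ℝ}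
    (h : ∀ i ∈ s, HasEval w (Fs i) (vs i)) : HasEval w (∑ i ∈ s, Fs i) (∑ i ∈ s, vs i) := by
  refine (hasSum_sum h).congr_fun fun n => ?_
  rw [map_sum, Finset.sum_mul]

lemma IsMajorized.sum (hr : ∀ i, 0 ≤ r i) {ι : Type*} (s : Finset ι)
    {Fs : ι → MvPowerSeries σ ℝ} {Bs : ι → ℝ}
    (h : ∀ i ∈ s, IsMajorized r (Fs i) (Bs i)) :
    IsMajorized r (∑ i ∈ s, Fs i) (∑ i ∈ s, Bs i) := by
  classical
  induction s using Finset.induction_on with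
  | empty => exact IsMajorized.of_hasSum hr hasSum_zero fun n => by simp
  | insert a s ha ih =>
    rw [Finset.sum_insert ha, Finset.sum_insert ha]
    exact (h _ (by simp)).add hr (ih fun i hi => h i (by simp [hi]))

lemma HasEval.prod {ι : Type*} (s : Finset ι) {Fs : ι → MvPowerSeries σ ℝ} {vs : ι → ℝ}
    (h : ∀ i ∈ s, HasEval w (Fs i) (vs i)) : HasEval w (∏ i ∈ s, Fs i) (∏ i ∈ s, vs i) := by
  classical
  induction s using Finset.induction_on with
  | empty => simpa using hasEval_one
  | insert a s ha ih =>
    rw [Finset.prod_insert ha, Finset.prod_insert ha]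
    exact (h _ (by simp)).mul (ih fun i hi => h i (by simp [hi]))

lemma IsMajorized.prod (hr : ∀ i, 0 ≤ r i) {ι : Type*} (s : Finset ι)
    {Fs : ι → MvPowerSeries σ ℝ} {Bs : ι → ℝ}
    (h : ∀ i ∈ s, IsMajorized r (Fs i) (Bs i)) :
    IsMajorized r (∏ i ∈ s, Fs i) (∏ i ∈ s, Bs i) := by
  classical
  induction s using Finset.induction_on with
  | empty => simpa using isMajorized_one hr
  | insert a s ha ih =>
    rw [Finset.prod_insert ha, Finset.prod_insert ha]
    exact (h _ (by simp)).mul hr (ih fun i hi => h i (by simp [hi]))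

/-- A power series is determined by its sums on a box. -/
lemma ext_of_hasSum {F G : (σ →₀ ℕ) → ℝ} {ε : ℝ} (hε : 0 < ε) {f : (σ → ℝ) → ℝ}
    (hF : ∀ w : σ → ℝ, (∀ i, |w i| ≤ ε) → HasSum (fun n : σ →₀ ℕ => F n * mon w n) (f w))
    (hG : ∀ w : σ → ℝ, (∀ i, |w i| ≤ ε) → HasSum (fun n : σ →₀ ℕ => G n * mon w n) (f w))
    (n : σ →₀ ℕ) : F n = G n := by
  have h := coeff_eq_zero_of_hasSum_zero (F := fun k : σ → ℕ =>
    F (Finsupp.equivFunOnFinite.symm k) - G (Finsupp.equivFunOnFinite.symm k)) hε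
    (fun w hw => by
      have h := (hF w hw).sub (hG w hw)
      rw [sub_self] at h
      refine (Finsupp.equivFunOnFinite.symm.hasSum_iff.2 h).congr_fun fun k => ?_
      simp [sub_mul]) n
  simpa [sub_eq_zero] using h

end Evaluation

end MultivariateMeixner

namespace MultivariateMeixner

/-! ### The Meixner distribution, the generating function of the polynomials, and its majorant. -/

section Distribution

open Filter Topology

variable {m : ℕ} {α θ : ℝ} {p : Fin (m + 1) → ℝ} {u : Fin (m + 1) → Fin (m + 1) → ℝ}

lemma Gamma_add_nat_div (hα : 0 < α) (n : ℕ) :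
    Real.Gamma (α + n) / Real.Gamma α = (ascPochhammer ℝ n).eval α := by
  rw [div_eq_iff (Real.Gamma_pos_of_pos hα).ne']
  induction n with
  | zero => simp
  | succ n ih =>
    rw [Nat.cast_succ, ← add_assoc, Real.Gamma_add_one (by positivity), ih, ascPochhammer_succ_eval]
    ring

lemma meixnerProb_eq (hα : 0 < α) (hθ : 0 < θ) (x : Fin (m + 1) → ℕ) :
    meixnerProb α θ p x = (1 + θ) ^ (-α) *
      ((ascPochhammer ℝ (∑ i, x i)).eval α * ∏ i, (θ / (1 + θ) * p i) ^ x i / ((x i) ! : ℝ)) := by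
  have h := Nat.multinomial_spec Finset.univ x
  have h' : (∏ i, ((x i) ! : ℝ)) * (Nat.multinomial Finset.univ x : ℝ) = ((∑ i, x i) ! : ℕ) := by
    exact_mod_cast h
  have h1 : (∏ i, ((x i) ! : ℝ)) ≠ 0 := Finset.prod_ne_zero_iff.2 fun i _ => by positivity
  have h2 : (((∑ i, x i) ! : ℕ) : ℝ) ≠ 0 := by positivity
  have hθ' : (0:ℝ) < 1 + θ := by positivity
  rw [meixnerProb, ← div_div, Gamma_add_nat_div hα, Real.rpow_add hθ', Real.rpow_natCast,
    Real.rpow_neg hθ'.le, Finset.prod_div_distrib]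
  simp only [mul_pow, Finset.prod_mul_distrib, Finset.prod_div_distrib, div_pow,
    Finset.prod_pow_eq_pow_sum]
  have h3 : (1 + θ) ^ α ≠ 0 := (Real.rpow_pos_of_pos hθ' α).ne'
  have h4 : (Nat.multinomial Finset.univ x : ℝ) = ((∑ i, x i) ! : ℕ) / ∏ i, ((x i) ! : ℝ) := by
    rw [← h']; field_simp
  rw [h4]
  field_simp

lemma meixnerProb_pos (hα : 0 < α) (hθ : 0 < θ) (hp : ∀ j, 0 < p j) (x : Fin (m + 1) → ℕ) :
    0 < meixnerProb α θ p x := by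
  rw [meixnerProb_eq hα hθ]
  have h0 := ascPochhammer_pos (∑ i, x i) α hα
  have h1 : 0 < ∏ i, (θ / (1 + θ) * p i) ^ x i / ((x i) ! : ℝ) :=
    Finset.prod_pos fun i _ => by have := hp i; positivity
  positivity

/-- The probability generating function of the multivariate Meixner distribution. -/
lemma hasSum_meixnerProb_mul_mon (hα : 0 < α) (hθ : 0 < θ) (hp : ∀ j, 0 < p j)
    {s : Fin (m + 1) → ℝ} (hs : θ / (1 + θ) * ∑ i, p i * |s i| < 1) :
    HasSum (fun x => meixnerProb α θ p x * mon s x) ((1 + θ - θ * ∑ i, p i * s i) ^ (-α)) := by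
  have hθ' : (0:ℝ) < 1 + θ := by positivity
  have h0 := hasSum_negMultinomial α (fun i => θ / (1 + θ) * p i * s i) (by
    convert hs using 1
    rw [Finset.mul_sum]
    refine Finset.sum_congr rfl fun i _ => ?_
    rw [abs_mul, abs_of_pos (mul_pos (div_pos hθ hθ') (hp i)), mul_assoc])
  have h1 : (1 + θ - θ * ∑ i, p i * s i) = (1 + θ) * (1 - ∑ i, θ / (1 + θ) * p i * s i) := by
    simp only [mul_assoc]
    rw [← Finset.mul_sum]; field_simp
  have h2 : θ / (1 + θ) * ∑ i, p i * s i < 1 :=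
    lt_of_le_of_lt (mul_le_mul_of_nonneg_left (Finset.sum_le_sum fun i _ =>
      mul_le_mul_of_nonneg_left (le_abs_self _) (hp i).le) (by positivity)) hs
  rw [h1, Real.mul_rpow hθ'.le (by simp only [mul_assoc]; rw [← Finset.mul_sum]; linarith)]
  refine (h0.mul_left ((1 + θ) ^ (-α))).congr_fun fun x => ?_
  rw [meixnerProb_eq hα hθ, mon]
  simp only [mul_assoc, ← Finset.prod_mul_distrib]
  congr 2
  refine Finset.prod_congr rfl fun i _ => ?_
  rw [mul_pow, mul_pow, mul_pow]; ring

/-- The `i`-th factor `(1 - w₀ (1 + θ)/θ + ∑_{j ≥ 1} u_i^{(j)} w_j) / (1 - w₀)`. -/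
noncomputable def genFactor (θ : ℝ) (u : Fin (m + 1) → Fin (m + 1) → ℝ) (w : Fin (m + 1) → ℝ)
    (i : Fin (m + 1)) : ℝ :=
  (1 - (1 + θ) / θ * w 0 + ∑ j : Fin m, u j.succ i * w j.succ) / (1 - w 0)

/-- The majorant of `genFactor` at the polyradius `r`. -/
noncomputable def genMajorant (θ : ℝ) (u : Fin (m + 1) → Fin (m + 1) → ℝ) (r : Fin (m + 1) → ℝ)
    (i : Fin (m + 1)) : ℝ :=
  (1 + (1 + θ) / θ * r 0 + ∑ j : Fin m, |u j.succ i| * r j.succ) / (1 - r 0)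

lemma hasEval_negBinSeries {w : Fin (m + 1) → ℝ} (hw : |w 0| < 1) (c : ℝ) :
    HasEval w (negBinSeries m c) ((1 - w 0) ^ (-c)) := by
  have hinj : Function.Injective fun k : ℕ => (Finsupp.single (0 : Fin (m + 1)) k) :=
    Finsupp.single_injective 0
  unfold HasEval
  rw [← hinj.hasSum_iff]
  · refine (hasSum_one_sub_rpow_neg c hw).congr_fun fun k => ?_
    have hm : mon w (Finsupp.single (0 : Fin (m + 1)) k) = w 0 ^ k := by
      rw [mon, Finset.prod_eq_single 0] <;> simp +contextual [eq_comm]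
    simp [negBinSeries, MvPowerSeries.coeff_apply, hm]
  · intro n hn
    have : n ≠ Finsupp.single 0 (n 0) := fun h => hn ⟨n 0, h.symm⟩
    simp [negBinSeries, MvPowerSeries.coeff_apply, this]

lemma isMajorized_negBinSeries {r : Fin (m + 1) → ℝ} (hr : ∀ i, 0 ≤ r i) (hr0 : r 0 < 1) {c : ℝ}
    (hc : 0 < c) : IsMajorized r (negBinSeries m c) ((1 - r 0) ^ (-c)) := by
  refine IsMajorized.of_hasSum hr
    (hasEval_negBinSeries (w := r) (by rwa [abs_of_nonneg (hr 0)]) c) fun n => le_of_eq ?_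
  rw [abs_of_nonneg]
  simp only [negBinSeries, MvPowerSeries.coeff_apply]
  split_ifs
  · exact div_nonneg (ascPochhammer_pos _ c hc).le (by positivity)
  · rfl

/-- Distributing the power `|x|` of `1 - t` over the factors makes the generating function `(1 -
w₀)^{-α}` times a monomial with exponent `x`. Sums against `P` then become values of its probability
generating function. -/
lemma one_sub_rpow_mul_prod {t : ℝ} (ht : t < 1) (a : Fin (m + 1) → ℝ) (x : Fin (m + 1) → ℕ) :
    (1 - t) ^ (-((∑ i, x i : ℕ) + α)) * ∏ i, a i ^ x i =
      (1 - t) ^ (-α) * mon (fun i => a i / (1 - t)) x := by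
  have h : 0 < 1 - t := by linarith
  rw [neg_add, add_comm, Real.rpow_add h, Real.rpow_neg h.le (_ : ℕ), Real.rpow_natCast, mon]
  simp only [div_pow, Finset.prod_div_distrib, Finset.prod_pow_eq_pow_sum]
  field_simp

/-- The generating function of the multivariate Meixner polynomials. -/
lemma hasEval_meixnerGen {w : Fin (m + 1) → ℝ} (hw : |w 0| < 1) (x : Fin (m + 1) → ℕ) :
    HasEval w (meixnerGen α θ u x) ((1 - w 0) ^ (-α) * mon (genFactor θ u w) x) := by
  have h := (hasEval_negBinSeries hw ((∑ i, x i : ℕ) + α)).mul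
    (HasEval.prod Finset.univ fun i _ => HasEval.pow
      (F := 1 - MvPowerSeries.C ((1 + θ) / θ) * MvPowerSeries.X 0
        + ∑ j : Fin m, MvPowerSeries.C (u j.succ i) * MvPowerSeries.X j.succ)
      (v := 1 + (-((1 + θ) / θ)) * w 0 + ∑ j : Fin m, u j.succ i * w j.succ) (w := w) ?_ (x i))
  · rw [one_sub_rpow_mul_prod (abs_lt.1 hw).2] at h
    unfold meixnerGen genFactor
    simpa only [neg_mul, ← sub_eq_add_neg] using h
  · rw [sub_eq_add_neg, ← neg_mul, ← map_neg]
    exact (hasEval_one.add (hasEval_C_mul_X _ _)).add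
      (HasEval.sum _ fun j _ => hasEval_C_mul_X _ _)

lemma isMajorized_meixnerGen (hα : 0 < α) (hθ : 0 < θ) {r : Fin (m + 1) → ℝ} (hr : ∀ i, 0 ≤ r i)
    (hr0 : r 0 < 1) (x : Fin (m + 1) → ℕ) :
    IsMajorized r (meixnerGen α θ u x) ((1 - r 0) ^ (-α) * mon (genMajorant θ u r) x) := by
  have h := (isMajorized_negBinSeries hr hr0 (c := (∑ i, x i : ℕ) + α) (by positivity)).mul hr
    (IsMajorized.prod hr Finset.univ fun i _ => IsMajorized.pow (B := 1 + |-((1 + θ) / θ)| * r 0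
        + ∑ j : Fin m, |u j.succ i| * r j.succ) hr
      (F := 1 - MvPowerSeries.C ((1 + θ) / θ) * MvPowerSeries.X 0
        + ∑ j : Fin m, MvPowerSeries.C (u j.succ i) * MvPowerSeries.X j.succ)
       ?_ (x i))
  · rw [one_sub_rpow_mul_prod hr0, abs_neg, abs_of_pos (by positivity)] at h
    exact h
  · rw [sub_eq_add_neg, ← neg_mul, ← map_neg]
    exact ((isMajorized_one hr).add hr (isMajorized_C_mul_X hr _ _)).add hr
      (IsMajorized.sum hr _ fun j _ => isMajorized_C_mul_X hr _ _)

lemma genMajorant_nonneg (hθ : 0 < θ) {r : Fin (m + 1) → ℝ} (hr : ∀ i, 0 ≤ r i) (hr0 : r 0 < 1)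
    (i : Fin (m + 1)) : 0 ≤ genMajorant θ u r i := by
  have := hr 0
  have h2 : 0 ≤ ∑ j : Fin m, |u j.succ i| * r j.succ :=
    Finset.sum_nonneg fun j _ => mul_nonneg (abs_nonneg _) (hr _)
  exact div_nonneg (by positivity) (by linarith)

/-- Cauchy's estimate. It separates `n` from `x`, and the growth in `x` is geometric, hence
controlled by the probability generating function. -/
lemma abs_meixnerPoly_le (hα : 0 < α) (hθ : 0 < θ) {r : Fin (m + 1) → ℝ} (hr : ∀ i, 0 < r i)
    (hr0 : r 0 < 1) (n : Fin (m + 1) →₀ ℕ) (x : Fin (m + 1) → ℕ) :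
    |meixnerPoly α θ u n x| ≤
      (mon r n)⁻¹ * ((1 - r 0) ^ (-α) * mon (genMajorant θ u r) x) := by
  have h := (isMajorized_meixnerGen (u := u) hα hθ (fun i => (hr i).le) hr0 x).coeff_le
    (fun i => (hr i).le) n
  have h1 := mon_pos hr n
  rw [inv_mul_eq_div, le_div_iff₀ h1]
  exact h

/-- Fubini for double series, in the form needed for generating functions: `b x` majorizes the inner
absolute sum, and only `∑ |f x| b x` has to converge. -/
lemma hasSum_tsum_comm {X N : Type*} {f g b : X → ℝ} {A : X → N → ℝ}
    (hA : ∀ x, Summable fun n => |A x n|) (hb : ∀ x, ∑' n, |A x n| ≤ b x)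
    (hg : ∀ x, HasSum (A x) (g x)) (hf : Summable fun x => |f x| * b x) :
    HasSum (fun n => ∑' x, f x * A x n) (∑' x, f x * g x) := by
  have hsum : Summable fun z : X × N => |f z.1| * |A z.1 z.2| := by
    rw [summable_prod_of_nonneg fun z => mul_nonneg (abs_nonneg _) (abs_nonneg _)]
    refine ⟨fun x => (hA x).mul_left (|f x|), ?_⟩
    have h1 : (fun x => ∑' n, |f x| * |A x n|) = fun x => |f x| * ∑' n, |A x n| :=
      funext fun x => tsum_mul_left
    have h2 : ∀ x, 0 ≤ ∑' n, |A x n| := fun x => tsum_nonneg fun n => abs_nonneg _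
    change Summable fun x => ∑' n, |f x| * |A x n|
    rw [h1]
    exact Summable.of_nonneg_of_le (fun x => mul_nonneg (abs_nonneg _) (h2 x))
      (fun x => mul_le_mul_of_nonneg_left (hb x) (abs_nonneg _)) hf
  have hsum' : Summable fun z : X × N => f z.1 * A z.1 z.2 :=
    Summable.of_abs (hsum.congr fun z => (abs_mul _ _).symm)
  have h2 := hsum'.hasSum.prod_fiberwise fun x => (hg x).mul_left (f x)
  have h3 : HasSum (fun z : N × X => f z.2 * A z.2 z.1) (∑' z : X × N, f z.1 * A z.1 z.2) :=
    (Equiv.prodComm N X).hasSum_iff.2 hsum'.hasSum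
  rw [h2.tsum_eq]
  exact h3.prod_fiberwise fun n => (h3.summable.prod_factor n).hasSum

/-- Summation against the generating function of the Meixner polynomials. -/
lemma hasSum_exchange (hα : 0 < α) (hθ : 0 < θ) {r : Fin (m + 1) → ℝ} (hr : ∀ i, 0 < r i)
    (hr0 : r 0 < 1) {f : (Fin (m + 1) → ℕ) → ℝ}
    (hf : Summable fun x => |f x| * mon (genMajorant θ u r) x) :
    (∀ n, Summable fun x => f x * meixnerPoly α θ u n x) ∧
      ∀ w : Fin (m + 1) → ℝ, (∀ i, |w i| ≤ r i) →
        HasSum (fun n : Fin (m + 1) →₀ ℕ => (∑' x, f x * meixnerPoly α θ u n x) * mon w n)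
          (∑' x, f x * ((1 - w 0) ^ (-α) * mon (genFactor θ u w) x)) := by
  have hr' : ∀ i, 0 ≤ r i := fun i => (hr i).le
  refine ⟨fun n => ?_, fun w hw => ?_⟩
  · refine Summable.of_norm_bounded (hf.mul_right ((mon r n)⁻¹ * (1 - r 0) ^ (-α))) fun x => ?_
    rw [norm_mul, Real.norm_eq_abs, Real.norm_eq_abs, mul_assoc]
    refine mul_le_mul_of_nonneg_left ((abs_meixnerPoly_le hα hθ hr hr0 n x).trans_eq ?_)
      (abs_nonneg _)
    ring
  have hM := fun x => isMajorized_meixnerGen (u := u) hα hθ hr' hr0 x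
  have hle : ∀ x (n : Fin (m + 1) →₀ ℕ), |meixnerPoly α θ u n x * mon w n| ≤
      |meixnerPoly α θ u n x| * mon r n := fun x n => by
    rw [abs_mul]; exact mul_le_mul_of_nonneg_left (mon_mono hw _) (abs_nonneg _)
  have hA : ∀ x, Summable fun n : Fin (m + 1) →₀ ℕ => |meixnerPoly α θ u n x * mon w n| :=
    fun x => Summable.of_nonneg_of_le (fun _ => abs_nonneg _) (hle x) (hM x).1
  have h := hasSum_tsum_comm (f := f) (A := fun x (n : Fin (m + 1) →₀ ℕ) =>
      meixnerPoly α θ u n x * mon w n) hA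
    (fun x => ((hA x).tsum_le_tsum (hle x) (hM x).1).trans (hM x).2)
    (fun x => hasEval_meixnerGen (α := α) (θ := θ) (u := u) ((hw 0).trans_lt hr0) x)
    ((hf.mul_left ((1 - r 0) ^ (-α))).congr fun x => by ring)
  refine h.congr_fun fun n => ?_
  rw [← tsum_mul_right]
  refine tsum_congr fun x => by ring

/-- Since the limit is `1`, any strict convergence condition survives the insertion of the majorant
at a sufficiently small polyradius. -/
lemma tendsto_genMajorant_const (i : Fin (m + 1)) :
    Tendsto (fun t : ℝ => genMajorant θ u (fun _ => t) i) (𝓝[>] 0) (𝓝 1) := by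
  have : ContinuousAt (fun t : ℝ => genMajorant θ u (fun _ => t) i) 0 := by
    unfold genMajorant
    exact ContinuousAt.div (by fun_prop) (by fun_prop) (by norm_num)
  have h := this.tendsto.mono_left (nhdsWithin_le_nhds (s := Set.Ioi 0))
  simpa [genMajorant] using h

end Distribution

end MultivariateMeixner

namespace MultivariateMeixner

/-! ### Transforms of the Meixner polynomials and their orthogonality. -/

section Orthogonality

open Filter Topology

variable {m : ℕ} {α θ : ℝ} {p : Fin (m + 1) → ℝ} {u : Fin (m + 1) → Fin (m + 1) → ℝ}

/-- `1 + θ - θ ∑ p_i s_i`. -/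
noncomputable def pgfBase (θ : ℝ) (p s : Fin (m + 1) → ℝ) : ℝ := 1 + θ - θ * ∑ i, p i * s i

/-- `T_j(s) = ∑_i p_i s_i u_i^{(j)}`. -/
noncomputable def basisTransform (p : Fin (m + 1) → ℝ) (u : Fin (m + 1) → Fin (m + 1) → ℝ)
    (s : Fin (m + 1) → ℝ) (j : Fin (m + 1)) : ℝ := ∑ i, p i * s i * u j i

/-- The vector whose monomials occur in the transforms of the Meixner polynomials. -/
noncomputable def transVec (θ : ℝ) (p : Fin (m + 1) → ℝ) (u : Fin (m + 1) → Fin (m + 1) → ℝ)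
    (s : Fin (m + 1) → ℝ) : Fin (m + 1) → ℝ :=
  Fin.cons ((1 + θ) * (1 - ∑ i, p i * s i) / pgfBase θ p s)
    fun j : Fin m => θ * basisTransform p u s j.succ / pgfBase θ p s

/-- The coefficient `(α)_{|n|} / ∏ n_j!`. -/
noncomputable def negMultinomialCoeff (α : ℝ) (n : Fin (m + 1) →₀ ℕ) : ℝ :=
  (ascPochhammer ℝ (∑ i, n i)).eval α / ∏ i, ((n i) ! : ℝ)

lemma negMultinomialCoeff_pos (hα : 0 < α) (n : Fin (m + 1) →₀ ℕ) :
    0 < negMultinomialCoeff α n :=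
  div_pos (ascPochhammer_pos _ α hα) (Finset.prod_pos fun i _ => by positivity)

lemma hasSum_negMultinomialCoeff (α : ℝ) (z : Fin (m + 1) → ℝ) (hz : ∑ i, |z i| < 1) :
    HasSum (fun n : Fin (m + 1) →₀ ℕ => negMultinomialCoeff α n * mon z n)
      ((1 - ∑ i, z i) ^ (-α)) := by
  refine (Finsupp.equivFunOnFinite.hasSum_iff.2 (hasSum_negMultinomial α z hz)).congr_fun
    fun n => ?_
  simp [negMultinomialCoeff, mon, Finset.prod_div_distrib, div_mul_eq_mul_div, mul_div_assoc]

lemma pgfBase_pos (hθ : 0 < θ) (hp : ∀ j, 0 < p j) {s : Fin (m + 1) → ℝ}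
    (hs : θ / (1 + θ) * ∑ i, p i * |s i| < 1) : 0 < pgfBase θ p s := by
  have h1 : ∑ i, p i * s i ≤ ∑ i, p i * |s i| := Finset.sum_le_sum fun i _ =>
    mul_le_mul_of_nonneg_left (le_abs_self _) (hp i).le
  rw [div_mul_eq_mul_div, div_lt_one (by positivity)] at hs
  have := mul_le_mul_of_nonneg_left h1 hθ.le
  unfold pgfBase; linarith

lemma abs_genFactor_le (hθ : 0 < θ) {r w : Fin (m + 1) → ℝ} (hr0 : r 0 < 1)
    (hw : ∀ i, |w i| ≤ r i) (i : Fin (m + 1)) : |genFactor θ u w i| ≤ genMajorant θ u r i := by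
  have h0 := abs_le.1 (hw 0)
  have hc : 0 < (1 + θ) / θ := by positivity
  rw [genFactor, genMajorant, abs_div, abs_of_pos (by linarith : 0 < 1 - w 0)]
  have h1 : |1 - (1 + θ) / θ * w 0| ≤ 1 + (1 + θ) / θ * r 0 := by
    refine (abs_sub _ _).trans ?_
    rw [abs_one, abs_mul, abs_of_pos hc]
    have := mul_le_mul_of_nonneg_left (hw 0) hc.le
    linarith
  have h2 : |∑ j : Fin m, u j.succ i * w j.succ| ≤ ∑ j : Fin m, |u j.succ i| * r j.succ := by
    refine (Finset.abs_sum_le_sum_abs _ _).trans (Finset.sum_le_sum fun j _ => ?_)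
    rw [abs_mul]; exact mul_le_mul_of_nonneg_left (hw _) (abs_nonneg _)
  have h3 := (abs_add_le (1 - (1 + θ) / θ * w 0) (∑ j : Fin m, u j.succ i * w j.succ)).trans
    (add_le_add h1 h2)
  exact div_le_div₀ ((abs_nonneg _).trans h3) h3 (by linarith) (by linarith)

/-- The base is affine in `s`, and each `G_i(w)` is affine in `w` over the common denominator `1 -
w₀`. After clearing that denominator the result is affine in `w`, so its power `-α` is a negative
multinomial series whose coefficients are monomials in `transVec`. -/
lemma pgfBase_mul_genFactor (hθ : 0 < θ) {s w : Fin (m + 1) → ℝ} (hw : w 0 < 1)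
    (hD : pgfBase θ p s ≠ 0) :
    (1 - w 0) * pgfBase θ p (fun i => s i * genFactor θ u w i) =
      pgfBase θ p s * (1 - ∑ j, transVec θ p u s j * w j) := by
  have h1 : 1 - w 0 ≠ 0 := by linarith
  have e1 : ∑ i, p i * (s i * genFactor θ u w i) =
      ((1 - (1 + θ) / θ * w 0) * ∑ i, p i * s i +
        ∑ j : Fin m, basisTransform p u s j.succ * w j.succ) / (1 - w 0) := by
    simp only [genFactor, basisTransform, Finset.sum_mul, Finset.mul_sum]
    rw [Finset.sum_comm, ← Finset.sum_add_distrib, Finset.sum_div]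
    refine Finset.sum_congr rfl fun i _ => ?_
    rw [mul_div_assoc', mul_div_assoc', mul_add, mul_add, Finset.mul_sum, Finset.mul_sum]
    congr 2
    · ring
    · exact Finset.sum_congr rfl fun j _ => by ring
  have e2 : pgfBase θ p s * ∑ j, transVec θ p u s j * w j =
      (1 + θ) * (1 - ∑ i, p i * s i) * w 0 +
        θ * ∑ j : Fin m, basisTransform p u s j.succ * w j.succ := by
    rw [Fin.sum_univ_succ, mul_add, Finset.mul_sum, Finset.mul_sum]
    simp only [transVec, Fin.cons_zero, Fin.cons_succ]
    congr 1
    · field_simp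
    · refine Finset.sum_congr rfl fun j _ => by field_simp
  rw [mul_sub, mul_one, e2, pgfBase, pgfBase, e1]
  field_simp
  ring

/-- The transform `∑_x P(x) s^x M_n(x)` of the Meixner polynomials. -/
lemma hasSum_meixner_transform (hα : 0 < α) (hθ : 0 < θ) (hp : ∀ j, 0 < p j)
    {s : Fin (m + 1) → ℝ} (hs : θ / (1 + θ) * ∑ i, p i * |s i| < 1) (n : Fin (m + 1) →₀ ℕ) :
    HasSum (fun x => meixnerProb α θ p x * mon s x * meixnerPoly α θ u n x)
      (pgfBase θ p s ^ (-α) * (negMultinomialCoeff α n * mon (transVec θ p u s) n)) := by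
  have hD := pgfBase_pos hθ hp hs
  have ht1 : Tendsto (fun t : ℝ => θ / (1 + θ) * ∑ i, p i * (|s i| * genMajorant θ u (fun _ => t) i))
      (𝓝[>] 0) (𝓝 (θ / (1 + θ) * ∑ i, p i * (|s i| * 1))) :=
    (tendsto_finsetSum _ fun i _ =>
      ((tendsto_genMajorant_const i).const_mul _).const_mul _).const_mul _
  have ht2 : Tendsto (fun t : ℝ => t * ∑ j, |transVec θ p u s j|) (𝓝[>] 0) (𝓝 0) := by
    have : Tendsto (fun t : ℝ => t * ∑ j, |transVec θ p u s j|) (𝓝 0)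
      (𝓝 (0 * ∑ j, |transVec θ p u s j|)) := tendsto_id.mul_const _
    rw [zero_mul] at this
    exact this.mono_left nhdsWithin_le_nhds
  have hlt : ∀ᶠ t : ℝ in 𝓝[>] 0, t < 1 := Ioo_mem_nhdsGT one_pos |> fun h =>
    mem_of_superset h fun t ht => ht.2
  -- A common radius `t`: `h1` dominates the exchange of sums, `h2` makes the negative multinomial
  -- series converge, and `h3` keeps `1 - w₀` positive.
  obtain ⟨t, h1, h2, h3, h4⟩ := ((ht1.eventually (gt_mem_nhds (by simpa using hs))).and
    ((ht2.eventually (gt_mem_nhds one_pos)).and (hlt.and self_mem_nhdsWithin))).exists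
  have ht0 : (0:ℝ) < t := h4
  have hG := fun i => genMajorant_nonneg (u := u) hθ (r := fun _ : Fin (m + 1) => t)
    (fun _ => ht0.le) h3 i
  have hf : Summable fun x => |meixnerProb α θ p x * mon s x| *
      mon (genMajorant θ u fun _ => t) x := by
    have := hasSum_meixnerProb_mul_mon hα hθ hp
      (s := fun i => |s i| * genMajorant θ u (fun _ => t) i) (by
        simpa only [abs_mul, abs_abs, abs_of_nonneg (hG _)] using h1)
    refine this.summable.congr fun x => ?_
    rw [abs_mul, abs_of_pos (meixnerProb_pos hα hθ hp x), mon_mul, mon_abs, mul_assoc]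
  obtain ⟨hsum, hw⟩ := hasSum_exchange (u := u) hα hθ (r := fun _ => t) (fun _ => ht0) h3 hf
  refine (hsum n).hasSum_iff.2 ?_
  refine ext_of_hasSum (G := fun n : Fin (m + 1) →₀ ℕ =>
    pgfBase θ p s ^ (-α) * (negMultinomialCoeff α n * mon (transVec θ p u s) n)) ht0 hw
    (fun w hwt => ?_) n
  have hw0 : w 0 < 1 := ((le_abs_self _).trans (hwt 0)).trans_lt h3
  have hle := abs_genFactor_le (u := u) hθ (r := fun _ => t) h3 hwt
  have hs' : θ / (1 + θ) * ∑ i, p i * |s i * genFactor θ u w i| < 1 := by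
    refine lt_of_le_of_lt (mul_le_mul_of_nonneg_left (Finset.sum_le_sum fun i _ => ?_)
      (by positivity)) h1
    rw [abs_mul]
    exact mul_le_mul_of_nonneg_left (mul_le_mul_of_nonneg_left (hle i) (abs_nonneg _)) (hp i).le
  have hv := (hasSum_meixnerProb_mul_mon hα hθ hp hs').mul_left ((1 - w 0) ^ (-α))
  have hz : ∑ j, |transVec θ p u s j * w j| < 1 := by
    refine lt_of_le_of_lt ?_ h2
    rw [Finset.mul_sum]
    refine Finset.sum_le_sum fun j _ => ?_
    rw [abs_mul, mul_comm]
    exact mul_le_mul_of_nonneg_right (hwt j) (abs_nonneg _)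
  have hpos : ∑ j, transVec θ p u s j * w j < 1 :=
    ((le_abs_self _).trans (Finset.abs_sum_le_sum_abs _ _)).trans_lt hz
  have hval : ∑' x, meixnerProb α θ p x * mon s x *
      ((1 - w 0) ^ (-α) * mon (genFactor θ u w) x) =
      pgfBase θ p s ^ (-α) * (1 - ∑ j, transVec θ p u s j * w j) ^ (-α) := by
    rw [← Real.mul_rpow hD.le (by linarith), ← pgfBase_mul_genFactor hθ hw0 hD.ne',
      Real.mul_rpow (by linarith) (pgfBase_pos hθ hp hs').le, pgfBase, ← hv.tsum_eq]
    refine tsum_congr fun x => ?_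
    rw [mon_mul]; ring
  rw [hval]
  refine ((hasSum_negMultinomialCoeff α _ hz).mul_left (pgfBase θ p s ^ (-α))).congr_fun
    fun k => ?_
  rw [mon_mul]; ring

/-- `b_0 = (1 + θ)/θ` and `b_j = θ a_j` for `j ≥ 1`. -/
noncomputable def normVec (θ : ℝ) (p : Fin (m + 1) → ℝ) (u : Fin (m + 1) → Fin (m + 1) → ℝ) :
    Fin (m + 1) → ℝ :=
  Fin.cons ((1 + θ) / θ) fun j : Fin m => θ * sqNorm p u j.succ

lemma meixnerSqNorm_eq (hα : 0 < α) (n : Fin (m + 1) →₀ ℕ) :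
    meixnerSqNorm α θ p u n = negMultinomialCoeff α n * mon (normVec θ p u) n := by
  have h : mon (normVec θ p u) n = ((1 + θ) / θ) ^ n 0 * (θ ^ (∑ j : Fin m, n j.succ) *
      ∏ j : Fin m, sqNorm p u j.succ ^ n j.succ) := by
    rw [mon, Fin.prod_univ_succ]
    simp only [normVec, Fin.cons_zero, Fin.cons_succ, mul_pow, Finset.prod_mul_distrib,
      Finset.prod_pow_eq_pow_sum]
  rw [meixnerSqNorm, h, ← div_div, add_comm _ α, Gamma_add_nat_div hα, negMultinomialCoeff]
  ring

lemma sqNorm_pos (hu : IsOrthogonalBasis p u) (k : Fin (m + 1)) : 0 < sqNorm p u k := by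
  refine Finset.sum_pos' (fun j _ => mul_nonneg (mul_self_nonneg _) (hu.p_pos j).le)
    ⟨Fin.last m, Finset.mem_univ _, ?_⟩
  rw [hu.u_last]; simpa using hu.p_pos _

lemma sqNorm_zero (hu : IsOrthogonalBasis p u) : sqNorm p u 0 = 1 := by
  simp [sqNorm, hu.u_zero, hu.p_sum]

lemma normVec_pos (hu : IsOrthogonalBasis p u) (hθ : 0 < θ) (j : Fin (m + 1)) :
    0 < normVec θ p u j := by
  refine Fin.cases ?_ (fun j => ?_) j
  · simp only [normVec, Fin.cons_zero]; positivity
  · simp only [normVec, Fin.cons_succ]; exact mul_pos hθ (sqNorm_pos hu _)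

lemma meixnerSqNorm_pos (hu : IsOrthogonalBasis p u) (hα : 0 < α) (hθ : 0 < θ)
    (n : Fin (m + 1) →₀ ℕ) : 0 < meixnerSqNorm α θ p u n := by
  rw [meixnerSqNorm_eq hα]
  exact mul_pos (negMultinomialCoeff_pos hα n) (mon_pos (normVec_pos hu hθ) _)

lemma meixnerH_pos (hu : IsOrthogonalBasis p u) (hα : 0 < α) (hθ : 0 < θ)
    (n : Fin (m + 1) →₀ ℕ) : 0 < meixnerH α θ p u n :=
  inv_pos.2 (meixnerSqNorm_pos hu hα hθ n)

lemma sum_p_mul_genFactor (hu : IsOrthogonalBasis p u) (z : Fin (m + 1) → ℝ) :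
    ∑ i, p i * genFactor θ u z i = (1 - (1 + θ) / θ * z 0) / (1 - z 0) := by
  have h : ∀ j : Fin m, ∑ i, p i * (u j.succ i * z j.succ) = 0 := fun j => by
    have := hu.orth 0 j.succ (Fin.succ_ne_zero j).symm
    simp only [hu.u_zero, one_mul] at this
    calc _ = (∑ i, u j.succ i * p i) * z j.succ := by
          rw [Finset.sum_mul]; exact Finset.sum_congr rfl fun i _ => by ring
      _ = 0 := by rw [this, zero_mul]
  simp only [genFactor, mul_div_assoc', ← Finset.sum_div, mul_add, Finset.sum_add_distrib]
  simp only [Finset.mul_sum]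
  rw [Finset.sum_comm (s := Finset.univ) (t := (Finset.univ : Finset (Fin m)))]
  simp only [h, Finset.sum_const_zero, add_zero, ← Finset.sum_mul, hu.p_sum, one_mul]

/-- Pairing with `u^{(k+1)}` kills the constant part of the numerator and all linear terms but one,
by orthogonality of the basis. -/
lemma basisTransform_genFactor (hu : IsOrthogonalBasis p u) (z : Fin (m + 1) → ℝ) (k : Fin m) :
    basisTransform p u (genFactor θ u z) k.succ = sqNorm p u k.succ * z k.succ / (1 - z 0) := by
  have h0 : ∑ i, p i * u k.succ i = 0 := by
    have := hu.orth 0 k.succ (Fin.succ_ne_zero k).symm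
    simp only [hu.u_zero, one_mul] at this
    rw [← this]; exact Finset.sum_congr rfl fun i _ => by ring
  have h : ∀ j : Fin m, ∑ i, p i * (u j.succ i * z j.succ) * u k.succ i =
      if j = k then sqNorm p u k.succ * z k.succ else 0 := fun j => by
    split_ifs with hjk
    · subst hjk
      rw [sqNorm, Finset.sum_mul]; exact Finset.sum_congr rfl fun i _ => by ring
    · have := hu.orth j.succ k.succ fun h => hjk (Fin.succ_injective _ h)
      calc _ = (∑ i, u j.succ i * u k.succ i * p i) * z j.succ := by
            rw [Finset.sum_mul]; exact Finset.sum_congr rfl fun i _ => by ring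
        _ = 0 := by rw [this, zero_mul]
  simp only [basisTransform, genFactor]
  generalize (1 + θ) / θ = c
  simp only [mul_div_assoc', div_mul_eq_mul_div, ← Finset.sum_div,
    mul_add, add_mul, Finset.sum_add_distrib]
  simp only [Finset.mul_sum, Finset.sum_mul]
  rw [Finset.sum_comm (s := Finset.univ) (t := (Finset.univ : Finset (Fin m)))]
  simp only [h, Finset.sum_ite_eq', Finset.mem_univ, if_true]
  have h5 : ∑ i, p i * (1 - c * z 0) * u k.succ i = 0 := by
    calc _ = (1 - c * z 0) * ∑ i, p i * u k.succ i := by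
          rw [Finset.mul_sum]; exact Finset.sum_congr rfl fun i _ => by ring
      _ = 0 := by rw [h0, mul_zero]
  rw [h5, zero_add]

lemma pgfBase_genFactor (hu : IsOrthogonalBasis p u) (hθ : 0 < θ) {z : Fin (m + 1) → ℝ}
    (hz : z 0 < 1) : pgfBase θ p (genFactor θ u z) = (1 - z 0)⁻¹ := by
  have : 1 - z 0 ≠ 0 := by linarith
  rw [pgfBase, sum_p_mul_genFactor hu]
  field_simp; ring

/-- This linearization is the source of orthogonality: the transform of `M_n` at `s = G(z)` contains
the single monomial `z^n`. -/
lemma transVec_genFactor (hu : IsOrthogonalBasis p u) (hθ : 0 < θ) {z : Fin (m + 1) → ℝ}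
    (hz : z 0 < 1) : transVec θ p u (genFactor θ u z) = fun j => normVec θ p u j * z j := by
  have h1 : 1 - z 0 ≠ 0 := by linarith
  funext j
  rw [transVec, pgfBase_genFactor hu hθ hz]
  refine Fin.cases ?_ (fun j => ?_) j
  · simp only [normVec, Fin.cons_zero, sum_p_mul_genFactor hu]
    field_simp; ring
  · simp only [normVec, Fin.cons_succ, basisTransform_genFactor hu]
    field_simp

/-- The orthogonality of the Meixner polynomials. -/
lemma hasSum_meixner_orthogonality (hu : IsOrthogonalBasis p u) (hα : 0 < α) (hθ : 0 < θ)
    (n k : Fin (m + 1) →₀ ℕ) :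
    HasSum (fun x => meixnerProb α θ p x * meixnerPoly α θ u n x * meixnerPoly α θ u k x)
      (if k = n then meixnerSqNorm α θ p u n else 0) := by
  have hp := hu.p_pos
  -- The majorant enters twice: once through the bound on `M_n`, once through the generating
  -- function summed against it.
  have ht1 : Tendsto (fun t : ℝ => θ / (1 + θ) * ∑ i, p i * (genMajorant θ u (fun _ => t) i *
      genMajorant θ u (fun _ => t) i)) (𝓝[>] 0) (𝓝 (θ / (1 + θ) * ∑ i, p i * (1 * 1))) :=
    (tendsto_finsetSum _ fun i _ =>
      ((tendsto_genMajorant_const i).mul (tendsto_genMajorant_const i)).const_mul _).const_mul _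
  have ht2 : Tendsto (fun t : ℝ => θ / (1 + θ) * ∑ i, p i * (genMajorant θ u (fun _ => t) i))
      (𝓝[>] 0) (𝓝 (θ / (1 + θ) * ∑ i, p i * 1)) :=
    (tendsto_finsetSum _ fun i _ => (tendsto_genMajorant_const i).const_mul _).const_mul _
  have hlt : ∀ᶠ t : ℝ in 𝓝[>] 0, t < 1 := Ioo_mem_nhdsGT one_pos |> fun h =>
    mem_of_superset h fun t ht => ht.2
  have hq : θ / (1 + θ) < 1 := by rw [div_lt_one (by positivity)]; linarith
  obtain ⟨t, h1, h2, h3, h4⟩ := ((ht1.eventually (gt_mem_nhds (by simpa [hu.p_sum] using hq))).and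
    ((ht2.eventually (gt_mem_nhds (by simpa [hu.p_sum] using hq))).and
      (hlt.and self_mem_nhdsWithin))).exists
  have ht0 : (0:ℝ) < t := h4
  have hG := fun i => genMajorant_nonneg (u := u) hθ (r := fun _ : Fin (m + 1) => t)
    (fun _ => ht0.le) h3 i
  have hf : Summable fun x => |meixnerProb α θ p x * meixnerPoly α θ u n x| *
      mon (genMajorant θ u fun _ => t) x := by
    have := (hasSum_meixnerProb_mul_mon hα hθ hp
      (s := fun i => genMajorant θ u (fun _ => t) i * genMajorant θ u (fun _ => t) i) (by
        simpa only [abs_mul, abs_of_nonneg (hG _)] using h1)).summable.mul_left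
        ((mon (fun _ => t) n)⁻¹ * (1 - t) ^ (-α))
    refine Summable.of_nonneg_of_le (fun x => mul_nonneg (abs_nonneg _) (mon_nonneg hG x))
      (fun x => ?_) this
    rw [abs_mul, abs_of_pos (meixnerProb_pos hα hθ hp x), mon_mul]
    have hb := abs_meixnerPoly_le (u := u) hα hθ (r := fun _ => t) (fun _ => ht0) h3 n x
    have := mul_le_mul_of_nonneg_left hb (meixnerProb_pos hα hθ hp x).le
    refine (mul_le_mul_of_nonneg_right this (mon_nonneg hG x)).trans_eq (by ring)
  obtain ⟨hsum, hw⟩ := hasSum_exchange (u := u) hα hθ (r := fun _ => t) (fun _ => ht0) h3 hf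
  refine (hsum k).hasSum_iff.2 ?_
  refine ext_of_hasSum (G := fun k : Fin (m + 1) →₀ ℕ =>
    if k = n then meixnerSqNorm α θ p u n else 0) ht0 hw (fun z hz => ?_) k
  have hz0 : z 0 < 1 := ((le_abs_self _).trans (hz 0)).trans_lt h3
  have hz1 : 0 < 1 - z 0 := by linarith
  have hle := abs_genFactor_le (u := u) hθ (r := fun _ => t) h3 hz
  have hs' : θ / (1 + θ) * ∑ i, p i * |genFactor θ u z i| < 1 :=
    lt_of_le_of_lt (mul_le_mul_of_nonneg_left (Finset.sum_le_sum fun i _ =>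
      mul_le_mul_of_nonneg_left (hle i) (hp i).le) (by positivity)) h2
  -- At `s = G(z)` the factors `(1 - z₀)^{∓α}` cancel, leaving the squared norm times `z^n`;
  -- coefficients of `z^k` can then be compared.
  have hT := (hasSum_meixner_transform (u := u) hα hθ hp hs' n).mul_left ((1 - z 0) ^ (-α))
  rw [pgfBase_genFactor hu hθ hz0, transVec_genFactor hu hθ hz0, Real.inv_rpow hz1.le,
    ← mul_assoc ((1 - z 0) ^ (-α)), mul_inv_cancel₀ (Real.rpow_pos_of_pos hz1 _).ne', one_mul,
    mon_mul, ← mul_assoc, ← meixnerSqNorm_eq hα] at hT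
  have hval : ∑' x, meixnerProb α θ p x * meixnerPoly α θ u n x *
      ((1 - z 0) ^ (-α) * mon (genFactor θ u z) x) = meixnerSqNorm α θ p u n * mon z n := by
    rw [← hT.tsum_eq]; exact tsum_congr fun x => by ring
  rw [hval]
  have := hasSum_single (f := fun k : Fin (m + 1) →₀ ℕ =>
    (if k = n then meixnerSqNorm α θ p u n else 0) * mon z k) n fun k hk => by simp [hk]
  simpa using this

end Orthogonality

end MultivariateMeixner

namespace MultivariateMeixner

/-! ### Hilbert space arguments: convergence, marginals and correlations. -/

section Lancaster

open Filter Topology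

variable {m : ℕ} {α θ : ℝ} {p : Fin (m + 1) → ℝ} {u : Fin (m + 1) → Fin (m + 1) → ℝ}
  {ρ : (Fin (m + 1) →₀ ℕ) → ℝ}

lemma real_inner_eq_mul (a b : ℝ) : inner ℝ a b = a * b := by simp [mul_comm]

lemma meixnerPoly_zero (x : Fin (m + 1) → ℕ) : meixnerPoly α θ u 0 x = 1 := by
  have h : MvPowerSeries.constantCoeff (negBinSeries m ((∑ i, x i : ℕ) + α)) = 1 := by
    rw [← MvPowerSeries.coeff_zero_eq_constantCoeff, MvPowerSeries.coeff_apply]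
    simp [negBinSeries]
  rw [meixnerPoly, MvPowerSeries.coeff_zero_eq_constantCoeff, meixnerGen, map_mul, h, map_prod]
  simp

lemma meixnerSqNorm_zero (hα : 0 < α) : meixnerSqNorm α θ p u 0 = 1 := by
  simp [meixnerSqNorm_eq hα, negMultinomialCoeff, mon]

lemma meixnerH_zero (hα : 0 < α) : meixnerH α θ p u 0 = 1 := by
  rw [meixnerH, meixnerSqNorm_zero hα, inv_one]

/-- The orthonormal functions `h_n^{1/2} M_n`, as square summable sequences with respect to the
counting measure. -/
noncomputable def orthoVec (hu : IsOrthogonalBasis p u) (hα : 0 < α) (hθ : 0 < θ)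
    (n : Fin (m + 1) →₀ ℕ) : lp (fun _ : Fin (m + 1) → ℕ => ℝ) 2 :=
  ⟨fun x => √(meixnerProb α θ p x) * √(meixnerH α θ p u n) * meixnerPoly α θ u n x, by
    refine memℓp_gen ?_
    have h := (hasSum_meixner_orthogonality hu hα hθ n n).summable.mul_left (meixnerH α θ p u n)
    refine h.congr fun x => ?_
    have h1 := (meixnerProb_pos hα hθ hu.p_pos x).le
    have h2 := (meixnerH_pos hu hα hθ n).le
    simp only [ENNReal.toReal_ofNat, Real.rpow_ofNat, Real.norm_eq_abs, sq_abs, mul_pow,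
      Real.sq_sqrt h1, Real.sq_sqrt h2]
    ring⟩

lemma orthoVec_apply (hu : IsOrthogonalBasis p u) (hα : 0 < α) (hθ : 0 < θ)
    (n : Fin (m + 1) →₀ ℕ) (x : Fin (m + 1) → ℕ) : orthoVec hu hα hθ n x =
      √(meixnerProb α θ p x) * √(meixnerH α θ p u n) * meixnerPoly α θ u n x := rfl

lemma orthonormal_orthoVec (hu : IsOrthogonalBasis p u) (hα : 0 < α) (hθ : 0 < θ) :
    Orthonormal ℝ (orthoVec hu hα hθ) := by
  classical
  rw [orthonormal_iff_ite]
  intro n k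
  have h := lp.hasSum_inner (𝕜 := ℝ) (orthoVec hu hα hθ n) (orthoVec hu hα hθ k)
  refine h.unique ?_
  have h2 := (hasSum_meixner_orthogonality hu hα hθ n k).mul_left
    (√(meixnerH α θ p u n) * √(meixnerH α θ p u k))
  have hv : (if n = k then (1 : ℝ) else 0) = √(meixnerH α θ p u n) * √(meixnerH α θ p u k) *
      if k = n then meixnerSqNorm α θ p u n else 0 := by
    by_cases hk : n = k
    · subst hk
      rw [if_pos rfl, if_pos rfl, Real.mul_self_sqrt (meixnerH_pos hu hα hθ n).le, meixnerH,
        inv_mul_cancel₀ (meixnerSqNorm_pos hu hα hθ n).ne']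
    · simp [hk, Ne.symm hk]
  rw [hv]
  refine h2.congr_fun fun x => ?_
  have h1 := Real.mul_self_sqrt (meixnerProb_pos hα hθ hu.p_pos x).le
  rw [orthoVec_apply, orthoVec_apply, real_inner_eq_mul]
  linear_combination √(meixnerH α θ p u n) * √(meixnerH α θ p u k) *
    meixnerPoly α θ u n x * meixnerPoly α θ u k x * h1

/-- Bessel's inequality for the point evaluations. -/
lemma summable_meixnerH_mul_sq (hu : IsOrthogonalBasis p u) (hα : 0 < α) (hθ : 0 < θ)
    (x : Fin (m + 1) → ℕ) :
    Summable fun n => meixnerH α θ p u n * meixnerPoly α θ u n x ^ 2 := by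
  classical
  -- The inner product with the unit mass at `x` is the value at `x`, which carries the weight
  -- `√P(x)`.
  have h := (orthonormal_orthoVec hu hα hθ).inner_products_summable
    (lp.single 2 x (1 : ℝ) : lp (fun _ : Fin (m + 1) → ℕ => ℝ) 2)
  have hP := meixnerProb_pos hα hθ hu.p_pos x
  refine (h.mul_left (meixnerProb α θ p x)⁻¹).congr fun n => ?_
  rw [lp.inner_single_right, orthoVec_apply, real_inner_eq_mul, Real.norm_eq_abs, sq_abs, mul_one,
    mul_pow, mul_pow, Real.sq_sqrt hP.le, Real.sq_sqrt (meixnerH_pos hu hα hθ n).le]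
  field_simp

/-- The coefficient `ρ_n` is kept with `M_n(x)`, where mean square convergence applies; the factor
`M_n(y)` is handled by Bessel's inequality. Then `|ab| ≤ a² + b²`. -/
lemma summable_meixner_kernel (hu : IsOrthogonalBasis p u) (hα : 0 < α) (hθ : 0 < θ)
    (hρ : MeanSquareConvergent α θ p u ρ) (x y : Fin (m + 1) → ℕ) : Summable fun n =>
      ρ n * meixnerH α θ p u n * meixnerPoly α θ u n x * meixnerPoly α θ u n y := by
  refine Summable.of_norm_bounded ((hρ x).add (summable_meixnerH_mul_sq hu hα hθ y)) fun n => ?_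
  have hh := (meixnerH_pos hu hα hθ n).le
  have e : ‖ρ n * meixnerH α θ p u n * meixnerPoly α θ u n x * meixnerPoly α θ u n y‖ =
      meixnerH α θ p u n * (|ρ n * meixnerPoly α θ u n x| * |meixnerPoly α θ u n y|) := by
    rw [Real.norm_eq_abs, ← abs_mul, ← abs_of_nonneg hh, ← abs_mul, abs_of_nonneg hh]
    congr 1; ring
  have h2 : |ρ n * meixnerPoly α θ u n x| * |meixnerPoly α θ u n y| ≤
      (ρ n * meixnerPoly α θ u n x) ^ 2 + meixnerPoly α θ u n y ^ 2 := by
    rw [← sq_abs (ρ n * _), ← sq_abs (meixnerPoly α θ u n y)]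
    nlinarith [sq_nonneg (|ρ n * meixnerPoly α θ u n x| - |meixnerPoly α θ u n y|),
      sq_nonneg (|ρ n * meixnerPoly α θ u n x|), sq_nonneg (|meixnerPoly α θ u n y|)]
  rw [e]
  refine (mul_le_mul_of_nonneg_left h2 hh).trans_eq ?_
  ring

lemma expansion_eq_tsum (hu : IsOrthogonalBasis p u) (hα : 0 < α) (hθ : 0 < θ) (h0 : ρ 0 = 1)
    (hρ : MeanSquareConvergent α θ p u ρ) (x y : Fin (m + 1) → ℕ) :
    expansion α θ p u ρ x y = meixnerProb α θ p x * meixnerProb α θ p y *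
      ∑' n, ρ n * meixnerH α θ p u n * meixnerPoly α θ u n x * meixnerPoly α θ u n y := by
  classical
  have hs := summable_meixner_kernel hu hα hθ hρ x y
  rw [expansion]
  congr 1
  rw [← (Summable.tsum_add_tsum_compl (s := {0}) (hs.subtype _) (hs.subtype _))]
  congr 1
  simp [h0, meixnerH_zero hα, meixnerPoly_zero]

lemma expansion_comm (x y : Fin (m + 1) → ℕ) :
    expansion α θ p u ρ x y = expansion α θ p u ρ y x := by
  rw [expansion, expansion, mul_comm (meixnerProb α θ p x)]
  congr 2
  exact tsum_congr fun n => by ring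

/-- Integration of a Meixner polynomial against a mean square convergent expansion. -/
lemma hasSum_expansion_mul_meixnerPoly (hu : IsOrthogonalBasis p u) (hα : 0 < α) (hθ : 0 < θ)
    (h0 : ρ 0 = 1) (hρ : MeanSquareConvergent α θ p u ρ) (x : Fin (m + 1) → ℕ)
    (k : Fin (m + 1) →₀ ℕ) :
    HasSum (fun y => expansion α θ p u ρ x y * meixnerPoly α θ u k y)
      (meixnerProb α θ p x * (ρ k * meixnerPoly α θ u k x)) := by
  have hon := orthonormal_orthoVec hu hα hθ
  let c : (Fin (m + 1) →₀ ℕ) → ℝ := fun n => ρ n * √(meixnerH α θ p u n) * meixnerPoly α θ u n x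
  -- Square summable coefficients give a convergent orthogonal series; its limit `v` is the
  -- expansion as a vector in `ℓ²`.
  have hsum : Summable fun n => c n • orthoVec hu hα hθ n := by
    have h := (hon.orthogonalFamily.summable_iff_norm_sq_summable c).2
      ((hρ x).congr fun n => by
        rw [Real.norm_eq_abs, sq_abs]
        simp only [c, mul_pow, Real.sq_sqrt (meixnerH_pos hu hα hθ n).le])
    simpa using h
  obtain ⟨v, hv⟩ := hsum
  -- Evaluation at `y` is continuous on `ℓ²`, so the limit vector has the pointwise sums as
  -- coordinates.
  have hvy : ∀ y, v y = √(meixnerProb α θ p y) *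
      ∑' n, ρ n * meixnerH α θ p u n * meixnerPoly α θ u n x * meixnerPoly α θ u n y := by
    intro y
    have h1 : HasSum (fun n => (c n • orthoVec hu hα hθ n) y) (v y) :=
      hv.mapL (lp.evalCLM ℝ (fun _ : Fin (m + 1) → ℕ => ℝ) 2 y)
    refine h1.unique ?_
    refine ((summable_meixner_kernel hu hα hθ hρ x y).hasSum.mul_left _).congr_fun fun n => ?_
    change c n * orthoVec hu hα hθ n y = _
    rw [orthoVec_apply]
    simp only [c]
    linear_combination (√(meixnerProb α θ p y) * ρ n * meixnerPoly α θ u n x *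
      meixnerPoly α θ u n y) * Real.mul_self_sqrt (meixnerH_pos hu hα hθ n).le
  have hin : inner ℝ (orthoVec hu hα hθ k) v = c k := by
    classical
    have h1 : HasSum (fun n => inner ℝ (orthoVec hu hα hθ k) (c n • orthoVec hu hα hθ n))
        (inner ℝ (orthoVec hu hα hθ k) v) := hv.mapL (innerSL ℝ (orthoVec hu hα hθ k))
    refine h1.unique ?_
    have h2 := hasSum_single (f := fun n =>
      inner ℝ (orthoVec hu hα hθ k) (c n • orthoVec hu hα hθ n)) k fun n hn => by
        rw [inner_smul_right, orthonormal_iff_ite.1 hon, if_neg (Ne.symm hn), mul_zero]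
    rwa [inner_smul_right, orthonormal_iff_ite.1 hon, if_pos rfl, mul_one] at h2
  have h3 := lp.hasSum_inner (𝕜 := ℝ) (orthoVec hu hα hθ k) v
  rw [hin] at h3
  have hk := meixnerH_pos hu hα hθ k
  have h4 := h3.mul_left (meixnerProb α θ p x * (√(meixnerH α θ p u k))⁻¹)
  have hk' : √(meixnerH α θ p u k) ≠ 0 := (Real.sqrt_pos.2 hk).ne'
  have hval : meixnerProb α θ p x * (ρ k * meixnerPoly α θ u k x) =
      meixnerProb α θ p x * (√(meixnerH α θ p u k))⁻¹ * c k := by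
    simp only [c]; field_simp
  rw [hval]
  refine h4.congr_fun fun y => ?_
  have h1 := Real.mul_self_sqrt (meixnerProb_pos hα hθ hu.p_pos y).le
  rw [expansion_eq_tsum hu hα hθ h0 hρ, hvy, orthoVec_apply, real_inner_eq_mul]
  generalize (∑' n, ρ n * meixnerH α θ p u n * meixnerPoly α θ u n x * meixnerPoly α θ u n y) = F
  field_simp
  linear_combination (-(meixnerProb α θ p x * F * meixnerPoly α θ u k y)) * h1

/-- Tonelli: for a non-negative `q`, a non-negative function of the first variable may be integrated
against the marginal. -/
lemma hasSum_pair_of_marginal {X Y : Type*} {q : X × Y → ℝ} (hq : ∀ z, 0 ≤ q z) {P g : X → ℝ}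
    (hP : ∀ x, HasSum (fun y => q (x, y)) (P x)) (hg : ∀ x, 0 ≤ g x) {S : ℝ}
    (hS : HasSum (fun x => P x * g x) S) : HasSum (fun z : X × Y => q z * g z.1) S := by
  have h1 : ∀ x, HasSum (fun y => q (x, y) * g x) (P x * g x) := fun x => (hP x).mul_right _
  have hs : Summable fun z : X × Y => q z * g z.1 := by
    rw [summable_prod_of_nonneg fun z => mul_nonneg (hq _) (hg _)]
    exact ⟨fun x => (h1 x).summable, hS.summable.congr fun x => ((h1 x).tsum_eq).symm⟩
  have h2 := hs.hasSum.prod_fiberwise h1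
  rw [hS.unique h2]
  exact hs.hasSum

lemma abs_mul_le_half_add_sq (q a b : ℝ) (hq : 0 ≤ q) :
    |q * (a * b)| ≤ 1 / 2 * (q * a ^ 2 + q * b ^ 2) := by
  rw [abs_mul, abs_of_nonneg hq, abs_mul, ← mul_add, ← sq_abs a, ← sq_abs b,
    mul_left_comm (1 / 2 : ℝ)]
  refine mul_le_mul_of_nonneg_left ?_ hq
  nlinarith [sq_nonneg (|a| - |b|)]

lemma hasSum_expansion_mul_sq_left (hu : IsOrthogonalBasis p u) (hα : 0 < α) (hθ : 0 < θ)
    (h0 : ρ 0 = 1) (hρ : MeanSquareConvergent α θ p u ρ) (hnn : IsNonnegExpansion α θ p u ρ)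
    (k : Fin (m + 1) →₀ ℕ) :
    HasSum (fun z : (Fin (m + 1) → ℕ) × (Fin (m + 1) → ℕ) =>
      expansion α θ p u ρ z.1 z.2 * meixnerPoly α θ u k z.1 ^ 2) (meixnerSqNorm α θ p u k) := by
  refine hasSum_pair_of_marginal (q := fun z => expansion α θ p u ρ z.1 z.2)
    (fun z => hnn _ _) (P := meixnerProb α θ p) (fun x => ?_) (fun x => sq_nonneg _) ?_
  · simpa [meixnerPoly_zero, h0] using hasSum_expansion_mul_meixnerPoly hu hα hθ h0 hρ x 0
  · have := hasSum_meixner_orthogonality hu hα hθ k k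
    rw [if_pos rfl] at this
    exact this.congr_fun fun x => by ring

lemma hasSum_expansion_mul_sq_right (hu : IsOrthogonalBasis p u) (hα : 0 < α) (hθ : 0 < θ)
    (h0 : ρ 0 = 1) (hρ : MeanSquareConvergent α θ p u ρ) (hnn : IsNonnegExpansion α θ p u ρ)
    (k : Fin (m + 1) →₀ ℕ) :
    HasSum (fun z : (Fin (m + 1) → ℕ) × (Fin (m + 1) → ℕ) =>
      expansion α θ p u ρ z.1 z.2 * meixnerPoly α θ u k z.2 ^ 2) (meixnerSqNorm α θ p u k) := by
  have h := (Equiv.prodComm (Fin (m + 1) → ℕ) (Fin (m + 1) → ℕ)).hasSum_iff.2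
    (hasSum_expansion_mul_sq_left hu hα hθ h0 hρ hnn k)
  refine h.congr_fun fun z => ?_
  simp [expansion_comm z.1 z.2]

/-- A non-negative mean square convergent expansion is a proper bivariate distribution. -/
theorem isLancasterDistribution_of_nonneg (hu : IsOrthogonalBasis p u) (hα : 0 < α) (hθ : 0 < θ)
    (h0 : ρ 0 = 1) (hρ : MeanSquareConvergent α θ p u ρ) (hnn : IsNonnegExpansion α θ p u ρ) :
    IsLancasterDistribution α θ p u ρ := by
  have hml : ∀ x, HasSum (fun y => expansion α θ p u ρ x y) (meixnerProb α θ p x) := fun x => by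
    simpa [meixnerPoly_zero, h0] using hasSum_expansion_mul_meixnerPoly hu hα hθ h0 hρ x 0
  refine ⟨summable_meixner_kernel hu hα hθ hρ, hnn, ?_, hml, fun y => ?_, fun k n => ?_⟩
  · simpa [meixnerPoly_zero, meixnerSqNorm_zero hα] using
      hasSum_expansion_mul_sq_left hu hα hθ h0 hρ hnn 0
  · simpa only [expansion_comm] using hml y
  -- The two finite second moments dominate the mixed product, so the double sum may be computed row
  -- by row.
  · have hs : Summable fun z : (Fin (m + 1) → ℕ) × (Fin (m + 1) → ℕ) =>
        expansion α θ p u ρ z.1 z.2 * (meixnerPoly α θ u k z.1 * meixnerPoly α θ u n z.2) :=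
      Summable.of_norm_bounded (((hasSum_expansion_mul_sq_left hu hα hθ h0 hρ hnn k).summable.add
        (hasSum_expansion_mul_sq_right hu hα hθ h0 hρ hnn n).summable).mul_left (1 / 2))
        fun z => abs_mul_le_half_add_sq _ _ _ (hnn _ _)
    have h1 := hs.hasSum.prod_fiberwise (g := fun x => meixnerPoly α θ u k x *
        (meixnerProb α θ p x * (ρ n * meixnerPoly α θ u n x))) fun x =>
      ((hasSum_expansion_mul_meixnerPoly hu hα hθ h0 hρ x n).mul_left
        (meixnerPoly α θ u k x)).congr_fun fun y => by ring
    have h2 := (hasSum_meixner_orthogonality hu hα hθ n k).mul_left (ρ n)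
    have h3 := h1.unique (h2.congr_fun fun x => by ring)
    convert hs.hasSum using 1
    rw [h3]
    split_ifs
    · rw [meixnerH, div_inv_eq_mul]
    · rw [mul_zero]

/-- The number `ρ_n` is the correlation of `M_n(X)` and `M_n(Y)`, whose second moments are equal;
hence the arithmetic-geometric inequality suffices in place of Cauchy-Schwarz. -/
lemma abs_le_one_of_nonneg (hu : IsOrthogonalBasis p u) (hα : 0 < α) (hθ : 0 < θ)
    (h0 : ρ 0 = 1) (hρ : MeanSquareConvergent α θ p u ρ) (hnn : IsNonnegExpansion α θ p u ρ)
    (n : Fin (m + 1) →₀ ℕ) : |ρ n| ≤ 1 := by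
  have h1 := (isLancasterDistribution_of_nonneg hu hα hθ h0 hρ hnn).correlation n n
  have h2 := ((hasSum_expansion_mul_sq_left hu hα hθ h0 hρ hnn n).add
    (hasSum_expansion_mul_sq_right hu hα hθ h0 hρ hnn n)).mul_left (1 / 2)
  have hN := meixnerSqNorm_pos hu hα hθ n
  rw [if_pos rfl, meixnerH, div_inv_eq_mul] at h1
  have h3 : ‖ρ n * meixnerSqNorm α θ p u n‖ ≤
      1 / 2 * (meixnerSqNorm α θ p u n + meixnerSqNorm α θ p u n) := by
    rw [← h1.tsum_eq]
    exact tsum_of_norm_bounded h2 fun z => abs_mul_le_half_add_sq _ _ _ (hnn _ _)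
  rw [Real.norm_eq_abs, abs_mul, abs_of_pos hN] at h3
  have h4 : |ρ n| * meixnerSqNorm α θ p u n ≤ 1 * meixnerSqNorm α θ p u n := by linarith
  exact le_of_mul_le_mul_right h4 hN

/-- Comparison with Bessel's inequality, which is the case of all coefficients equal to `1`. -/
lemma meanSquareConvergent_of_abs_le_one (hu : IsOrthogonalBasis p u) (hα : 0 < α) (hθ : 0 < θ)
    (h : ∀ n, |ρ n| ≤ 1) : MeanSquareConvergent α θ p u ρ := fun x => by
  refine Summable.of_nonneg_of_le (fun n => ?_) (fun n => ?_)
    (summable_meixnerH_mul_sq hu hα hθ x)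
  · have := (meixnerH_pos hu hα hθ n).le; positivity
  · have h1 : ρ n ^ 2 ≤ 1 := by rw [← sq_abs]; exact pow_le_one₀ (abs_nonneg _) (h n)
    rw [mul_assoc]
    have := (meixnerH_pos hu hα hθ n).le
    exact mul_le_of_le_one_left (by positivity) h1

end Lancaster

end MultivariateMeixner

namespace MultivariateMeixner

/-! ### Consequences of the hypergroup property: bounds on the basis and on `ρ_j(ξ)`. -/

section Hypergroup

variable {m : ℕ} {p : Fin (m + 1) → ℝ} {u : Fin (m + 1) → Fin (m + 1) → ℝ}

lemma sum_orth_eq (hu : IsOrthogonalBasis p u) (k l : Fin (m + 1)) :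
    ∑ j, u k j * u l j * p j = if k = l then sqNorm p u l else 0 := by
  split_ifs with h
  · subst h; rfl
  · exact hu.orth k l h

/-- The product formula of the hypergroup. Orthogonality extracts the `r`-th term from `𝔰`; for `r =
0` it says that the weights `p_l 𝔰(j,k,l)` have total mass `1`. -/
lemma sum_p_mul_hyperS_mul (hu : IsOrthogonalBasis p u) (j k r : Fin (m + 1)) :
    ∑ l, p l * hyperS p u j k l * u r l = u r j * u r k := by
  have h : ∀ l, p l * hyperS p u j k l * u r l =
      ∑ q, (sqNorm p u q)⁻¹ * u q j * u q k * (u q l * u r l * p l) := fun l => by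
    rw [hyperS, Finset.mul_sum, Finset.sum_mul]
    exact Finset.sum_congr rfl fun q _ => by ring
  simp only [h]
  rw [Finset.sum_comm]
  simp only [← Finset.mul_sum, sum_orth_eq hu, mul_ite, mul_zero, Finset.sum_ite_eq',
    Finset.mem_univ, if_true]
  have := (sqNorm_pos hu r).ne'
  field_simp

/-- At a point `k` where `|u^{(r)}|` is maximal, the product formula writes the square of
`u^{(r)}_k` as an average of values of `u^{(r)}`. So the maximum `M` satisfies `M² ≤ M`. -/
lemma abs_u_le_one (hu : IsOrthogonalBasis p u) (hyp : IsHypergroup p u) (r j : Fin (m + 1)) :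
    |u r j| ≤ 1 := by
  obtain ⟨k, -, hk⟩ := Finset.exists_max_image Finset.univ (fun j => |u r j|)
    ⟨j, Finset.mem_univ j⟩
  have h1 : ∑ l, p l * hyperS p u k k l = 1 := by
    have := sum_p_mul_hyperS_mul hu k k 0
    simpa [hu.u_zero] using this
  have h2 : |u r k| * |u r k| ≤ |u r k| := by
    rw [← abs_mul, ← sum_p_mul_hyperS_mul hu k k r]
    refine (Finset.abs_sum_le_sum_abs _ _).trans ?_
    calc ∑ l, |p l * hyperS p u k k l * u r l|
        ≤ ∑ l, p l * hyperS p u k k l * |u r k| := Finset.sum_le_sum fun l _ => by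
          have h0 := mul_nonneg (hu.p_pos l).le (hyp k k l)
          rw [abs_mul, abs_of_nonneg h0]
          exact mul_le_mul_of_nonneg_left (hk l (Finset.mem_univ l)) h0
      _ = |u r k| := by rw [← Finset.sum_mul, h1, one_mul]
  have h3 : |u r k| ≤ 1 := by nlinarith [abs_nonneg (u r k)]
  exact (hk j (Finset.mem_univ j)).trans h3

lemma rhoForm_zero (hu : IsOrthogonalBasis p u) (ξ : Fin (m + 1) → ℝ) :
    rhoForm u 0 ξ = ∑ i, ξ i := by simp [rhoForm, hu.u_zero]

lemma abs_rhoForm_le_sum (hu : IsOrthogonalBasis p u) (hyp : IsHypergroup p u)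
    {ξ : Fin (m + 1) → ℝ} (hξ : ∀ i, 0 ≤ ξ i) (j : Fin (m + 1)) : |rhoForm u j ξ| ≤ ∑ i, ξ i := by
  refine (Finset.abs_sum_le_sum_abs _ _).trans (Finset.sum_le_sum fun i _ => ?_)
  rw [abs_mul, abs_of_nonneg (hξ i)]
  exact mul_le_of_le_one_left (hξ i) (abs_u_le_one hu hyp j i)

lemma abs_rhoMonomial_le_sum_pow (hu : IsOrthogonalBasis p u) (hyp : IsHypergroup p u)
    {ξ : Fin (m + 1) → ℝ} (hξ : ∀ i, 0 ≤ ξ i) (n : Fin (m + 1) →₀ ℕ) :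
    |rhoMonomial u n ξ| ≤ (∑ i, ξ i) ^ (∑ i, n i) := by
  rw [rhoMonomial, Finset.abs_prod, ← Finset.prod_pow_eq_pow_sum]
  refine Finset.prod_le_prod (fun j _ => abs_nonneg _) fun j _ => ?_
  rw [abs_pow]
  exact pow_le_pow_left₀ (abs_nonneg _) (abs_rhoForm_le_sum hu hyp hξ j) _

lemma abs_rhoMonomial_le_one (hu : IsOrthogonalBasis p u) (hyp : IsHypergroup p u)
    {ξ : Fin (m + 1) → ℝ} (hξ : ξ ∈ unitSimplex m) (n : Fin (m + 1) →₀ ℕ) :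
    |rhoMonomial u n ξ| ≤ 1 :=
  (abs_rhoMonomial_le_sum_pow hu hyp hξ.1 n).trans
    (pow_le_one₀ (Finset.sum_nonneg fun i _ => hξ.1 i) hξ.2)

lemma continuous_rhoMonomial (u : Fin (m + 1) → Fin (m + 1) → ℝ) (n : Fin (m + 1) →₀ ℕ) :
    Continuous (rhoMonomial u n) := by
  unfold rhoMonomial rhoForm; fun_prop

lemma integrable_rhoMonomial (hu : IsOrthogonalBasis p u) (hyp : IsHypergroup p u)
    {ν : Measure (Fin (m + 1) → ℝ)} [IsProbabilityMeasure ν]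
    (hν : ∀ᵐ ξ ∂ν, ξ ∈ unitSimplex m) (n : Fin (m + 1) →₀ ℕ) :
    Integrable (rhoMonomial u n) ν := by
  refine Integrable.of_bound (continuous_rhoMonomial u n).aestronglyMeasurable 1 ?_
  filter_upwards [hν] with ξ hξ using abs_rhoMonomial_le_one hu hyp hξ n

lemma abs_integral_rhoMonomial_le_one (hu : IsOrthogonalBasis p u) (hyp : IsHypergroup p u)
    {ν : Measure (Fin (m + 1) → ℝ)} [IsProbabilityMeasure ν]
    (hν : ∀ᵐ ξ ∂ν, ξ ∈ unitSimplex m) (n : Fin (m + 1) →₀ ℕ) :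
    |∫ ξ, rhoMonomial u n ξ ∂ν| ≤ 1 := by
  have h := norm_integral_le_of_norm_le_const (μ := ν) (f := rhoMonomial u n) (C := 1) (by
    filter_upwards [hν] with ξ hξ using abs_rhoMonomial_le_one hu hyp hξ n)
  simpa using h

end Hypergroup

/-! ### The bivariate generating function of a diagonal expansion. -/

section BivariateTransform

open Filter Topology

variable {m : ℕ} {α θ : ℝ} {p : Fin (m + 1) → ℝ} {u : Fin (m + 1) → Fin (m + 1) → ℝ}
  {ρ : (Fin (m + 1) →₀ ℕ) → ℝ}

lemma summable_factorial_div_ascPochhammer (hα : 0 < α) {t : ℝ} (ht0 : 0 < t) (ht : t < 1) :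
    Summable fun k : ℕ => (k ! : ℝ) / (ascPochhammer ℝ k).eval α * t ^ k := by
  have hpos := fun k => ascPochhammer_pos k α hα
  refine summable_of_ratio_test_tendsto_lt_one ht
    (Eventually.of_forall fun k => by have := hpos k; positivity) ?_
  have h1 : Tendsto (fun k : ℕ => ((k : ℝ) + 1) / (k + α) * t) atTop (𝓝 (1 * t)) := by
    refine Tendsto.mul_const _ ?_
    have h2 : Tendsto (fun k : ℕ => 1 + (1 - α) / ((k : ℝ) + α)) atTop (𝓝 (1 + 0)) :=
      (Tendsto.const_div_atTop (tendsto_atTop_add_const_right _ _ tendsto_natCast_atTop_atTop)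
        _).const_add _
    rw [add_zero] at h2
    refine h2.congr fun k => ?_
    have : (k : ℝ) + α ≠ 0 := by positivity
    field_simp; ring
  rw [one_mul] at h1
  refine h1.congr fun k => ?_
  have h3 := hpos k
  rw [Real.norm_of_nonneg (by have := hpos (k + 1); positivity), Real.norm_of_nonneg (by positivity),
    ascPochhammer_succ_eval, Nat.factorial_succ, pow_succ]
  push_cast
  have h4 := h3.ne'
  have h5 : α + (k : ℝ) ≠ 0 := by positivity
  rw [add_comm (k : ℝ) α]
  field_simp

lemma prod_factorial_le (n : Fin (m + 1) → ℕ) : ∏ i, ((n i) ! : ℝ) ≤ ((∑ i, n i) ! : ℕ) := by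
  have h := Nat.multinomial_spec Finset.univ n
  have h2 : ∏ i, (n i) ! ≤ (∑ i, n i) ! := by
    rw [← h]; exact Nat.le_mul_of_pos_right _ (Nat.multinomial_pos _ _)
  exact_mod_cast h2

/-- The term is `(∏ n_j!)² / (α)_{|n|}` times `κ^n / ∏ n_j!`. Bounding `∏ n_j!` by `|n|!` in the
square and summing by degree leaves `∑ k!/(α)_k (∑ κ_j)^k`, to which the ratio test applies. -/
lemma summable_inv_negMultinomialCoeff (hα : 0 < α) {κ : Fin (m + 1) → ℝ} (hκ : ∀ i, 0 < κ i)
    (h1 : ∑ i, κ i < 1) : Summable fun n : Fin (m + 1) →₀ ℕ =>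
      (negMultinomialCoeff α n)⁻¹ * mon κ n := by
  have hpos := fun k => ascPochhammer_pos k α hα
  have h0 : 0 < ∑ i, κ i := Finset.sum_pos (fun i _ => hκ i) ⟨0, Finset.mem_univ _⟩
  have h := hasSum_multinomial (fun k => (k ! : ℝ) * ((k ! : ℝ) / (ascPochhammer ℝ k).eval α)) κ (by
    refine (summable_factorial_div_ascPochhammer hα h0 h1).congr fun k => ?_
    have := hpos k
    simp only [abs_of_pos (hκ _)]
    rw [abs_of_pos (by positivity)]
    field_simp)
  refine Summable.of_nonneg_of_le
    (fun n => mul_nonneg (inv_nonneg.2 (negMultinomialCoeff_pos hα n).le)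
      (mon_nonneg (fun i => (hκ i).le) n)) (fun n => ?_)
    (Finsupp.equivFunOnFinite.summable_iff.2 h.summable)
  have hP : 0 < ∏ i, ((n i) ! : ℝ) := Finset.prod_pos fun i _ => by positivity
  simp only [Function.comp_apply, Finsupp.equivFunOnFinite_apply, negMultinomialCoeff,
    Finset.prod_div_distrib, inv_div]
  change _ ≤ _ * (mon κ n / _)
  have hle := prod_factorial_le (m := m) n
  rw [mul_div_assoc', le_div_iff₀ hP]
  have hm := mon_nonneg (fun i => (hκ i).le) n
  have ha := hpos (∑ i, n i)
  calc (∏ i, ((n i) ! : ℝ)) / (ascPochhammer ℝ (∑ i, n i)).eval α * mon κ n * ∏ i, ((n i) ! : ℝ)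
      = (∏ i, ((n i) ! : ℝ)) * (∏ i, ((n i) ! : ℝ)) *
        (mon κ n / (ascPochhammer ℝ (∑ i, n i)).eval α) := by ring
    _ ≤ ((∑ i, n i) ! : ℕ) * ((∑ i, n i) ! : ℕ) *
        (mon κ n / (ascPochhammer ℝ (∑ i, n i)).eval α) := by gcongr
    _ = _ := by ring

/-- A polyradius at which the Meixner polynomials are small compared with their norms. -/
lemma exists_polyradius (b : Fin (m + 1) → ℝ) (hb0 : 1 < b 0) (hb : ∀ j, 0 < b j) :
    ∃ r : Fin (m + 1) → ℝ, (∀ i, 0 < r i) ∧ r 0 < 1 ∧ ∑ j, (b j * r j ^ 2)⁻¹ < 1 := by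
  have h0 := hb 0
  -- The coordinate `0` is the constrained one: `r₀²` must lie strictly between `1/b₀` and `1`, and
  -- `t` is the midpoint.
  let t : ℝ := (1 + (b 0)⁻¹) / 2
  have hb1 : (b 0)⁻¹ < 1 := inv_lt_one_of_one_lt₀ hb0
  have ht : (b 0)⁻¹ < t := by simp only [t]; linarith
  have ht1 : t < 1 := by simp only [t]; linarith
  have htpos : 0 < t := (inv_pos.2 h0).trans ht
  let κ : ℝ := (b 0 * t)⁻¹
  have hκ : κ < 1 := inv_lt_one_of_one_lt₀ (by
    have := mul_lt_mul_of_pos_left ht h0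
    rwa [mul_inv_cancel₀ h0.ne'] at this)
  -- The other radii may be as large as necessary. Each is chosen to contribute exactly `ε`, so
  -- together they use less than the remaining `1 - κ`.
  let ε : ℝ := (1 - κ) / (2 * (m + 1))
  have hε : 0 < ε := div_pos (by linarith) (by positivity)
  refine ⟨Fin.cons (√t) fun j : Fin m => √((b j.succ * ε)⁻¹), fun i => ?_, ?_, ?_⟩
  · refine Fin.cases ?_ (fun j => ?_) i
    · simpa using htpos
    · have := hb j.succ
      simp only [Fin.cons_succ]; positivity
  · simp only [Fin.cons_zero]; rw [Real.sqrt_lt' one_pos]; simpa using ht1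
  · rw [Fin.sum_univ_succ]
    simp only [Fin.cons_zero, Fin.cons_succ, Real.sq_sqrt htpos.le]
    have h2 : ∀ j : Fin m, (b j.succ * √((b j.succ * ε)⁻¹) ^ 2)⁻¹ = ε := fun j => by
      have := hb j.succ
      rw [Real.sq_sqrt (by positivity)]; field_simp
    simp only [h2, Finset.sum_const, Finset.card_univ, Fintype.card_fin, nsmul_eq_mul]
    change κ + m * ε < 1
    have h3 : (m + 1) * ε = (1 - κ) / 2 := by simp only [ε]; field_simp
    nlinarith

/-- The identity `pgfBase_mul_genFactor` keeps `1 - ∑ T_j(s) w_j` positive throughout the polydisc;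
choosing the signs of `w_j` to agree with those of `T_j` turns positivity into the bound. -/
lemma sum_abs_transVec_mul_lt (hθ : 0 < θ) (hp : ∀ j, 0 < p j) {r s : Fin (m + 1) → ℝ}
    (hr : ∀ i, 0 < r i) (hr0 : r 0 < 1) (hs1 : θ / (1 + θ) * ∑ i, p i * |s i| < 1)
    (hs : θ / (1 + θ) * ∑ i, p i * (|s i| * genMajorant θ u r i) < 1) :
    ∑ j, |transVec θ p u s j| * r j < 1 := by
  have hD := pgfBase_pos hθ hp hs1
  let w : Fin (m + 1) → ℝ := fun j => SignType.sign (transVec θ p u s j) * r j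
  have hw : ∀ j, |w j| ≤ r j := fun j => by
    have h := hr j
    simp only [w, abs_mul, abs_of_pos h]
    refine mul_le_of_le_one_left h.le ?_
    cases SignType.sign (transVec θ p u s j) <;> simp
  have hw0 : w 0 < 1 := ((le_abs_self _).trans (hw 0)).trans_lt hr0
  have hs' : θ / (1 + θ) * ∑ i, p i * |s i * genFactor θ u w i| < 1 := by
    refine lt_of_le_of_lt (mul_le_mul_of_nonneg_left (Finset.sum_le_sum fun i _ => ?_)
      (by positivity)) hs
    rw [abs_mul]
    exact mul_le_mul_of_nonneg_left (mul_le_mul_of_nonneg_left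
      (abs_genFactor_le hθ hr0 hw i) (abs_nonneg _)) (hp i).le
  have h1 := pgfBase_mul_genFactor (u := u) hθ hw0 hD.ne'
  have h2 : 0 < pgfBase θ p s * (1 - ∑ j, transVec θ p u s j * w j) := by
    rw [← h1]; exact mul_pos (by linarith) (pgfBase_pos hθ hp hs')
  have h3 := (mul_pos_iff_of_pos_left hD).1 h2
  have h4 : ∑ j, transVec θ p u s j * w j = ∑ j, |transVec θ p u s j| * r j :=
    Finset.sum_congr rfl fun j _ => by
      simp only [w]; rw [← mul_assoc, self_mul_sign]
  linarith

/-- Cauchy's estimate for `M_n(x)`, summed over `x`. What matters is that `C` does not depend on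
`n`. -/
lemma exists_transform_bound (hα : 0 < α) (hθ : 0 < θ) (hp : ∀ j, 0 < p j)
    {r s : Fin (m + 1) → ℝ} (hr : ∀ i, 0 < r i) (hr0 : r 0 < 1)
    (hs : θ / (1 + θ) * ∑ i, p i * (|s i| * genMajorant θ u r i) < 1) : ∃ C : ℝ, 0 ≤ C ∧
      ∀ n : Fin (m + 1) →₀ ℕ,
        (Summable fun x => |meixnerProb α θ p x * mon s x * meixnerPoly α θ u n x|) ∧
        ∑' x, |meixnerProb α θ p x * mon s x * meixnerPoly α θ u n x| ≤ (mon r n)⁻¹ * C := by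
  have hG := fun i => genMajorant_nonneg (u := u) hθ (fun i => (hr i).le) hr0 i
  have h1 := (hasSum_meixnerProb_mul_mon hα hθ hp
    (s := fun i => |s i| * genMajorant θ u r i) (by
      simpa only [abs_mul, abs_abs, abs_of_nonneg (hG _)] using hs)).summable
  have hle : ∀ (n : Fin (m + 1) →₀ ℕ) x,
      |meixnerProb α θ p x * mon s x * meixnerPoly α θ u n x| ≤
      (mon r n)⁻¹ * ((1 - r 0) ^ (-α) * (meixnerProb α θ p x *
        mon (fun i => |s i| * genMajorant θ u r i) x)) := fun n x => by
    have hP := (meixnerProb_pos hα hθ hp x).le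
    rw [abs_mul, abs_mul, abs_of_nonneg hP, mon_abs, mon_mul]
    refine (mul_le_mul_of_nonneg_left (abs_meixnerPoly_le hα hθ hr hr0 n x)
      (mul_nonneg hP (mon_nonneg (fun _ => abs_nonneg _) _))).trans_eq (by ring)
  refine ⟨(1 - r 0) ^ (-α) * ∑' x, meixnerProb α θ p x *
        mon (fun i => |s i| * genMajorant θ u r i) x, ?_, fun n => ?_⟩
  · exact mul_nonneg (Real.rpow_nonneg (by linarith) _) (tsum_nonneg fun x =>
      mul_nonneg (meixnerProb_pos hα hθ hp x).le
        (mon_nonneg (fun i => mul_nonneg (abs_nonneg _) (hG i)) _))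
  · have h2 := (h1.mul_left ((1 - r 0) ^ (-α))).mul_left (mon r n)⁻¹
    have h3 := Summable.of_nonneg_of_le (fun _ => abs_nonneg _) (hle n) h2
    refine ⟨h3, (h3.tsum_le_tsum (hle n) h2).trans_eq ?_⟩
    rw [tsum_mul_left, tsum_mul_left]

/-- The two transform bounds cost `r^{-2n}`, while `h_n` supplies the inverse of `b^n` times the
negative multinomial coefficient. The condition on `∑ 1/(b_j r_j²)` makes the balance summable. -/
lemma summable_meixnerH_mul_inv_mon (hu : IsOrthogonalBasis p u) (hα : 0 < α) (hθ : 0 < θ)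
    (hρ : ∀ n, |ρ n| ≤ 1) {r : Fin (m + 1) → ℝ} (hr : ∀ i, 0 < r i)
    (hrs : ∑ j, (normVec θ p u j * r j ^ 2)⁻¹ < 1) {C C' : ℝ} (hC : 0 ≤ C) (hC' : 0 ≤ C') :
    Summable fun n : Fin (m + 1) →₀ ℕ => |ρ n * meixnerH α θ p u n| *
      ((mon r n)⁻¹ * C * ((mon r n)⁻¹ * C')) := by
  have h1 := (summable_inv_negMultinomialCoeff hα
    (fun j => inv_pos.2 (mul_pos (normVec_pos hu hθ j) (pow_pos (hr j) 2))) hrs).mul_left (C * C')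
  have hm0 : ∀ n : Fin (m + 1) →₀ ℕ, 0 ≤ (mon r n)⁻¹ :=
    fun n => inv_nonneg.2 (mon_nonneg (fun i => (hr i).le) n)
  refine Summable.of_nonneg_of_le (fun n => ?_) (fun n => ?_) h1
  · have := hm0 n; positivity
  · have hH := meixnerH_pos hu hα hθ n
    have hm : mon (fun j => (normVec θ p u j * r j ^ 2)⁻¹) n =
        (mon (normVec θ p u) n)⁻¹ * ((mon r n)⁻¹ * (mon r n)⁻¹) := by
      simp only [mon, mul_pow, inv_pow, Finset.prod_mul_distrib, Finset.prod_inv_distrib,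
        mul_inv, pow_two]
    have h3 : 0 ≤ meixnerH α θ p u n * ((mon r n)⁻¹ * C * ((mon r n)⁻¹ * C')) :=
      mul_nonneg hH.le (mul_nonneg (mul_nonneg (hm0 n) hC) (mul_nonneg (hm0 n) hC'))
    rw [abs_mul, abs_of_pos hH, mul_assoc]
    refine (mul_le_of_le_one_left h3 (hρ n)).trans_eq ?_
    rw [meixnerH, meixnerSqNorm_eq hα, hm, mul_inv]
    ring

lemma summable_mul_abs {X Y : Type*} {f : X → ℝ} {g : Y → ℝ} {a b : ℝ}
    (hf : (Summable fun x => |f x|) ∧ ∑' x, |f x| ≤ a)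
    (hg : (Summable fun y => |g y|) ∧ ∑' y, |g y| ≤ b) :
    (Summable fun z : X × Y => |f z.1 * g z.2|) ∧ ∑' z : X × Y, |f z.1 * g z.2| ≤ a * b := by
  have h : Summable fun z : X × Y => |f z.1| * |g z.2| :=
    hf.1.mul_of_nonneg hg.1 (fun _ => abs_nonneg _) (fun _ => abs_nonneg _)
  simp only [abs_mul]
  refine ⟨h, ?_⟩
  rw [← hf.1.tsum_mul_tsum hg.1 h]
  exact mul_le_mul hf.2 hg.2 (tsum_nonneg fun _ => abs_nonneg _)
    ((tsum_nonneg fun _ => abs_nonneg _).trans hf.2)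

/-- The bivariate generating function of a diagonal expansion with bounded coefficients. -/
lemma hasSum_expansion_mul_mon (hu : IsOrthogonalBasis p u) (hα : 0 < α) (hθ : 0 < θ)
    (h0 : ρ 0 = 1) (hρ : ∀ n, |ρ n| ≤ 1) {r s t : Fin (m + 1) → ℝ}
    (hr : ∀ i, 0 < r i) (hr0 : r 0 < 1) (hrs : ∑ j, (normVec θ p u j * r j ^ 2)⁻¹ < 1)
    (hs1 : θ / (1 + θ) * ∑ i, p i * |s i| < 1)
    (hs : θ / (1 + θ) * ∑ i, p i * (|s i| * genMajorant θ u r i) < 1)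
    (ht1 : θ / (1 + θ) * ∑ i, p i * |t i| < 1)
    (ht : θ / (1 + θ) * ∑ i, p i * (|t i| * genMajorant θ u r i) < 1) :
    HasSum (fun z : (Fin (m + 1) → ℕ) × (Fin (m + 1) → ℕ) =>
      expansion α θ p u ρ z.1 z.2 * (mon s z.1 * mon t z.2))
      (pgfBase θ p s ^ (-α) * pgfBase θ p t ^ (-α) *
        ∑' n : Fin (m + 1) →₀ ℕ, ρ n * (negMultinomialCoeff α n *
          mon (fun j => transVec θ p u s j * transVec θ p u t j / normVec θ p u j) n)) := by
  have hp := hu.p_pos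
  have hmsc := meanSquareConvergent_of_abs_le_one hu hα hθ hρ
  obtain ⟨C, hC0, hC⟩ := exists_transform_bound (u := u) hα hθ hp hr hr0 hs
  obtain ⟨C', hC0', hC'⟩ := exists_transform_bound (u := u) hα hθ hp hr hr0 ht
  have hT := fun n => hasSum_meixner_transform (u := u) hα hθ hp hs1 n
  have hT' := fun n => hasSum_meixner_transform (u := u) hα hθ hp ht1 n
  have hprod := fun n => summable_mul_abs (hC n) (hC' n)
  have hTT := fun n => (hT n).mul (hT' n) (hprod n).1.of_abs
  -- Exchange of the sum over `n` with the sum over pairs `(x, y)`; for each `n` the latter is a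
  -- product of two transforms.
  have key := hasSum_tsum_comm (f := fun n => ρ n * meixnerH α θ p u n)
    (fun n => (hprod n).1) (fun n => (hprod n).2) hTT
    (summable_meixnerH_mul_inv_mon hu hα hθ hρ hr hrs hC0 hC0')
  have hval : ∑' n : Fin (m + 1) →₀ ℕ, ρ n * meixnerH α θ p u n *
      (pgfBase θ p s ^ (-α) * (negMultinomialCoeff α n * mon (transVec θ p u s) n) *
      (pgfBase θ p t ^ (-α) * (negMultinomialCoeff α n * mon (transVec θ p u t) n))) =
      pgfBase θ p s ^ (-α) * pgfBase θ p t ^ (-α) *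
        ∑' n : Fin (m + 1) →₀ ℕ, ρ n * (negMultinomialCoeff α n *
          mon (fun j => transVec θ p u s j * transVec θ p u t j / normVec θ p u j) n) := by
    rw [← tsum_mul_left]
    refine tsum_congr fun n => ?_
    have h1 := (negMultinomialCoeff_pos hα n).ne'
    have h2 := (mon_pos (normVec_pos hu hθ) n).ne'
    have h3 : mon (fun j => transVec θ p u s j * transVec θ p u t j / normVec θ p u j) n =
        mon (transVec θ p u s) n * mon (transVec θ p u t) n / mon (normVec θ p u) n := by
      simp only [mon, div_pow, mul_pow, Finset.prod_div_distrib, Finset.prod_mul_distrib]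
    rw [h3, meixnerH, meixnerSqNorm_eq hα]
    field_simp
  rw [hval] at key
  refine key.congr_fun fun z => ?_
  rw [expansion_eq_tsum hu hα hθ h0 hmsc, ← tsum_mul_left, ← tsum_mul_right]
  exact tsum_congr fun n => by ring

end BivariateTransform

end MultivariateMeixner

namespace MultivariateMeixner

/-! ### Fixed `ξ`: the condition for non-negativity, and mixtures. -/

section Extreme

open Filter Topology

variable {m : ℕ} {α θ : ℝ} {p : Fin (m + 1) → ℝ} {u : Fin (m + 1) → Fin (m + 1) → ℝ}
  {ξ : Fin (m + 1) → ℝ}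

/-- The basis diagonalizes the matrix: relative to `p_i p_k` it has eigenfunctions `u^{(r)}` with
eigenvalues `ρ_r(ω)`. -/
lemma pairProb_eq_sum (ω : Fin (m + 1) → ℝ) (i k : Fin (m + 1)) :
    pairProb p u ω i k =
      ∑ r, rhoForm u r ω * ((p i * u r i) * (p k * u r k)) * (sqNorm p u r)⁻¹ := by
  simp only [pairProb, hyperS, rhoForm, Finset.mul_sum, Finset.sum_mul]
  rw [Finset.sum_comm]
  exact Finset.sum_congr rfl fun r _ => Finset.sum_congr rfl fun l _ => by ring

lemma basisTransform_zero (hu : IsOrthogonalBasis p u) (s : Fin (m + 1) → ℝ) :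
    basisTransform p u s 0 = ∑ i, p i * s i := by simp [basisTransform, hu.u_zero]

/-- The term `r = 0` is split off because the coordinate `0` of the Meixner transform has a
different form from the others. -/
lemma sum_pairProb_mul (hu : IsOrthogonalBasis p u) (ω s t : Fin (m + 1) → ℝ) :
    ∑ i, ∑ k, pairProb p u ω i k * (s i * t k) =
      (∑ i, ω i) * ((∑ i, p i * s i) * ∑ i, p i * t i) +
        ∑ j : Fin m, rhoForm u j.succ ω *
          (basisTransform p u s j.succ * basisTransform p u t j.succ) *
            (sqNorm p u j.succ)⁻¹ := by
  have h : ∑ i, ∑ k, pairProb p u ω i k * (s i * t k) =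
      ∑ r, rhoForm u r ω * (basisTransform p u s r * basisTransform p u t r) *
        (sqNorm p u r)⁻¹ := by
    have e : ∀ i k, pairProb p u ω i k * (s i * t k) = ∑ r, rhoForm u r ω *
        ((p i * s i * u r i) * (p k * t k * u r k)) * (sqNorm p u r)⁻¹ := fun i k => by
      rw [pairProb_eq_sum, Finset.sum_mul]
      exact Finset.sum_congr rfl fun r _ => by ring
    simp only [e]
    rw [Finset.sum_congr rfl fun i _ => Finset.sum_comm, Finset.sum_comm]
    refine Finset.sum_congr rfl fun r _ => ?_
    rw [basisTransform, basisTransform, Finset.sum_mul_sum, Finset.mul_sum, Finset.sum_mul]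
    refine Finset.sum_congr rfl fun i _ => ?_
    rw [Finset.mul_sum, Finset.sum_mul]
  rw [h, Fin.sum_univ_succ, rhoForm_zero hu, basisTransform_zero hu, basisTransform_zero hu,
    sqNorm_zero hu, inv_one, mul_one]

/-- The base of the bivariate generating function of the extreme expansion with parameter `ξ`. -/
noncomputable def bivBase (θ : ℝ) (p : Fin (m + 1) → ℝ) (u : Fin (m + 1) → Fin (m + 1) → ℝ)
    (ξ s t : Fin (m + 1) → ℝ) : ℝ :=
  pgfBase θ p s * pgfBase θ p t *
    (1 - ∑ j, rhoForm u j ξ * (transVec θ p u s j * transVec θ p u t j / normVec θ p u j))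

/-- `θ(1 - |ξ|) / (1 + θ(1 - |ξ|))`. -/
noncomputable def thinning (θ : ℝ) (ξ : Fin (m + 1) → ℝ) : ℝ :=
  θ * (1 - ∑ l, ξ l) / (1 + θ * (1 - ∑ l, ξ l))

/-- The excess `|ξ| (p_{ij}(ξ/|ξ|) - θ(1 - |ξ|)/(1 + θ(1 - |ξ|)) p_i p_j)`. -/
noncomputable def excess (θ : ℝ) (p : Fin (m + 1) → ℝ) (u : Fin (m + 1) → Fin (m + 1) → ℝ)
    (ξ : Fin (m + 1) → ℝ) (i j : Fin (m + 1)) : ℝ :=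
  pairProb p u ξ i j - thinning θ ξ * (∑ l, ξ l) * (p i * p j)

/-- Multiplication by `|ξ|` removes the normalization `ω = ξ/|ξ|`. The resulting form is linear in
the pair probabilities and also makes sense at `ξ = 0`, where the excess vanishes. -/
lemma extremeCondition_iff (hξ : ξ ∈ unitSimplex m) :
    ExtremeCondition θ p u ξ ↔ ∀ i j, 0 ≤ excess θ p u ξ i j := by
  by_cases h0 : ξ = 0
  · subst h0
    simp [ExtremeCondition, excess, pairProb]
  · have hpos : 0 < ∑ l, ξ l := by
      obtain ⟨i, hi⟩ := Function.ne_iff.1 h0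
      exact Finset.sum_pos' (fun i _ => hξ.1 i) ⟨i, Finset.mem_univ _, (hξ.1 i).lt_of_ne' hi⟩
    have e : ∀ i j, excess θ p u ξ i j = (∑ l, ξ l) *
        (pairProb p u (fun l => ξ l / ∑ k, ξ k) i j - thinning θ ξ * (p i * p j)) := fun i j => by
      have : pairProb p u ξ i j =
          (∑ l, ξ l) * pairProb p u (fun l => ξ l / ∑ k, ξ k) i j := by
        simp only [pairProb, div_mul_eq_mul_div, ← Finset.sum_div]
        field_simp
      rw [excess, this]; ring
    simp only [ExtremeCondition, ne_eq, h0, not_false_eq_true, forall_const, e,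
      mul_nonneg_iff_of_pos_left hpos, sub_nonneg, thinning]

/-- With `S = ∑ p_i s_i` and `T = ∑ p_i t_i`, the part not involving the basis functions `u^{(j)}`,
`j ≥ 1`, is bi-affine in `S, T`. Its constant and linear terms force the product `C (1 - bS)(1 -
bT)`; the discrepancy in the `ST` term is what subtracts `b |ξ| p_i p_j` in the excess. -/
lemma bivBase_eq (hu : IsOrthogonalBasis p u) (hθ : 0 < θ) (hξ : ξ ∈ unitSimplex m)
    {s t : Fin (m + 1) → ℝ} (hs : pgfBase θ p s ≠ 0) (ht : pgfBase θ p t ≠ 0) :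
    bivBase θ p u ξ s t = (1 + θ) * (1 + θ * (1 - ∑ l, ξ l)) *
        ((1 - thinning θ ξ * ∑ i, p i * s i) * (1 - thinning θ ξ * ∑ i, p i * t i)) -
      θ * ∑ i, ∑ k, excess θ p u ξ i k * (s i * t k) := by
  have hC : 1 + θ * (1 - ∑ l, ξ l) ≠ 0 := by
    have := mul_nonneg hθ.le (sub_nonneg.2 hξ.2); positivity
  have h1 : ∑ i, ∑ k, excess θ p u ξ i k * (s i * t k) =
      ∑ i, ∑ k, pairProb p u ξ i k * (s i * t k) -
        thinning θ ξ * (∑ l, ξ l) * ((∑ i, p i * s i) * ∑ i, p i * t i) := by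
    rw [Finset.sum_mul_sum, Finset.mul_sum, ← Finset.sum_sub_distrib]
    refine Finset.sum_congr rfl fun i _ => ?_
    rw [Finset.mul_sum, ← Finset.sum_sub_distrib]
    exact Finset.sum_congr rfl fun k _ => by rw [excess]; ring
  have h2 : pgfBase θ p s * pgfBase θ p t *
      ∑ j : Fin m, rhoForm u j.succ ξ * (θ * basisTransform p u s j.succ / pgfBase θ p s *
        (θ * basisTransform p u t j.succ / pgfBase θ p t) / (θ * sqNorm p u j.succ)) =
      θ * ∑ j : Fin m, rhoForm u j.succ ξ *
          (basisTransform p u s j.succ * basisTransform p u t j.succ) *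
            (sqNorm p u j.succ)⁻¹ := by
    rw [Finset.mul_sum, Finset.mul_sum]
    refine Finset.sum_congr rfl fun j _ => ?_
    have := (sqNorm_pos hu j.succ).ne'
    field_simp
  rw [bivBase, Fin.sum_univ_succ, h1, sum_pairProb_mul hu, rhoForm_zero hu]
  simp only [transVec, normVec, Fin.cons_zero, Fin.cons_succ]
  rw [mul_sub, mul_add (pgfBase θ p s * pgfBase θ p t), h2]
  generalize (∑ j : Fin m, rhoForm u j.succ ξ *
    (basisTransform p u s j.succ * basisTransform p u t j.succ) * (sqNorm p u j.succ)⁻¹) = B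
  have h3 : pgfBase θ p s * pgfBase θ p t * ((∑ i, ξ i) *
      ((1 + θ) * (1 - ∑ i, p i * s i) / pgfBase θ p s *
        ((1 + θ) * (1 - ∑ i, p i * t i) / pgfBase θ p t) / ((1 + θ) / θ))) =
      (∑ i, ξ i) * (θ * (1 + θ) * (1 - ∑ i, p i * s i) * (1 - ∑ i, p i * t i)) := by
    field_simp
  rw [h3, pgfBase, pgfBase, thinning]
  generalize (∑ i, ξ i) = x at *
  generalize (∑ i, p i * s i) = S
  generalize (∑ i, p i * t i) = T
  field_simp
  ring

/-- Since `|ρ_j(ξ)| ≤ 1` and each `|T_j| r_j ≤ 1`, the `j`-th term is at most `1/(b_j r_j²)`. This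
is the convergence condition for the negative multinomial series in `n`. -/
lemma sum_abs_rhoForm_mul_lt (hu : IsOrthogonalBasis p u) (hyp : IsHypergroup p u) (hθ : 0 < θ)
    (hξ : ξ ∈ unitSimplex m) {r s t : Fin (m + 1) → ℝ} (hr : ∀ i, 0 < r i)
    (hrs : ∑ j, (normVec θ p u j * r j ^ 2)⁻¹ < 1)
    (hs : ∑ j, |transVec θ p u s j| * r j < 1) (ht : ∑ j, |transVec θ p u t j| * r j < 1) :
    ∑ j, |rhoForm u j ξ * (transVec θ p u s j * transVec θ p u t j / normVec θ p u j)| < 1 := by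
  refine lt_of_le_of_lt (Finset.sum_le_sum fun j _ => ?_) hrs
  have hj := hr j
  have key : ∀ v : Fin (m + 1) → ℝ, ∑ j, |transVec θ p u v j| * r j < 1 →
      |transVec θ p u v j| * r j ≤ 1 := fun v hv =>
    (Finset.single_le_sum (f := fun j => |transVec θ p u v j| * r j)
      (fun i _ => mul_nonneg (abs_nonneg _) (hr i).le) (Finset.mem_univ j)).trans hv.le
  have h1 := key s hs
  have h2 := key t ht
  have hb := normVec_pos hu hθ j
  have hρ : |rhoForm u j ξ| ≤ 1 := (abs_rhoForm_le_sum hu hyp hξ.1 j).trans hξ.2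
  rw [abs_mul, abs_div, abs_mul, abs_of_pos hb]
  refine (mul_le_of_le_one_left (by positivity) hρ).trans ?_
  rw [mul_inv, div_eq_mul_inv, mul_comm _ (normVec θ p u j)⁻¹]
  refine mul_le_mul_of_nonneg_left ?_ (inv_nonneg.2 hb.le)
  rw [← one_div, le_div_iff₀ (by positivity)]
  calc |transVec θ p u s j| * |transVec θ p u t j| * r j ^ 2
      = (|transVec θ p u s j| * r j) * (|transVec θ p u t j| * r j) := by ring
    _ ≤ 1 := mul_le_one₀ h1 (by positivity) h2

/-- On a box that does not depend on `α` and `ξ`, the bivariate generating function of the extreme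
expansion is the power `-α` of `bivBase`. -/
lemma exists_box_hasSum_expansion (hu : IsOrthogonalBasis p u) (hyp : IsHypergroup p u)
    (hθ : 0 < θ) : ∃ δ : ℝ, 0 < δ ∧ δ ≤ 1 ∧ ∀ ξ ∈ unitSimplex m, ∀ s t : Fin (m + 1) → ℝ,
      (∀ i, |s i| ≤ δ) → (∀ i, |t i| ≤ δ) → 0 < pgfBase θ p s ∧ 0 < pgfBase θ p t ∧
        0 < bivBase θ p u ξ s t ∧ ∀ α : ℝ, 0 < α →
        HasSum (fun z : (Fin (m + 1) → ℕ) × (Fin (m + 1) → ℕ) =>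
          expansion α θ p u (fun n => rhoMonomial u n ξ) z.1 z.2 * (mon s z.1 * mon t z.2))
          (bivBase θ p u ξ s t ^ (-α)) := by
  have hp := hu.p_pos
  obtain ⟨r, hr, hr0, hrs⟩ := exists_polyradius (normVec θ p u)
    (by simp only [normVec, Fin.cons_zero]; rw [one_lt_div hθ]; linarith) (normVec_pos hu hθ)
  have hG := fun i => genMajorant_nonneg (u := u) hθ (fun i => (hr i).le) hr0 i
  have hA : 0 ≤ ∑ i, p i * genMajorant θ u r i :=
    Finset.sum_nonneg fun i _ => mul_nonneg (hp i).le (hG i)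
  have hq : θ / (1 + θ) < 1 := by rw [div_lt_one (by positivity)]; linarith
  have hq0 : 0 ≤ θ / (1 + θ) := by positivity
  -- This `δ` satisfies both `δ ≤ 1` and `δ ∑ p_i G_i ≤ 1`; the factor `θ/(1 + θ) < 1` then makes
  -- all the required inequalities strict.
  refine ⟨(1 + ∑ i, p i * genMajorant θ u r i)⁻¹, by positivity,
    inv_le_one_of_one_le₀ (by linarith), fun ξ hξ s t hs ht => ?_⟩
  have h1 : ∀ v : Fin (m + 1) → ℝ, (∀ i, |v i| ≤ (1 + ∑ i, p i * genMajorant θ u r i)⁻¹) →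
      θ / (1 + θ) * ∑ i, p i * |v i| < 1 := fun v hv => by
    have : ∑ i, p i * |v i| ≤ ∑ i, p i := Finset.sum_le_sum fun i _ =>
      mul_le_of_le_one_right (hp i).le ((hv i).trans (inv_le_one_of_one_le₀ (by linarith)))
    rw [hu.p_sum] at this
    exact (mul_le_of_le_one_right hq0 this).trans_lt hq
  have h2 : ∀ v : Fin (m + 1) → ℝ, (∀ i, |v i| ≤ (1 + ∑ i, p i * genMajorant θ u r i)⁻¹) →
      θ / (1 + θ) * ∑ i, p i * (|v i| * genMajorant θ u r i) < 1 := fun v hv => by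
    have : ∑ i, p i * (|v i| * genMajorant θ u r i) ≤
        (1 + ∑ i, p i * genMajorant θ u r i)⁻¹ * ∑ i, p i * genMajorant θ u r i := by
      rw [Finset.mul_sum]
      refine Finset.sum_le_sum fun i _ => ?_
      rw [mul_left_comm]
      exact mul_le_mul_of_nonneg_right (hv i) (mul_nonneg (hp i).le (hG i))
    refine (mul_le_of_le_one_right hq0 (this.trans ?_)).trans_lt hq
    rw [inv_mul_le_one₀ (by positivity)]; linarith
  have hDs := pgfBase_pos hθ hp (h1 s hs)
  have hDt := pgfBase_pos hθ hp (h1 t ht)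
  have hlt := sum_abs_rhoForm_mul_lt hu hyp hθ hξ hr hrs
    (sum_abs_transVec_mul_lt hθ hp hr hr0 (h1 s hs) (h2 s hs))
    (sum_abs_transVec_mul_lt hθ hp hr hr0 (h1 t ht) (h2 t ht))
  have hlt' := (le_abs_self _).trans_lt ((Finset.abs_sum_le_sum_abs _ _).trans_lt hlt)
  have hpos := sub_pos.2 hlt'
  refine ⟨hDs, hDt, mul_pos (mul_pos hDs hDt) hpos, fun α hα => ?_⟩
  have h := hasSum_expansion_mul_mon hu hα hθ (ρ := fun n => rhoMonomial u n ξ)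
    (by simp [rhoMonomial]) (abs_rhoMonomial_le_one hu hyp hξ) hr hr0 hrs (h1 s hs) (h2 s hs)
    (h1 t ht) (h2 t ht)
  have hval : ∑' n : Fin (m + 1) →₀ ℕ, rhoMonomial u n ξ * (negMultinomialCoeff α n *
      mon (fun j => transVec θ p u s j * transVec θ p u t j / normVec θ p u j) n) =
      (1 - ∑ j, rhoForm u j ξ *
        (transVec θ p u s j * transVec θ p u t j / normVec θ p u j)) ^ (-α) := by
    rw [← (hasSum_negMultinomialCoeff α _ hlt).tsum_eq]
    refine tsum_congr fun n => ?_
    rw [mon_mul, mul_left_comm]; rfl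
  rw [hval, ← Real.mul_rpow hDs.le hDt.le, ← Real.mul_rpow (mul_pos hDs hDt).le hpos.le] at h
  exact h

lemma thinning_nonneg (hθ : 0 < θ) (hξ : ξ ∈ unitSimplex m) : 0 ≤ thinning θ ξ := by
  have := mul_nonneg hθ.le (sub_nonneg.2 hξ.2)
  exact div_nonneg this (by positivity)

lemma thinning_lt_one (hθ : 0 < θ) (hξ : ξ ∈ unitSimplex m) : thinning θ ξ < 1 := by
  have := mul_nonneg hθ.le (sub_nonneg.2 hξ.2)
  rw [thinning, div_lt_one (by positivity)]; linarith

/-- A bivariate power series is determined by its sums on a box. -/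
lemma ext_of_hasSum_bivariate {F : (Fin (m + 1) → ℕ) → (Fin (m + 1) → ℕ) → ℝ}
    {G : (Fin (m + 1) ⊕ Fin (m + 1) → ℕ) → ℝ} {δ : ℝ} (hδ : 0 < δ)
    {f : (Fin (m + 1) ⊕ Fin (m + 1) → ℝ) → ℝ}
    (hF : ∀ w : Fin (m + 1) ⊕ Fin (m + 1) → ℝ, (∀ i, |w i| ≤ δ) →
      HasSum (fun z : (Fin (m + 1) → ℕ) × (Fin (m + 1) → ℕ) =>
        F z.1 z.2 * (mon (fun i => w (.inl i)) z.1 * mon (fun i => w (.inr i)) z.2)) (f w))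
    (hG : ∀ w : Fin (m + 1) ⊕ Fin (m + 1) → ℝ, (∀ i, |w i| ≤ δ) →
      HasSum (fun n => G n * mon w n) (f w)) (x y : Fin (m + 1) → ℕ) :
    F x y = G (Sum.elim x y) := by
  have h := coeff_eq_zero_of_hasSum_zero
    (F := fun n => F (fun i => n (.inl i)) (fun i => n (.inr i)) - G n) hδ (fun w hw => by
      have h1 := (Equiv.sumArrowEquivProdArrow (Fin (m + 1)) (Fin (m + 1)) ℕ).hasSum_iff.2
        (hF w hw)
      have h2 := h1.sub (hG w hw)
      rw [sub_self] at h2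
      refine h2.congr_fun fun n => ?_
      simp only [sub_mul, mon, Fintype.prod_sum_type]
      rfl) (Sum.elim x y)
  simpa [sub_eq_zero] using h

lemma isNonnegExpansion_of_excess_nonneg (hu : IsOrthogonalBasis p u) (hyp : IsHypergroup p u)
    (hθ : 0 < θ) (hξ : ξ ∈ unitSimplex m) (h : ∀ i j, 0 ≤ excess θ p u ξ i j) (hα : 0 < α) :
    IsNonnegExpansion α θ p u fun n => rhoMonomial u n ξ := by
  obtain ⟨δ, hδ, hδ1, hbox⟩ := exists_box_hasSum_expansion hu hyp hθ
  have hp := hu.p_pos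
  have hb0 := thinning_nonneg hθ hξ
  have hb1 := thinning_lt_one hθ hξ
  have hη : 0 < 1 + θ * (1 - ∑ l, ξ l) := by
    have := mul_nonneg hθ.le (sub_nonneg.2 hξ.2); positivity
  have hC : 0 < (1 + θ) * (1 + θ * (1 - ∑ l, ξ l)) := mul_pos (by positivity) hη
  set C := (1 + θ) * (1 + θ * (1 - ∑ l, ξ l)) with hCdef
  have hmarg : ∀ e : Fin (m + 1) → Fin (m + 1) ⊕ Fin (m + 1),
      HasNonnegCoeffs δ fun w => thinning θ ξ * ∑ i, p i * w (e i) := fun e =>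
    .mul hδ (.const hδ hb0) (.sum hδ fun i => .mul hδ (.const hδ (hp i).le) (.coord hδ _))
  have hmargδ : thinning θ ξ * ∑ i, p i * δ < 1 := by
    rw [← Finset.sum_mul, hu.p_sum, one_mul]
    exact (mul_le_of_le_one_right hb0 hδ1).trans_lt hb1
  have hlt : ∀ (e : Fin (m + 1) → Fin (m + 1) ⊕ Fin (m + 1))
      (w : Fin (m + 1) ⊕ Fin (m + 1) → ℝ), (∀ i, |w i| ≤ δ) →
      0 < 1 - thinning θ ξ * ∑ i, p i * w (e i) := fun e w hw => by
    have h1 : ∑ i, p i * w (e i) ≤ ∑ i, p i * δ := Finset.sum_le_sum fun i _ =>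
      mul_le_mul_of_nonneg_left ((le_abs_self _).trans (hw _)) (hp i).le
    have := mul_le_mul_of_nonneg_left h1 hb0
    linarith
  have hinv : ∀ (e : Fin (m + 1) → Fin (m + 1) ⊕ Fin (m + 1)) (β : ℝ), 0 < β →
      HasNonnegCoeffs δ fun w => (1 - thinning θ ξ * ∑ i, p i * w (e i)) ^ (-β) := fun e β hβ =>
    (hmarg e).one_sub_rpow_neg hδ hmargδ hβ
  have hR : HasNonnegCoeffs δ fun w : Fin (m + 1) ⊕ Fin (m + 1) → ℝ =>
      θ / C * (∑ i, ∑ k, excess θ p u ξ i k * (w (.inl i) * w (.inr k))) *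
        ((1 - thinning θ ξ * ∑ i, p i * w (.inl i)) ^ (-1 : ℝ) *
          (1 - thinning θ ξ * ∑ i, p i * w (.inr i)) ^ (-1 : ℝ)) :=
    .mul hδ (.mul hδ (.const hδ (by positivity)) (.sum hδ fun i => .sum hδ fun k =>
      .mul hδ (.const hδ (h i k)) (.mul hδ (.coord hδ _) (.coord hδ _))))
      (.mul hδ (hinv _ 1 one_pos) (hinv _ 1 one_pos))
  -- Pulling out the two marginal factors leaves `1 - R`, where `R` has non-negative coefficients;
  -- the power `-α` of every factor can be expanded separately.
  have hfac : ∀ w : Fin (m + 1) ⊕ Fin (m + 1) → ℝ, (∀ i, |w i| ≤ δ) →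
      bivBase θ p u ξ (fun i => w (.inl i)) (fun i => w (.inr i)) =
      C * ((1 - thinning θ ξ * ∑ i, p i * w (.inl i)) *
        (1 - thinning θ ξ * ∑ i, p i * w (.inr i))) *
      (1 - θ / C * (∑ i, ∑ k, excess θ p u ξ i k * (w (.inl i) * w (.inr k))) *
        ((1 - thinning θ ξ * ∑ i, p i * w (.inl i)) ^ (-1 : ℝ) *
          (1 - thinning θ ξ * ∑ i, p i * w (.inr i)) ^ (-1 : ℝ))) := fun w hw => by
    obtain ⟨h1, h2, -, -⟩ := hbox ξ hξ (fun i => w (.inl i)) (fun i => w (.inr i))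
      (fun i => hw _) (fun i => hw _)
    rw [bivBase_eq hu hθ hξ h1.ne' h2.ne', Real.rpow_neg_one, Real.rpow_neg_one]
    have h3 := (hlt .inl w hw).ne'
    have h4 := (hlt .inr w hw).ne'
    rw [← hCdef]
    field_simp
  -- That `R < 1`, in particular at the corner of the box, comes for free from the positivity of
  -- `bivBase`.
  have hpos : ∀ w : Fin (m + 1) ⊕ Fin (m + 1) → ℝ, (∀ i, |w i| ≤ δ) →
      0 < 1 - θ / C * (∑ i, ∑ k, excess θ p u ξ i k * (w (.inl i) * w (.inr k))) *
        ((1 - thinning θ ξ * ∑ i, p i * w (.inl i)) ^ (-1 : ℝ) *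
          (1 - thinning θ ξ * ∑ i, p i * w (.inr i)) ^ (-1 : ℝ)) := fun w hw => by
    have h1 := (hbox ξ hξ (fun i => w (.inl i)) (fun i => w (.inr i))
      (fun i => hw _) (fun i => hw _)).2.2.1
    rw [hfac w hw] at h1
    exact (mul_pos_iff_of_pos_left (mul_pos hC (mul_pos (hlt .inl w hw) (hlt .inr w hw)))).1 h1
  have hδδ : ∀ i : Fin (m + 1) ⊕ Fin (m + 1), |(fun _ => δ : _ → ℝ) i| ≤ δ :=
    fun _ => (abs_of_pos hδ).le
  obtain ⟨G, hG0, hG⟩ := HasNonnegCoeffs.mul hδ (.mul hδ (.const hδ (Real.rpow_nonneg hC.le (-α)))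
    (.mul hδ (hinv .inl α hα) (hinv .inr α hα)))
    (hR.one_sub_rpow_neg hδ (by have := hpos _ hδδ; linarith) hα)
  intro x y
  rw [ext_of_hasSum_bivariate hδ (f := fun w =>
    bivBase θ p u ξ (fun i => w (.inl i)) (fun i => w (.inr i)) ^ (-α)) (fun w hw =>
    (hbox ξ hξ _ _ (fun i => hw _) (fun i => hw _)).2.2.2 α hα) (fun w hw => ?_) x y]
  · exact hG0 _
  · have h1 := hlt .inl w hw
    have h2 := hlt .inr w hw
    rw [hfac w hw, Real.mul_rpow (mul_pos hC (mul_pos h1 h2)).le (hpos w hw).le,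
      Real.mul_rpow hC.le (mul_pos h1 h2).le, Real.mul_rpow h1.le h2.le]
    exact hG w hw

/-- Both sides of the hypothesis equal `2` at `α = 0`, so their right derivatives there are ordered.
These are sums of `-log`. -/
lemma nonneg_of_forall_rpow_neg {a b c d : ℝ} (ha : 0 < a) (hb : 0 < b) (hc : 0 < c) (hd : 0 < d)
    (h : ∀ α : ℝ, 0 < α → c ^ (-α) + d ^ (-α) ≤ a ^ (-α) + b ^ (-α)) : a * b ≤ c * d := by
  have hder : ∀ x : ℝ, 0 < x → HasDerivAt (fun α : ℝ => x ^ (-α)) (-Real.log x) 0 := fun x hx => by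
    have := ((hasDerivAt_id (0 : ℝ)).neg).const_rpow hx
    simpa using this
  have h1 := ((hder a ha).add (hder b hb)).sub ((hder c hc).add (hder d hd))
  have h2 : 0 ≤ -Real.log a + -Real.log b - (-Real.log c + -Real.log d) := by
    refine ge_of_tendsto h1.tendsto_slope_zero_right ?_
    filter_upwards [self_mem_nhdsWithin] with t ht
    have ht0 : (0:ℝ) < t := ht
    have := h t ht0
    simp only [Pi.add_apply, Pi.sub_apply, zero_add, neg_zero, Real.rpow_zero, smul_eq_mul]
    exact mul_nonneg (inv_nonneg.2 ht0.le) (by linarith)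
  have h3 : Real.log (a * b) ≤ Real.log (c * d) := by
    rw [Real.log_mul ha.ne' hb.ne', Real.log_mul hc.ne' hd.ne']; linarith
  exact (Real.log_le_log_iff (mul_pos ha hb) (mul_pos hc hd)).1 h3

/-- A mixed second difference of the generating function, taken between `0` and `δ e_i` in `s` and
between `0` and `δ e_k` in `t`, isolates `e_{ik}`, the only excess that contributes. -/
lemma excess_nonneg_of_isNonnegExpansion (hu : IsOrthogonalBasis p u) (hyp : IsHypergroup p u)
    (hθ : 0 < θ) (hξ : ξ ∈ unitSimplex m)
    (h : ∀ α : ℝ, 0 < α → IsNonnegExpansion α θ p u fun n => rhoMonomial u n ξ)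
    (i k : Fin (m + 1)) : 0 ≤ excess θ p u ξ i k := by
  obtain ⟨δ, hδ, hδ1, hbox⟩ := exists_box_hasSum_expansion hu hyp hθ
  let v : Fin (m + 1) → Fin (m + 1) → ℝ := fun i => Pi.single i δ
  have hv0 : ∀ i j, 0 ≤ v i j := fun i j => by
    by_cases hij : j = i
    · subst hij; simpa [v] using hδ.le
    · simp [v, hij]
  have hv : ∀ i j, |v i j| ≤ δ := fun i j => by
    rw [abs_of_nonneg (hv0 i j)]
    by_cases hij : j = i
    · subst hij; simp [v]
    · simpa [v, hij] using hδ.le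
  have hz : ∀ j : Fin (m + 1), |(0 : Fin (m + 1) → ℝ) j| ≤ δ := fun j => by simpa using hδ.le
  have hmono : ∀ i x, mon (0 : Fin (m + 1) → ℝ) x ≤ mon (v i) x := fun i x => by
    refine Finset.prod_le_prod (fun j _ => pow_nonneg le_rfl _) fun j _ => ?_
    exact pow_le_pow_left₀ le_rfl (hv0 i j) _
  obtain ⟨h1, h2, h3, h4⟩ := hbox ξ hξ (v i) (v k) (hv i) (hv k)
  obtain ⟨g1, g2, g3, g4⟩ := hbox ξ hξ 0 0 hz hz
  obtain ⟨-, -, e3, e4⟩ := hbox ξ hξ (v i) 0 (hv i) hz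
  obtain ⟨-, -, f3, f4⟩ := hbox ξ hξ 0 (v k) hz (hv k)
  -- The second difference is the sum of the expansion against `((δ e_i)^x - 0^x)((δ e_k)^y - 0^y)`,
  -- a product of non-negative factors. In the resulting inequality between products of bases
  -- everything cancels except the term with `e_{ik}`.
  have key := nonneg_of_forall_rpow_neg h3 g3 e3 f3 fun α hα => by
    have hs := ((h4 α hα).add (g4 α hα)).sub ((e4 α hα).add (f4 α hα))
    have := hs.nonneg fun z => by
      have h5 := h α hα z.1 z.2
      have h6 := mul_nonneg h5 (mul_nonneg (sub_nonneg.2 (hmono i z.1))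
        (sub_nonneg.2 (hmono k z.2)))
      refine h6.trans_eq (by ring)
    linarith
  have hsum1 : ∀ i, ∑ j, p j * v i j = p i * δ := fun i => by
    rw [Finset.sum_eq_single i] <;> simp +contextual [v]
  have hsum2 : ∑ a, ∑ b, excess θ p u ξ a b * (v i a * v k b) = excess θ p u ξ i k * (δ * δ) := by
    rw [Finset.sum_eq_single i, Finset.sum_eq_single k] <;> simp +contextual [v]
  have hη : 0 < 1 + θ * (1 - ∑ l, ξ l) := by
    have := mul_nonneg hθ.le (sub_nonneg.2 hξ.2); positivity
  rw [bivBase_eq hu hθ hξ h1.ne' h2.ne', bivBase_eq hu hθ hξ g1.ne' g2.ne',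
    bivBase_eq hu hθ hξ h1.ne' g2.ne', bivBase_eq hu hθ hξ g1.ne' h2.ne', hsum1, hsum1, hsum2] at key
  simp only [Pi.zero_apply, mul_zero, zero_mul, Finset.sum_const_zero, sub_zero, mul_one,
    one_mul] at key
  have hC : 0 < (1 + θ) * (1 + θ * (1 - ∑ l, ξ l)) := mul_pos (by positivity) hη
  generalize (1 + θ) * (1 + θ * (1 - ∑ l, ξ l)) = C at key hC
  have h7 : 0 ≤ C * θ * (δ * δ) * excess θ p u ξ i k := by linarith
  exact (mul_nonneg_iff_of_pos_left (by positivity)).1 h7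

/-- The expansion with random parameter is the mixture of the extreme expansions. -/
lemma isNonnegExpansion_integral (hu : IsOrthogonalBasis p u) (hyp : IsHypergroup p u)
    (hα : 0 < α) (hθ : 0 < θ) {ν : Measure (Fin (m + 1) → ℝ)} [IsProbabilityMeasure ν]
    (hν : ∀ᵐ ξ ∂ν, ξ ∈ unitSimplex m)
    (h : ∀ᵐ ξ ∂ν, IsNonnegExpansion α θ p u fun n => rhoMonomial u n ξ) :
    IsNonnegExpansion α θ p u fun n => ∫ ξ, rhoMonomial u n ξ ∂ν := by
  intro x y
  -- All coefficients being at most `1` in absolute value, the absolutely convergent case `ρ = 1`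
  -- dominates the sum and the integral uniformly in `ξ`.
  have habs : Summable fun n =>
      |meixnerH α θ p u n * meixnerPoly α θ u n x * meixnerPoly α θ u n y| := by
    have := (summable_meixner_kernel hu hα hθ (ρ := fun _ => 1)
      (meanSquareConvergent_of_abs_le_one hu hα hθ (by simp)) x y).abs
    simpa using this
  have hint := fun n => integrable_rhoMonomial hu hyp hν n
  rw [expansion_eq_tsum hu hα hθ (by simp [rhoMonomial])
    (meanSquareConvergent_of_abs_le_one hu hα hθ (abs_integral_rhoMonomial_le_one hu hyp hν))]
  refine mul_nonneg (mul_nonneg (meixnerProb_pos hα hθ hu.p_pos x).le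
    (meixnerProb_pos hα hθ hu.p_pos y).le) ?_
  let F : (Fin (m + 1) →₀ ℕ) → (Fin (m + 1) → ℝ) → ℝ := fun n ξ =>
    rhoMonomial u n ξ * (meixnerH α θ p u n * meixnerPoly α θ u n x * meixnerPoly α θ u n y)
  have hF : ∀ n, Integrable (F n) ν := fun n => (hint n).mul_const _
  have hnorm : ∀ n, ∫ ξ, ‖F n ξ‖ ∂ν ≤
      |meixnerH α θ p u n * meixnerPoly α θ u n x * meixnerPoly α θ u n y| := fun n => by
    have h1 : ∀ᵐ ξ ∂ν, ‖F n ξ‖ ≤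
        |meixnerH α θ p u n * meixnerPoly α θ u n x * meixnerPoly α θ u n y| := by
      filter_upwards [hν] with ξ hξ
      simp only [F]
      rw [norm_mul, Real.norm_eq_abs, Real.norm_eq_abs]
      exact mul_le_of_le_one_left (abs_nonneg _) (abs_rhoMonomial_le_one hu hyp hξ n)
    have := integral_mono_ae (hF n).norm (integrable_const _) h1
    simpa using this
  have hsum := Summable.of_nonneg_of_le (fun n => integral_nonneg fun ξ => norm_nonneg _)
    hnorm habs
  have h2 := integral_tsum_of_summable_integral_norm hF hsum
  have h3 : ∑' n, (∫ ξ, rhoMonomial u n ξ ∂ν) * meixnerH α θ p u n * meixnerPoly α θ u n x *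
      meixnerPoly α θ u n y = ∫ ξ, ∑' n, F n ξ ∂ν := by
    rw [← h2]
    refine tsum_congr fun n => ?_
    simp only [F]
    rw [integral_mul_const]; ring
  rw [h3]
  refine integral_nonneg_of_ae ?_
  filter_upwards [hν, h] with ξ hξ hn
  have h4 := hn x y
  rw [expansion_eq_tsum hu hα hθ (by simp [rhoMonomial])
    (meanSquareConvergent_of_abs_le_one hu hα hθ (abs_rhoMonomial_le_one hu hyp hξ))] at h4
  have h5 := (mul_nonneg_iff_of_pos_left (mul_pos (meixnerProb_pos hα hθ hu.p_pos x)
    (meixnerProb_pos hα hθ hu.p_pos y))).1 h4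
  refine h5.trans_eq (tsum_congr fun n => ?_)
  simp only [F]; ring

end Extreme

end MultivariateMeixner

namespace MultivariateMeixner

/-! ### Power series whose coefficients are asymptotically those of an exponential. -/

section ExpType

variable {σ : Type*} [Fintype σ] {X : Type*}

/-- The coefficient of `w ^ n` in `exp (∑ l_j w_j)`. -/
noncomputable def expCoeff (l : σ → ℝ) (n : σ →₀ ℕ) : ℝ := ∏ j, l j ^ n j / ((n j) ! : ℝ)

lemma hasSum_expCoeff (l w : σ → ℝ) :
    HasSum (fun n : σ →₀ ℕ => expCoeff l n * mon w n) (Real.exp (∑ j, l j * w j)) := by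
  refine (Finsupp.equivFunOnFinite.hasSum_iff.2 (hasSum_exp_sum fun j => l j * w j)).congr_fun
    fun n => ?_
  simp only [expCoeff, mon, ← Finset.prod_mul_distrib, Function.comp_apply,
    Finsupp.equivFunOnFinite_apply]
  exact Finset.prod_congr rfl fun j _ => by rw [mul_pow]; ring

lemma expCoeff_add [DecidableEq σ] (l l' : σ → ℝ) (n : σ →₀ ℕ) :
    expCoeff (fun j => l j + l' j) n =
      ∑ q ∈ Finset.HasAntidiagonal.antidiagonal n, expCoeff l q.1 * expCoeff l' q.2 := by
  refine ext_of_hasSum (f := fun w => Real.exp (∑ j, (l j + l' j) * w j)) one_pos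
    (fun w _ => hasSum_expCoeff _ w)
    (G := fun n => ∑ q ∈ Finset.HasAntidiagonal.antidiagonal n, expCoeff l q.1 * expCoeff l' q.2)
    (fun w _ => ?_) n
  have h := hasSum_mul_antidiagonal (hasSum_expCoeff l w) (hasSum_expCoeff l' w)
  rw [← Real.exp_add, ← Finset.sum_add_distrib] at h
  simp only [← add_mul] at h
  exact h.congr_fun fun n => mul_mon_antidiagonal _ _ _ _

/-- The coefficients of the power series `F x` agree with those of `exp (∑ l_j(x) w_j)` up to terms
of lower order in the size `N x`. -/
structure IsExpType (N : X → ℝ) (l : X → σ → ℝ) (F : X → MvPowerSeries σ ℝ) : Prop where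
  lin : ∃ C, ∀ x j, |l x j| ≤ C * N x
  coeff : ∀ n : σ →₀ ℕ, ∃ C, ∀ x,
    N x * |MvPowerSeries.coeff n (F x) - expCoeff (l x) n| ≤ C * N x ^ (∑ j, n j)

namespace IsExpType

variable {N : X → ℝ} {l l' : X → σ → ℝ} {F G : X → MvPowerSeries σ ℝ}

lemma exists_expCoeff_le (h : IsExpType N l F) (n : σ →₀ ℕ) :
    ∃ C, ∀ x, |expCoeff (l x) n| ≤ C * N x ^ (∑ j, n j) := by
  obtain ⟨C, hC⟩ := h.lin
  refine ⟨∏ j, C ^ n j / ((n j) ! : ℝ), fun x => ?_⟩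
  rw [expCoeff, Finset.abs_prod, ← Finset.prod_pow_eq_pow_sum, ← Finset.prod_mul_distrib]
  refine Finset.prod_le_prod (fun _ _ => abs_nonneg _) fun j _ => ?_
  rw [abs_div, abs_pow, Nat.abs_cast, div_mul_eq_mul_div, ← mul_pow]
  gcongr
  exact hC x j

lemma exists_coeff_le (h : IsExpType N l F) (hN : ∀ x, 1 ≤ N x) (n : σ →₀ ℕ) :
    ∃ C, ∀ x, |MvPowerSeries.coeff n (F x)| ≤ C * N x ^ (∑ j, n j) := by
  obtain ⟨C, hC⟩ := h.exists_expCoeff_le n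
  obtain ⟨D, hD⟩ := h.coeff n
  refine ⟨C + D, fun x => ?_⟩
  have h1 := (le_mul_of_one_le_left (abs_nonneg _) (hN x)).trans (hD x)
  have h2 := abs_add_le (MvPowerSeries.coeff n (F x) - expCoeff (l x) n) (expCoeff (l x) n)
  rw [sub_add_cancel] at h2
  linarith [hC x]

/-- Exponents add because `exp` is multiplicative. The error is `fg - f'g' = (f - f')g + f'(g -
g')`, one factor being of lower order and the other of the full order of its degree. -/
lemma mul (hN : ∀ x, 1 ≤ N x) (hF : IsExpType N l F) (hG : IsExpType N l' G) :
    IsExpType N (fun x j => l x j + l' x j) fun x => F x * G x := by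
  classical
  constructor
  · obtain ⟨C, hC⟩ := hF.lin
    obtain ⟨D, hD⟩ := hG.lin
    exact ⟨C + D, fun x j => (abs_add_le _ _).trans (by linarith [hC x j, hD x j])⟩
  · intro n
    choose A hA using hF.coeff
    choose B hB using hG.exists_coeff_le hN
    choose A' hA' using hG.coeff
    choose B' hB' using hF.exists_expCoeff_le
    refine ⟨∑ q ∈ Finset.HasAntidiagonal.antidiagonal n, (A q.1 * B q.2 + B' q.1 * A' q.2),
      fun x => ?_⟩
    have hx : 0 < N x := one_pos.trans_le (hN x)
    rw [MvPowerSeries.coeff_mul, expCoeff_add, ← Finset.sum_sub_distrib, Finset.sum_mul]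
    refine (mul_le_mul_of_nonneg_left (Finset.abs_sum_le_sum_abs _ _) hx.le).trans ?_
    rw [Finset.mul_sum]
    refine Finset.sum_le_sum fun q hq => ?_
    have hdeg : ∑ j, n j = ∑ j, q.1 j + ∑ j, q.2 j := by
      rw [← Finset.HasAntidiagonal.mem_antidiagonal.1 hq, ← Finset.sum_add_distrib]; rfl
    have e : MvPowerSeries.coeff q.1 (F x) * MvPowerSeries.coeff q.2 (G x) -
        expCoeff (l x) q.1 * expCoeff (l' x) q.2 =
        (MvPowerSeries.coeff q.1 (F x) - expCoeff (l x) q.1) * MvPowerSeries.coeff q.2 (G x) +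
        expCoeff (l x) q.1 * (MvPowerSeries.coeff q.2 (G x) - expCoeff (l' x) q.2) := by ring
    have h1 := mul_le_mul (hA q.1 x) (hB q.2 x) (abs_nonneg _)
      ((mul_nonneg hx.le (abs_nonneg _)).trans (hA q.1 x))
    have h2 := mul_le_mul (hB' q.1 x) (hA' q.2 x) (mul_nonneg hx.le (abs_nonneg _))
      ((abs_nonneg _).trans (hB' q.1 x))
    have h3 := mul_le_mul_of_nonneg_left (abs_add_le
      ((MvPowerSeries.coeff q.1 (F x) - expCoeff (l x) q.1) * MvPowerSeries.coeff q.2 (G x))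
      (expCoeff (l x) q.1 * (MvPowerSeries.coeff q.2 (G x) - expCoeff (l' x) q.2))) hx.le
    rw [e, hdeg, pow_add]
    rw [abs_mul, abs_mul] at h3
    calc _ ≤ _ := h3
      _ = N x * |MvPowerSeries.coeff q.1 (F x) - expCoeff (l x) q.1| *
            |MvPowerSeries.coeff q.2 (G x)| +
          |expCoeff (l x) q.1| *
            (N x * |MvPowerSeries.coeff q.2 (G x) - expCoeff (l' x) q.2|) := by ring
      _ ≤ _ := add_le_add h1 h2
      _ = _ := by ring

lemma one (N : X → ℝ) :
    IsExpType N (fun _ (_ : σ) => 0) fun _ => (1 : MvPowerSeries σ ℝ) := by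
  classical
  refine ⟨⟨0, fun x j => by simp⟩, fun n => ⟨0, fun x => ?_⟩⟩
  have : MvPowerSeries.coeff n (1 : MvPowerSeries σ ℝ) = expCoeff (fun _ => 0) n := by
    rw [MvPowerSeries.coeff_one, expCoeff]
    split_ifs with h
    · simp [h]
    · obtain ⟨j, hj⟩ := Finsupp.ne_iff.1 h
      exact (Finset.prod_eq_zero (Finset.mem_univ j) (by simpa using Or.inl hj)).symm
  simp [this]

lemma prod (hN : ∀ x, 1 ≤ N x) {ι : Type*} (s : Finset ι) {ls : ι → X → σ → ℝ}
    {Fs : ι → X → MvPowerSeries σ ℝ} (h : ∀ i ∈ s, IsExpType N (ls i) (Fs i)) :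
    IsExpType N (fun x j => ∑ i ∈ s, ls i x j) fun x => ∏ i ∈ s, Fs i x := by
  classical
  induction s using Finset.induction_on with
  | empty => simpa using one N
  | insert a s ha ih =>
    simp only [Finset.sum_insert ha, Finset.prod_insert ha]
    exact (h a (by simp)).mul hN (ih fun i hi => h i (by simp [hi]))

end IsExpType

/-- The rising factorial of `t + β` is `t^k` plus lower order terms. The saved order is written as a
factor `1 + |t|` on the left, so that `k = 0` needs no negative exponent. -/
lemma exists_ascPochhammer_sub_pow_le (β : ℝ) (k : ℕ) : ∃ C, 0 ≤ C ∧ ∀ t : ℝ,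
    (1 + |t|) * |(ascPochhammer ℝ k).eval (t + β) - t ^ k| ≤ C * (1 + |t|) ^ k := by
  induction k with
  | zero => exact ⟨0, le_rfl, fun t => by simp⟩
  | succ k ih =>
    obtain ⟨C, hC0, hC⟩ := ih
    refine ⟨C * (1 + |β + k|) + |β + k|, by positivity, fun t => ?_⟩
    have e : (ascPochhammer ℝ (k + 1)).eval (t + β) - t ^ (k + 1) =
        ((ascPochhammer ℝ k).eval (t + β) - t ^ k) * (t + (β + k)) + t ^ k * (β + k) := by
      rw [ascPochhammer_succ_eval]; ring
    have ht := abs_nonneg t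
    have h1 : |t + (β + k)| ≤ (1 + |β + k|) * (1 + |t|) := by
      have := abs_add_le t (β + k)
      nlinarith [abs_nonneg (β + k)]
    have h2 : |t| ^ k ≤ (1 + |t|) ^ k := pow_le_pow_left₀ ht (by linarith) k
    rw [e]
    calc _ ≤ (1 + |t|) * (|(ascPochhammer ℝ k).eval (t + β) - t ^ k| * |t + (β + k)| +
          |t| ^ k * |β + k|) := by
          refine mul_le_mul_of_nonneg_left ((abs_add_le _ _).trans_eq ?_) (by linarith)
          rw [abs_mul, abs_mul, abs_pow]
      _ = ((1 + |t|) * |(ascPochhammer ℝ k).eval (t + β) - t ^ k|) * |t + (β + k)| +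
          (1 + |t|) * (|t| ^ k * |β + k|) := by ring
      _ ≤ C * (1 + |t|) ^ k * ((1 + |β + k|) * (1 + |t|)) +
          (1 + |t|) * ((1 + |t|) ^ k * |β + k|) := by
          have := mul_le_mul (hC t) h1 (abs_nonneg _) (by positivity)
          have h3 : |t| ^ k * |β + k| ≤ (1 + |t|) ^ k * |β + k| :=
            mul_le_mul_of_nonneg_right h2 (abs_nonneg _)
          exact add_le_add this (mul_le_mul_of_nonneg_left h3 (by linarith))
      _ = _ := by ring

/-- Enlarging `1 + |t|` to `N` is harmless only after the factor on the left is cancelled: for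
positive `k` the difference has order `k - 1 ≥ 0`, and for `k = 0` it is zero. -/
lemma exists_mul_ascPochhammer_sub_pow_le (β : ℝ) (k : ℕ) : ∃ C, 0 ≤ C ∧ ∀ t N : ℝ, 1 + |t| ≤ N →
    N * |(ascPochhammer ℝ k).eval (t + β) - t ^ k| ≤ C * N ^ k := by
  cases k with
  | zero => exact ⟨0, le_rfl, fun t N _ => by simp⟩
  | succ k =>
    obtain ⟨C, hC0, hC⟩ := exists_ascPochhammer_sub_pow_le β (k + 1)
    refine ⟨C, hC0, fun t N hN => ?_⟩
    have ht : 0 < 1 + |t| := by positivity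
    have h1 : |(ascPochhammer ℝ (k + 1)).eval (t + β) - t ^ (k + 1)| ≤ C * (1 + |t|) ^ k := by
      have := hC t
      rw [pow_succ (1 + |t|), ← mul_assoc, mul_comm (1 + |t|)] at this
      exact le_of_mul_le_mul_right this ht
    calc _ ≤ N * (C * N ^ k) := by
          refine mul_le_mul_of_nonneg_left (h1.trans ?_) (ht.le.trans hN)
          gcongr
      _ = _ := by ring

end ExpType

/-! ### Leading terms of the Meixner polynomials. -/

section Asymptotics

variable {m : ℕ} {α θ : ℝ} {u : Fin (m + 1) → Fin (m + 1) → ℝ}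

/-- `1 + |x|`. -/
noncomputable def size (x : Fin (m + 1) → ℕ) : ℝ := 1 + ∑ i, (x i : ℝ)

lemma one_le_size (x : Fin (m + 1) → ℕ) : 1 ≤ size x :=
  le_add_of_nonneg_right (Finset.sum_nonneg fun _ _ => Nat.cast_nonneg _)

/-- The multinomial theorem seen as the negative multinomial series with `c = -k` and variables
`-l_j w_j`. In this form the coefficient is a rising factorial, to be compared with a power. -/
lemma coeff_one_add_linear_pow (l : Fin (m + 1) → ℝ) (k : ℕ) (n : Fin (m + 1) →₀ ℕ) :
    MvPowerSeries.coeff n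
      ((1 + ∑ j, MvPowerSeries.C (l j) * MvPowerSeries.X j : MvPowerSeries (Fin (m + 1)) ℝ) ^ k) =
      (ascPochhammer ℝ (∑ j, n j)).eval (-(k : ℝ)) * expCoeff (fun j => -l j) n := by
  have hA : 0 < 1 + ∑ j, |l j| := by positivity
  have hA' : ∑ j, |l j| / (2 * (1 + ∑ j, |l j|)) < 1 := by
    rw [← Finset.sum_div, div_lt_one (by positivity)]; linarith
  refine ext_of_hasSum (ε := (2 * (1 + ∑ j, |l j|))⁻¹) (by positivity)
    (f := fun w => (1 + ∑ j, l j * w j) ^ k)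
    (F := fun n => MvPowerSeries.coeff n
      ((1 + ∑ j, MvPowerSeries.C (l j) * MvPowerSeries.X j : MvPowerSeries (Fin (m + 1)) ℝ) ^ k))
    (G := fun n => (ascPochhammer ℝ (∑ j, n j)).eval (-(k : ℝ)) * expCoeff (fun j => -l j) n)
    (fun w _ => (hasEval_one.add (HasEval.sum _ fun j _ => hasEval_C_mul_X _ _)).pow k)
    (fun w hw => ?_) n
  have hlt : ∑ j, |-l j * w j| < 1 := by
    refine lt_of_le_of_lt (Finset.sum_le_sum fun j _ => ?_) hA'
    rw [abs_mul, abs_neg, div_eq_mul_inv]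
    exact mul_le_mul_of_nonneg_left (hw j) (abs_nonneg _)
  have h := Finsupp.equivFunOnFinite.hasSum_iff.2
    (hasSum_negMultinomial (-(k : ℝ)) (fun j => -l j * w j) hlt)
  rw [neg_neg, Real.rpow_natCast] at h
  simp only [neg_mul, Finset.sum_neg_distrib, sub_neg_eq_add] at h
  refine h.congr_fun fun n => ?_
  simp only [expCoeff, mon, Function.comp_apply, Finsupp.equivFunOnFinite_apply, mul_assoc,
    ← Finset.prod_mul_distrib]
  congr 1
  refine Finset.prod_congr rfl fun j _ => ?_
  rw [neg_pow (l j * w j), neg_pow (l j), mul_pow]; ring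

/-- The coefficients contain `(-x_i)_{|n|}`, which is `(-x_i)^{|n|}` to leading order; the signs
recombine with those of `-l_j`. -/
lemma isExpType_linear_pow (l : Fin (m + 1) → ℝ) (i : Fin (m + 1)) :
    IsExpType size (fun (x : Fin (m + 1) → ℕ) j => x i * l j) fun x =>
      (1 + ∑ j, MvPowerSeries.C (l j) * MvPowerSeries.X j : MvPowerSeries (Fin (m + 1)) ℝ) ^ x i := by
  have hle : ∀ x : Fin (m + 1) → ℕ, 1 + |-(x i : ℝ)| ≤ size x := fun x => by
    rw [abs_neg, Nat.abs_cast, size]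
    gcongr
    exact Finset.single_le_sum (f := fun i => (x i : ℝ)) (fun _ _ => Nat.cast_nonneg _)
      (Finset.mem_univ i)
  refine ⟨⟨∑ j, |l j|, fun x j => ?_⟩, fun n => ?_⟩
  · rw [abs_mul, mul_comm]
    have h1 : |(x i : ℝ)| ≤ size x := by have := hle x; rw [abs_neg] at this; linarith
    have h2 : |l j| ≤ ∑ j, |l j| := Finset.single_le_sum (f := fun j => |l j|)
      (fun _ _ => abs_nonneg _) (Finset.mem_univ j)
    gcongr
  · obtain ⟨C, hC0, hC⟩ := exists_mul_ascPochhammer_sub_pow_le 0 (∑ j, n j)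
    refine ⟨C * |expCoeff (fun j => -l j) n|, fun x => ?_⟩
    have e : expCoeff (fun j => (x i : ℝ) * l j) n =
        (-(x i : ℝ)) ^ (∑ j, n j) * expCoeff (fun j => -l j) n := by
      rw [expCoeff, expCoeff, ← Finset.prod_pow_eq_pow_sum, ← Finset.prod_mul_distrib]
      refine Finset.prod_congr rfl fun j _ => ?_
      rw [← mul_div_assoc, ← mul_pow, neg_mul_neg]
    have h := hC (-(x i : ℝ)) (size x) (hle x)
    rw [add_zero] at h
    rw [coeff_one_add_linear_pow, e, ← sub_mul, abs_mul, ← mul_assoc]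
    calc _ ≤ C * size x ^ (∑ j, n j) * |expCoeff (fun j => -l j) n| := by gcongr
      _ = _ := by ring

/-- Only powers of `w₀` occur, with coefficients `(|x| + α)_k / k!`, and the shift by `α` is of
lower order. -/
lemma isExpType_negBinSeries (α : ℝ) :
    IsExpType size (fun (x : Fin (m + 1) → ℕ) => Pi.single 0 (∑ i, (x i : ℝ))) fun x =>
      negBinSeries m ((∑ i, x i : ℕ) + α) := by
  have hle : ∀ x : Fin (m + 1) → ℕ, 1 + |∑ i, (x i : ℝ)| ≤ size x := fun x => by
    rw [abs_of_nonneg (Finset.sum_nonneg fun _ _ => Nat.cast_nonneg _), size]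
  refine ⟨⟨1, fun x j => ?_⟩, fun n => ?_⟩
  · by_cases hj : j = 0
    · subst hj; simpa using (by linarith [hle x] : |∑ i, (x i : ℝ)| ≤ size x)
    · have := one_le_size x
      simp only [Pi.single_apply, hj, if_false, abs_zero]; linarith
  · obtain ⟨C, hC0, hC⟩ := exists_mul_ascPochhammer_sub_pow_le α (n 0)
    by_cases hn : n = Finsupp.single 0 (n 0)
    · refine ⟨C, fun x => ?_⟩
      have hsum : ∑ j, n j = n 0 := by
        rw [hn, Finset.sum_eq_single 0] <;> simp +contextual [eq_comm]
      have e : expCoeff (Pi.single 0 (∑ i, (x i : ℝ)) : Fin (m + 1) → ℝ) n =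
          (∑ i, (x i : ℝ)) ^ n 0 / ((n 0) ! : ℝ) := by
        rw [expCoeff, Finset.prod_eq_single 0]
        · simp
        · intro j _ hj
          rw [hn]; simp [hj.symm]
        · simp
      have h := hC (∑ i, (x i : ℝ)) (size x) (hle x)
      rw [e, hsum, MvPowerSeries.coeff_apply, negBinSeries, if_pos hn, ← sub_div, abs_div,
        Nat.abs_cast, mul_div_assoc']
      push_cast
      refine (div_le_self (mul_nonneg (by linarith [one_le_size x]) (abs_nonneg _)) ?_).trans h
      exact_mod_cast Nat.one_le_iff_ne_zero.2 (Nat.factorial_ne_zero _)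
    · refine ⟨0, fun x => ?_⟩
      have e : expCoeff (Pi.single 0 (∑ i, (x i : ℝ)) : Fin (m + 1) → ℝ) n = 0 := by
        obtain ⟨j, hj⟩ := Finsupp.ne_iff.1 hn
        refine Finset.prod_eq_zero (Finset.mem_univ j) ?_
        have hj0 : j ≠ 0 := by rintro rfl; simp at hj
        have : n j ≠ 0 := by simpa [Finsupp.single_apply, hj0.symm] using hj
        simp [hj0, this]
      rw [e, MvPowerSeries.coeff_apply, negBinSeries, if_neg hn]
      simp

/-- The leading coefficient `(-1/θ)^{n₀} / ∏ n_j!` of the Meixner polynomials. -/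
noncomputable def leadCoeff (θ : ℝ) (n : Fin (m + 1) →₀ ℕ) : ℝ :=
  (-(1 / θ)) ^ n 0 / ∏ j, ((n j) ! : ℝ)

lemma leadCoeff_ne_zero (hθ : 0 < θ) (n : Fin (m + 1) →₀ ℕ) : leadCoeff θ n ≠ 0 :=
  div_ne_zero (pow_ne_zero _ (neg_ne_zero.2 (by positivity)))
    (Finset.prod_ne_zero_iff.2 fun _ _ => by positivity)

/-- The leading term of the Meixner polynomials. -/
lemma exists_meixnerPoly_sub_le {p : Fin (m + 1) → ℝ} (hu : IsOrthogonalBasis p u) (hθ : 0 < θ)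
    (n : Fin (m + 1) →₀ ℕ) :
    ∃ C, ∀ x : Fin (m + 1) → ℕ, size x * |meixnerPoly α θ u n x -
      leadCoeff θ n * rhoMonomial u n (fun i => (x i : ℝ))| ≤ C * size x ^ (∑ j, n j) := by
  let l : Fin (m + 1) → Fin (m + 1) → ℝ := fun i =>
    Fin.cons (-((1 + θ) / θ)) fun j : Fin m => u j.succ i
  have h := (isExpType_negBinSeries (m := m) α).mul one_le_size
    (IsExpType.prod one_le_size Finset.univ fun i _ => isExpType_linear_pow (l i) i)
  obtain ⟨C, hC⟩ := h.coeff n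
  refine ⟨C, fun x => ?_⟩
  have e1 : negBinSeries m ((∑ i, x i : ℕ) + α) * ∏ i,
      (1 + ∑ j, MvPowerSeries.C (l i j) * MvPowerSeries.X j) ^ x i = meixnerGen α θ u x := by
    rw [meixnerGen]
    congr 1
    refine Finset.prod_congr rfl fun i _ => ?_
    rw [Fin.sum_univ_succ]
    simp only [l, Fin.cons_zero, Fin.cons_succ, map_neg]
    ring
  have e2 : expCoeff (fun j => (Pi.single 0 (∑ i, (x i : ℝ)) : Fin (m + 1) → ℝ) j +
      ∑ i, (x i : ℝ) * l i j) n = leadCoeff θ n * rhoMonomial u n (fun i => (x i : ℝ)) := by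
    -- In the coordinate `0` the two contributions combine to `|x| - |x|(1 + θ)/θ = -|x|/θ`; this is
    -- the origin of the factor `-1/θ` in `leadCoeff`.
    have e3 : ∀ j, (Pi.single 0 (∑ i, (x i : ℝ)) : Fin (m + 1) → ℝ) j + ∑ i, (x i : ℝ) * l i j =
        (if j = 0 then -(1 / θ) else 1) * rhoForm u j (fun i => (x i : ℝ)) := fun j => by
      refine Fin.cases ?_ (fun j => ?_) j
      · simp only [l, Fin.cons_zero, Pi.single_eq_same, if_true, rhoForm_zero hu]
        rw [← Finset.sum_mul]; field_simp; ring
      · simp only [l, Fin.cons_succ, Pi.single_apply, Fin.succ_ne_zero, if_false, zero_add,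
          one_mul, rhoForm]
        exact Finset.sum_congr rfl fun i _ => mul_comm _ _
    simp only [e3, expCoeff, leadCoeff, rhoMonomial, mul_pow, Finset.prod_div_distrib,
      Finset.prod_mul_distrib]
    have e4 : ∏ j, (if j = 0 then -(1 / θ) else (1 : ℝ)) ^ n j = (-(1 / θ)) ^ n 0 := by
      rw [Finset.prod_eq_single 0] <;> simp +contextual
    rw [e4]; ring
  have h5 := hC x
  rw [e1, e2] at h5
  exact h5

end Asymptotics

end MultivariateMeixner

namespace MultivariateMeixner

/-! ### Moments of the conditional distributions given `X = K e_d`. -/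

section Moments

open Filter Topology

variable {m : ℕ} {α θ : ℝ} {p : Fin (m + 1) → ℝ} {u : Fin (m + 1) → Fin (m + 1) → ℝ}
  {ρ : (Fin (m + 1) →₀ ℕ) → ℝ}

/-- The conditional probability function of `Y` given `X = K e_d`. -/
noncomputable def condProb (α θ : ℝ) (p : Fin (m + 1) → ℝ) (u : Fin (m + 1) → Fin (m + 1) → ℝ)
    (ρ : (Fin (m + 1) →₀ ℕ) → ℝ) (K : ℕ) (y : Fin (m + 1) → ℕ) : ℝ :=
  expansion α θ p u ρ (Pi.single (Fin.last m) K) y /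
    meixnerProb α θ p (Pi.single (Fin.last m) K)

/-- The remainder of a Meixner polynomial after its leading term. -/
noncomputable def meixnerRem (α θ : ℝ) (u : Fin (m + 1) → Fin (m + 1) → ℝ) (n : Fin (m + 1) →₀ ℕ)
    (y : Fin (m + 1) → ℕ) : ℝ :=
  meixnerPoly α θ u n y - leadCoeff θ n * rhoMonomial u n (fun i => (y i : ℝ))

lemma exists_meixnerRem_le (hu : IsOrthogonalBasis p u) (hθ : 0 < θ) {n : Fin (m + 1) →₀ ℕ}
    {k : ℕ} (hn : ∑ j, n j = k + 1) :
    ∃ C, 0 ≤ C ∧ ∀ y, |meixnerRem α θ u n y| ≤ C * size y ^ k := by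
  obtain ⟨C, hC⟩ := exists_meixnerPoly_sub_le (α := α) hu hθ n
  refine ⟨|C|, abs_nonneg _, fun y => ?_⟩
  have hy : 0 < size y := one_pos.trans_le (one_le_size y)
  have h := hC y
  rw [hn, pow_succ, ← mul_assoc, mul_comm (size y)] at h
  refine (le_of_mul_le_mul_right h hy).trans ?_
  gcongr
  exact le_abs_self _

lemma size_single (K : ℕ) : size (Pi.single (Fin.last m) K : Fin (m + 1) → ℕ) = 1 + K := by
  rw [size, Finset.sum_eq_single (Fin.last m)] <;> simp +contextual

lemma rhoMonomial_smul (n : Fin (m + 1) →₀ ℕ) (c : ℝ) (ξ : Fin (m + 1) → ℝ) :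
    rhoMonomial u n (fun i => c * ξ i) = c ^ (∑ j, n j) * rhoMonomial u n ξ := by
  have : ∀ j, rhoForm u j (fun i => c * ξ i) = c * rhoForm u j ξ := fun j => by
    rw [rhoForm, rhoForm, Finset.mul_sum]
    exact Finset.sum_congr rfl fun i _ => by ring
  simp only [rhoMonomial, this, mul_pow, Finset.prod_mul_distrib, Finset.prod_pow_eq_pow_sum]

lemma rhoMonomial_single_last (hu : IsOrthogonalBasis p u) (n : Fin (m + 1) →₀ ℕ) (K : ℕ) :
    rhoMonomial u n (fun i => ((Pi.single (Fin.last m) K : Fin (m + 1) → ℕ) i : ℝ)) =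
      (K : ℝ) ^ (∑ j, n j) := by
  have : ∀ j, rhoForm u j (fun i => ((Pi.single (Fin.last m) K : Fin (m + 1) → ℕ) i : ℝ)) = K :=
    fun j => by
      rw [rhoForm, Finset.sum_eq_single (Fin.last m)] <;> simp +contextual [hu.u_last]
  simp only [rhoMonomial, this, Finset.prod_pow_eq_pow_sum]

lemma sum_single_apply (k : ℕ) : ∑ j, (Finsupp.single (0 : Fin (m + 1)) k) j = k := by
  rw [Finset.sum_eq_single 0] <;> simp +contextual

lemma rhoMonomial_single_zero (hu : IsOrthogonalBasis p u) (k : ℕ) (ξ : Fin (m + 1) → ℝ) :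
    rhoMonomial u (Finsupp.single 0 k) ξ = (∑ i, ξ i) ^ k := by
  rw [rhoMonomial, Finset.prod_eq_single 0, rhoForm_zero hu] <;> simp +contextual [eq_comm]

/-- A family of conditional distributions, with `K`-th member given `X = K e_d`, that acts
diagonally on the Meixner polynomials. -/
structure IsDiagonalFamily (α θ : ℝ) (u : Fin (m + 1) → Fin (m + 1) → ℝ)
    (ρ : (Fin (m + 1) →₀ ℕ) → ℝ) (κ : ℕ → (Fin (m + 1) → ℕ) → ℝ) : Prop where
  nonneg : ∀ K y, 0 ≤ κ K y
  hasSum : ∀ K n, HasSum (fun y => κ K y * meixnerPoly α θ u n y)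
    (ρ n * meixnerPoly α θ u n (Pi.single (Fin.last m) K))

lemma isDiagonalFamily_condProb (hu : IsOrthogonalBasis p u) (hα : 0 < α) (hθ : 0 < θ)
    (h0 : ρ 0 = 1) (hρ : MeanSquareConvergent α θ p u ρ) (hnn : IsNonnegExpansion α θ p u ρ) :
    IsDiagonalFamily α θ u ρ (condProb α θ p u ρ) := by
  refine ⟨fun K y => div_nonneg (hnn _ _) (meixnerProb_pos hα hθ hu.p_pos _).le, fun K n => ?_⟩
  have hP := (meixnerProb_pos hα hθ hu.p_pos (Pi.single (Fin.last m) K)).ne'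
  have h := (hasSum_expansion_mul_meixnerPoly hu hα hθ h0 hρ (Pi.single (Fin.last m) K) n).div_const
    (meixnerProb α θ p (Pi.single (Fin.last m) K))
  rw [mul_div_cancel_left₀ _ hP] at h
  exact h.congr_fun fun y => by rw [condProb]; ring

variable {κ : ℕ → (Fin (m + 1) → ℕ) → ℝ}

lemma IsDiagonalFamily.hasSum_one (hκ : IsDiagonalFamily α θ u ρ κ) (h0 : ρ 0 = 1) (K : ℕ) :
    HasSum (κ K) 1 := by
  simpa [meixnerPoly_zero, h0] using hκ.hasSum K 0

/-- Induction on the order. Up to a constant, `|y|^{k+1}` is the leading term of the Meixner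
polynomial of index `(k + 1) e_0`; its conditional mean is known and of order `K^{k+1}`, and its
remainder is covered by the moment of order `k`. -/
lemma IsDiagonalFamily.exists_moment_le (hκ : IsDiagonalFamily α θ u ρ κ)
    (hu : IsOrthogonalBasis p u) (hθ : 0 < θ) (h0 : ρ 0 = 1) (k : ℕ) :
    ∃ C, 0 ≤ C ∧ ∀ K : ℕ, (Summable fun y => κ K y * size y ^ k) ∧
      ∑' y, κ K y * size y ^ k ≤ C * (1 + K) ^ k := by
  induction k with
  | zero =>
    refine ⟨1, zero_le_one, fun K => ?_⟩
    have h := hκ.hasSum_one h0 K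
    simpa using ⟨h.summable, h.tsum_eq.le⟩
  | succ k ih =>
    obtain ⟨C, hC0, hC⟩ := ih
    set n : Fin (m + 1) →₀ ℕ := Finsupp.single 0 (k + 1) with hn
    have hdeg : ∑ j, n j = k + 1 := sum_single_apply _
    obtain ⟨D, hD0, hD⟩ := exists_meixnerRem_le (α := α) hu hθ hdeg
    have hε := leadCoeff_ne_zero hθ n
    set ε := leadCoeff θ n
    -- The constant `2^k` comes from convexity: `(1 + a)^{k+1} ≤ 2^k (1 + a^{k+1})`.
    have hbase : ∀ y : Fin (m + 1) → ℕ, size y ^ (k + 1) ≤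
        2 ^ k * (1 + (ε⁻¹ * meixnerPoly α θ u n y + |ε|⁻¹ * D * size y ^ k)) := fun y => by
      have h1 : (∑ i, (y i : ℝ)) ^ (k + 1) = ε⁻¹ * (meixnerPoly α θ u n y - meixnerRem α θ u n y) := by
        rw [meixnerRem, rhoMonomial_single_zero hu]; field_simp; ring
      have h2 : -(ε⁻¹ * meixnerRem α θ u n y) ≤ |ε|⁻¹ * D * size y ^ k := by
        refine (neg_le_abs _).trans ?_
        rw [abs_mul, abs_inv, mul_assoc]
        exact mul_le_mul_of_nonneg_left (hD y) (by positivity)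
      have h3 := add_pow_le (zero_le_one (α := ℝ))
        (Finset.sum_nonneg fun i _ => Nat.cast_nonneg (y i) : (0:ℝ) ≤ ∑ i, (y i : ℝ)) (k + 1)
      rw [one_pow, Nat.add_sub_cancel] at h3
      refine h3.trans ?_
      gcongr
      rw [h1]; linarith
    have hX : ∃ E, 0 ≤ E ∧ ∀ K : ℕ,
        |meixnerPoly α θ u n (Pi.single (Fin.last m) K)| ≤ E * (1 + K) ^ (k + 1) := by
      refine ⟨|ε| + D, by positivity, fun K => ?_⟩
      have h1 := hD (Pi.single (Fin.last m) K)
      rw [size_single] at h1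
      have h2 : meixnerPoly α θ u n (Pi.single (Fin.last m) K) =
          ε * (K : ℝ) ^ (k + 1) + meixnerRem α θ u n (Pi.single (Fin.last m) K) := by
        rw [meixnerRem, rhoMonomial_single_last hu, hdeg]; ring
      have hK : (0:ℝ) ≤ K := Nat.cast_nonneg K
      have h3 : (K : ℝ) ^ (k + 1) ≤ (1 + K) ^ (k + 1) := pow_le_pow_left₀ hK (by linarith) _
      have h4 : (1 + K : ℝ) ^ k ≤ (1 + K) ^ (k + 1) := pow_le_pow_right₀ (by linarith) (by omega)
      rw [h2, add_mul]
      refine (abs_add_le _ _).trans (add_le_add ?_ (h1.trans (by gcongr)))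
      rw [abs_mul, abs_of_nonneg (by positivity : (0:ℝ) ≤ (K : ℝ) ^ (k + 1))]
      gcongr
    obtain ⟨E, hE0, hE⟩ := hX
    refine ⟨2 ^ k * (1 + (|ε|⁻¹ * (|ρ n| * E) + |ε|⁻¹ * D * C)), by positivity, fun K => ?_⟩
    have hsum : HasSum (fun y => κ K y * (2 ^ k * (1 + (ε⁻¹ * meixnerPoly α θ u n y +
        |ε|⁻¹ * D * size y ^ k)))) (2 ^ k * (1 + (ε⁻¹ * (ρ n * meixnerPoly α θ u n
          (Pi.single (Fin.last m) K)) + |ε|⁻¹ * D * ∑' y, κ K y * size y ^ k))) := by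
      have h1 := ((hκ.hasSum_one h0 K).add (((hκ.hasSum K n).mul_left ε⁻¹).add
        ((hC K).1.hasSum.mul_left (|ε|⁻¹ * D)))).mul_left (2 ^ k)
      exact h1.congr_fun fun y => by ring
    have hle : ∀ y, κ K y * size y ^ (k + 1) ≤ κ K y * (2 ^ k * (1 + (ε⁻¹ *
        meixnerPoly α θ u n y + |ε|⁻¹ * D * size y ^ k))) := fun y =>
      mul_le_mul_of_nonneg_left (hbase y) (hκ.nonneg K y)
    have hs := Summable.of_nonneg_of_le (fun y => mul_nonneg (hκ.nonneg K y)
      (pow_nonneg (by linarith [one_le_size y]) _)) hle hsum.summable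
    refine ⟨hs, (hasSum_le hle hs.hasSum hsum).trans ?_⟩
    have hK : (1:ℝ) ≤ 1 + K := by have : (0:ℝ) ≤ K := Nat.cast_nonneg K; linarith
    have h1 : ε⁻¹ * (ρ n * meixnerPoly α θ u n (Pi.single (Fin.last m) K)) ≤
        |ε|⁻¹ * (|ρ n| * E) * (1 + K) ^ (k + 1) := by
      refine (le_abs_self _).trans ?_
      rw [abs_mul, abs_mul, abs_inv, mul_assoc, mul_assoc]
      have := hE K
      gcongr
    have h2 : |ε|⁻¹ * D * ∑' y, κ K y * size y ^ k ≤ |ε|⁻¹ * D * C * (1 + K) ^ (k + 1) := by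
      rw [mul_assoc _ C]
      refine mul_le_mul_of_nonneg_left ((hC K).2.trans ?_) (by positivity)
      exact mul_le_mul_of_nonneg_left (pow_le_pow_right₀ hK (by omega)) hC0
    have h3 : (1:ℝ) ≤ (1 + K) ^ (k + 1) := one_le_pow₀ hK
    calc _ ≤ 2 ^ k * ((1 + K) ^ (k + 1) + (|ε|⁻¹ * (|ρ n| * E) * (1 + K) ^ (k + 1) +
          |ε|⁻¹ * D * C * (1 + K) ^ (k + 1))) := by gcongr
      _ = _ := by ring

/-- The moments of `Y / K`, given `X = K e_d`, converge to the coefficients `ρ_n`. -/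
lemma IsDiagonalFamily.tendsto_moment (hκ : IsDiagonalFamily α θ u ρ κ)
    (hu : IsOrthogonalBasis p u) (hθ : 0 < θ) (h0 : ρ 0 = 1) (n : Fin (m + 1) →₀ ℕ) :
    (∀ K, Summable fun y => κ K y * rhoMonomial u n (fun i => (K : ℝ)⁻¹ * y i)) ∧
      Tendsto (fun K : ℕ => ∑' y, κ K y * rhoMonomial u n (fun i => (K : ℝ)⁻¹ * y i)) atTop
        (𝓝 (ρ n)) := by
  rcases hdeg : ∑ j, n j with _ | k
  · have hn : n = 0 := by
      ext j; simpa using Finset.sum_eq_zero_iff.1 hdeg j (Finset.mem_univ j)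
    subst hn
    have : ∀ ξ : Fin (m + 1) → ℝ, rhoMonomial u 0 ξ = 1 := fun ξ => by simp [rhoMonomial]
    simp only [this, mul_one, h0]
    exact ⟨fun K => (hκ.hasSum_one h0 K).summable, by
      simp only [(hκ.hasSum_one h0 _).tsum_eq]; exact tendsto_const_nhds⟩
  · obtain ⟨D, hD0, hD⟩ := exists_meixnerRem_le (α := α) hu hθ hdeg
    obtain ⟨C, hC0, hC⟩ := hκ.exists_moment_le hu hθ h0 k
    have hε := leadCoeff_ne_zero hθ n
    set ε := leadCoeff θ n with hεdef
    have hle : ∀ K y, ‖κ K y * meixnerRem α θ u n y‖ ≤ D * (κ K y * size y ^ k) := fun K y => by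
      rw [norm_mul, Real.norm_of_nonneg (hκ.nonneg K y), Real.norm_eq_abs, mul_left_comm]
      exact mul_le_mul_of_nonneg_left (hD y) (hκ.nonneg K y)
    have hsR : ∀ K, Summable fun y => κ K y * meixnerRem α θ u n y := fun K =>
      Summable.of_norm_bounded ((hC K).1.mul_left D) (hle K)
    have hR : ∀ K : ℕ, |∑' y, κ K y * meixnerRem α θ u n y| ≤ D * C * (1 + K) ^ k := fun K => by
      rw [← Real.norm_eq_abs, mul_assoc]
      refine (tsum_of_norm_bounded ((hC K).1.hasSum.mul_left D) (hle K)).trans ?_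
      exact mul_le_mul_of_nonneg_left (hC K).2 hD0
    have hsum : ∀ K : ℕ, HasSum (fun y => κ K y * rhoMonomial u n (fun i => (K : ℝ)⁻¹ * y i))
        (((K : ℝ)⁻¹) ^ (k + 1) * (ε⁻¹ * (ρ n * meixnerPoly α θ u n (Pi.single (Fin.last m) K) -
          ∑' y, κ K y * meixnerRem α θ u n y))) := fun K => by
      refine (((((hκ.hasSum K n).sub (hsR K).hasSum).mul_left ε⁻¹).mul_left
        (((K : ℝ)⁻¹) ^ (k + 1)))).congr_fun fun y => ?_
      rw [rhoMonomial_smul, hdeg, meixnerRem, ← hεdef]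
      field_simp
      ring
    refine ⟨fun K => (hsum K).summable, ?_⟩
    simp only [(hsum _).tsum_eq]
    have hlim : Tendsto (fun K : ℕ => (|ε|⁻¹ * (|ρ n| * D + D * C)) * (2 ^ k * (1 / (K : ℝ)))) atTop
        (𝓝 ((|ε|⁻¹ * (|ρ n| * D + D * C)) * (2 ^ k * 0))) :=
      (tendsto_one_div_atTop_nhds_zero_nat.const_mul _).const_mul _
    rw [mul_zero, mul_zero] at hlim
    rw [tendsto_iff_dist_tendsto_zero]
    refine squeeze_zero' (Eventually.of_forall fun _ => dist_nonneg) ?_ hlim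
    filter_upwards [eventually_ge_atTop 1] with K hK
    have hK1 : (1:ℝ) ≤ K := by exact_mod_cast hK
    have hK0 : (0:ℝ) < K := by linarith
    have hX := hD (Pi.single (Fin.last m) K)
    rw [size_single] at hX
    -- The leading part of `M_n(K e_d)` is exactly `ε K^{k+1}`, which cancels `ρ_n`. Only remainders
    -- of order `K^k` survive, divided by `K^{k+1}`.
    have e : ((K : ℝ)⁻¹) ^ (k + 1) * (ε⁻¹ * (ρ n * meixnerPoly α θ u n
        (Pi.single (Fin.last m) K) - ∑' y, κ K y * meixnerRem α θ u n y)) - ρ n =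
        ((K : ℝ)⁻¹) ^ (k + 1) * (ε⁻¹ * (ρ n * meixnerRem α θ u n (Pi.single (Fin.last m) K) -
          ∑' y, κ K y * meixnerRem α θ u n y)) := by
      have h2 : meixnerPoly α θ u n (Pi.single (Fin.last m) K) =
          ε * (K : ℝ) ^ (k + 1) + meixnerRem α θ u n (Pi.single (Fin.last m) K) := by
        rw [meixnerRem, rhoMonomial_single_last hu, hdeg, ← hεdef]; ring
      rw [h2, inv_pow]
      field_simp
      ring
    rw [Real.dist_eq, e, abs_mul, abs_mul, abs_inv, abs_of_pos (by positivity)]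
    have h3 : |ρ n * meixnerRem α θ u n (Pi.single (Fin.last m) K) -
        ∑' y, κ K y * meixnerRem α θ u n y| ≤ (|ρ n| * D + D * C) * (1 + K) ^ k := by
      refine (abs_sub _ _).trans ?_
      rw [abs_mul, add_mul, mul_assoc]
      exact add_le_add (mul_le_mul_of_nonneg_left hX (abs_nonneg _)) (hR K)
    have h4 : (1 + K : ℝ) ^ k ≤ 2 ^ k * (K : ℝ) ^ k := by
      rw [← mul_pow]; exact pow_le_pow_left₀ (by positivity) (by linarith) k
    calc _ ≤ ((K : ℝ)⁻¹) ^ (k + 1) * (|ε|⁻¹ * ((|ρ n| * D + D * C) * (2 ^ k * (K : ℝ) ^ k))) := by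
          gcongr
          exact h3.trans (by gcongr)
      _ = _ := by rw [inv_pow, pow_succ]; field_simp

end Moments

/-! ### Passage to a limit law on the unit simplex. -/

section MomentRepresentation

open Filter Topology

variable {m : ℕ} {α θ : ℝ} {p : Fin (m + 1) → ℝ} {u : Fin (m + 1) → Fin (m + 1) → ℝ}
  {ρ : (Fin (m + 1) →₀ ℕ) → ℝ}

lemma isCompact_unitSimplex (m : ℕ) : IsCompact (unitSimplex m) := by
  have h : unitSimplex m ⊆ Set.Icc 0 1 := fun ξ hξ =>
    ⟨hξ.1, fun i => (Finset.single_le_sum (fun i _ => hξ.1 i) (Finset.mem_univ i)).trans hξ.2⟩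
  have hc : IsClosed (unitSimplex m) := by
    have : unitSimplex m = (⋂ i, {ξ | 0 ≤ ξ i}) ∩ {ξ | ∑ i, ξ i ≤ 1} := by
      ext ξ; simp [unitSimplex]
    rw [this]
    exact (isClosed_iInter fun i => isClosed_le continuous_const (continuous_apply i)).inter
      (isClosed_le (by fun_prop) continuous_const)
  exact isCompact_Icc.of_isClosed_subset hc h

/-- The radial retraction of the non-negative orthant onto the unit simplex. -/
noncomputable def simplexRetract (ξ : Fin (m + 1) → ℝ) : Fin (m + 1) → ℝ :=
  fun i => (max 1 (∑ j, ξ j))⁻¹ * ξ i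

lemma simplexRetract_mem {ξ : Fin (m + 1) → ℝ} (hξ : ∀ i, 0 ≤ ξ i) :
    simplexRetract ξ ∈ unitSimplex m := by
  have h : 0 < max 1 (∑ j, ξ j) := lt_max_of_lt_left one_pos
  refine ⟨fun i => mul_nonneg (inv_nonneg.2 h.le) (hξ i), ?_⟩
  simp only [simplexRetract, ← Finset.mul_sum]
  rw [inv_mul_le_one₀ h]
  exact le_max_right _ _

/-- Outside the simplex, homogeneity bounds the change by `z - 1` with `z = |ξ|^{|n|}`, and
Bernoulli's inequality gives `z - 1 ≤ z^k / k`. Thus a high moment controls the error with a small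
constant. -/
lemma abs_rhoMonomial_sub_retract_le (hu : IsOrthogonalBasis p u) (hyp : IsHypergroup p u)
    {ξ : Fin (m + 1) → ℝ} (hξ : ∀ i, 0 ≤ ξ i) (n : Fin (m + 1) →₀ ℕ) {k : ℕ} (hk : 0 < k) :
    |rhoMonomial u n (simplexRetract ξ) - rhoMonomial u n ξ| ≤
      (∑ i, ξ i) ^ ((∑ j, n j) * k) / k := by
  have hk' : (0:ℝ) < k := by exact_mod_cast hk
  have hS : 0 ≤ ∑ i, ξ i := Finset.sum_nonneg fun i _ => hξ i
  rcases le_total (∑ i, ξ i) 1 with h | h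
  · have : simplexRetract ξ = ξ := by funext i; simp [simplexRetract, max_eq_left h]
    rw [this, sub_self, abs_zero]; positivity
  · have hmax : max 1 (∑ j, ξ j) = ∑ i, ξ i := max_eq_right h
    have hpos : 0 < ∑ i, ξ i := by linarith
    have e : rhoMonomial u n ξ = (∑ i, ξ i) ^ (∑ j, n j) * rhoMonomial u n (simplexRetract ξ) := by
      rw [← rhoMonomial_smul]
      congr 1
      funext i
      rw [simplexRetract, hmax, mul_inv_cancel_left₀ hpos.ne']
    have hz : 1 ≤ (∑ i, ξ i) ^ (∑ j, n j) := one_le_pow₀ h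
    have h1 := abs_rhoMonomial_le_one hu hyp (simplexRetract_mem hξ) n
    have h2 := one_add_mul_le_pow (a := (∑ i, ξ i) ^ (∑ j, n j) - 1) (by linarith) k
    rw [add_sub_cancel, ← pow_mul] at h2
    have e2 : rhoMonomial u n (simplexRetract ξ) - (∑ i, ξ i) ^ (∑ j, n j) *
        rhoMonomial u n (simplexRetract ξ) =
        -(((∑ i, ξ i) ^ (∑ j, n j) - 1) * rhoMonomial u n (simplexRetract ξ)) := by ring
    rw [e, e2, abs_neg, abs_mul, abs_of_nonneg (by linarith), le_div_iff₀ hk']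
    have h3 : ((∑ i, ξ i) ^ (∑ j, n j) - 1) * |rhoMonomial u n (simplexRetract ξ)| ≤
        (∑ i, ξ i) ^ (∑ j, n j) - 1 := mul_le_of_le_one_right (by linarith) h1
    nlinarith

/-- The moments of `|Y|/K` converge to coefficients `ρ` bounded by `1`, uniformly in the order. So
the retraction error is eventually at most `2/k`, with `k` arbitrary. -/
lemma IsDiagonalFamily.tendsto_retract {κ : ℕ → (Fin (m + 1) → ℕ) → ℝ}
    (hκ : IsDiagonalFamily α θ u ρ κ) (hu : IsOrthogonalBasis p u) (hyp : IsHypergroup p u)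
    (hθ : 0 < θ) (h0 : ρ 0 = 1) (hρ1 : ∀ n, |ρ n| ≤ 1) (n : Fin (m + 1) →₀ ℕ) :
    Tendsto (fun K : ℕ => ∑' y, κ K y *
      rhoMonomial u n (simplexRetract fun i => (K : ℝ)⁻¹ * y i)) atTop (𝓝 (ρ n)) := by
  obtain ⟨hs, ht⟩ := hκ.tendsto_moment hu hθ h0 n
  rw [Metric.tendsto_atTop'] at *
  intro ε hε
  obtain ⟨k, hk⟩ := exists_nat_gt (4 / ε)
  have hk0 : (0:ℝ) < k := lt_trans (by positivity) hk
  have hkn : 0 < k := by exact_mod_cast hk0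
  -- The index concentrated at `0` gives the pure moment of `|Y|/K` of order `|n| k`.
  obtain ⟨hs', ht'⟩ := hκ.tendsto_moment hu hθ h0 (Finsupp.single 0 ((∑ j, n j) * k))
  simp only [rhoMonomial_single_zero hu] at hs' ht'
  have hev := ht'.eventually (gt_mem_nhds (lt_of_le_of_lt
    ((le_abs_self _).trans (hρ1 _)) one_lt_two))
  obtain ⟨K₁, hK₁⟩ := ht (ε / 2) (by positivity)
  obtain ⟨K₂, hK₂⟩ := eventually_atTop.1 hev
  refine ⟨max K₁ K₂, fun K hK => ?_⟩
  have h1 := hK₁ K ((le_max_left _ _).trans_lt hK)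
  have h2 := hK₂ K ((le_max_right _ _).trans hK.le)
  have hpt : ∀ (y : Fin (m + 1) → ℕ) i, 0 ≤ (K : ℝ)⁻¹ * y i := fun y i => by positivity
  have hle : ∀ y, ‖κ K y * rhoMonomial u n (simplexRetract fun i => (K : ℝ)⁻¹ * y i) -
      κ K y * rhoMonomial u n (fun i => (K : ℝ)⁻¹ * y i)‖ ≤
      (κ K y * (∑ i, (K : ℝ)⁻¹ * (y i : ℝ)) ^ ((∑ j, n j) * k)) / k := fun y => by
    rw [← mul_sub, norm_mul, Real.norm_of_nonneg (hκ.nonneg K y), mul_div_assoc]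
    exact mul_le_mul_of_nonneg_left
      (abs_rhoMonomial_sub_retract_le hu hyp (hpt y) n hkn) (hκ.nonneg K y)
  have hsd := Summable.of_norm_bounded ((hs' K).div_const (k : ℝ)) hle
  have hsr : Summable fun y => κ K y *
      rhoMonomial u n (simplexRetract fun i => (K : ℝ)⁻¹ * y i) := by
    simpa using hsd.add (hs K)
  have h3 : ‖∑' y, κ K y * rhoMonomial u n (simplexRetract fun i => (K : ℝ)⁻¹ * y i) -
      ∑' y, κ K y * rhoMonomial u n (fun i => (K : ℝ)⁻¹ * y i)‖ ≤ 2 / k := by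
    rw [← hsr.tsum_sub (hs K)]
    refine (tsum_of_norm_bounded ((hs' K).div_const (k : ℝ)).hasSum hle).trans ?_
    rw [tsum_div_const]
    gcongr
  have h4 : 2 / (k : ℝ) < ε / 2 := by
    rw [div_lt_iff₀ hk0]; rw [div_lt_iff₀ hε] at hk; linarith
  rw [Real.norm_eq_abs, ← Real.dist_eq] at h3
  calc _ ≤ _ := dist_triangle _ _ _
    _ < ε / 2 + ε / 2 := add_lt_add (h3.trans_lt h4) h1
    _ = ε := by ring

/-- A sequence of discrete distributions on a compact space has a limit along which the integrals
of continuous functions converge. -/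
lemma exists_measure_of_tendsto {Ω Y ι : Type*} [TopologicalSpace Ω] [CompactSpace Ω] [T2Space Ω]
    [MeasurableSpace Ω] [BorelSpace Ω] {κ : ℕ → Y → ℝ} (hκ0 : ∀ K y, 0 ≤ κ K y)
    (hκ : ∀ K, HasSum (κ K) 1) (T : ℕ → Y → Ω) (f : ι → C(Ω, ℝ)) {L : ι → ℝ}
    (h : ∀ i, Tendsto (fun K => ∑' y, κ K y * f i (T K y)) atTop (𝓝 (L i))) :
    ∃ ν : Measure Ω, IsProbabilityMeasure ν ∧ ∀ i, L i = ∫ ω, f i ω ∂ν := by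
  let Q : ℕ → Measure Ω := fun K =>
    Measure.sum fun y => ENNReal.ofReal (κ K y) • Measure.dirac (T K y)
  have hQ : ∀ K, IsProbabilityMeasure (Q K) := fun K => ⟨by
    simp only [Q, Measure.sum_apply _ MeasurableSet.univ, Measure.smul_apply, smul_eq_mul,
      measure_univ, mul_one]
    rw [← ENNReal.ofReal_tsum_of_nonneg (hκ0 K) (hκ K).summable, (hκ K).tsum_eq,
      ENNReal.ofReal_one]⟩
  have hbdd : ∀ i, ∀ μ : Measure Ω, IsProbabilityMeasure μ → Integrable (f i) μ := fun i μ _ =>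
    (BoundedContinuousFunction.mkOfCompact (f i)).integrable μ
  have hint : ∀ K i, ∫ ω, f i ω ∂(Q K) = ∑' y, κ K y * f i (T K y) := fun K i => by
    have h1 := hasSum_integral_measure (hbdd i (Q K) (hQ K))
    rw [← h1.tsum_eq]
    refine tsum_congr fun y => ?_
    rw [integral_smul_measure, integral_dirac, ENNReal.toReal_ofReal (hκ0 K y), smul_eq_mul]
  let Q' : ℕ → ProbabilityMeasure Ω := fun K => ⟨Q K, hQ K⟩
  -- Probability measures on a compact space form a compact space, so along an ultrafilter a weak
  -- limit exists without passing to a subsequence. The integrals already converge, hence keep their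
  -- limits.
  let U : Ultrafilter ℕ := Ultrafilter.of atTop
  obtain ⟨ν, -, hν⟩ := isCompact_univ.ultrafilter_le_nhds (U.map Q') (by simp)
  refine ⟨ν, inferInstance, fun i => ?_⟩
  have h1 : Tendsto (fun K => ∫ ω, f i ω ∂(Q K)) U (𝓝 (∫ ω, f i ω ∂(ν : Measure Ω))) :=
    ProbabilityMeasure.tendsto_iff_forall_integral_tendsto.1
      (show Tendsto Q' U (𝓝 ν) from hν) (BoundedContinuousFunction.mkOfCompact (f i))
  simp only [hint] at h1
  exact tendsto_nhds_unique ((h i).mono_left (Ultrafilter.of_le atTop)) h1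

/-- Non-negative expansions have coefficients with a moment representation. -/
theorem exists_moment_representation (hu : IsOrthogonalBasis p u) (hyp : IsHypergroup p u)
    (hα : 0 < α) (hθ : 0 < θ) (h0 : ρ 0 = 1) (hρ : MeanSquareConvergent α θ p u ρ)
    (hnn : IsNonnegExpansion α θ p u ρ) :
    ∃ ν : Measure (Fin (m + 1) → ℝ), IsProbabilityMeasure ν ∧
      (∀ᵐ ξ ∂ν, ξ ∈ unitSimplex m) ∧ ∀ n, ρ n = ∫ ξ, rhoMonomial u n ξ ∂ν := by
  have hκ := isDiagonalFamily_condProb hu hα hθ h0 hρ hnn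
  have hc := isCompact_unitSimplex m
  have : CompactSpace (unitSimplex m) := isCompact_iff_compactSpace.1 hc
  obtain ⟨ν, hν, hL⟩ := exists_measure_of_tendsto (Ω := unitSimplex m) hκ.nonneg
    (hκ.hasSum_one h0) (fun K y => ⟨simplexRetract fun i => (K : ℝ)⁻¹ * y i,
      simplexRetract_mem fun i => by positivity⟩)
    (fun n : Fin (m + 1) →₀ ℕ => ⟨fun ξ => rhoMonomial u n ξ,
      (continuous_rhoMonomial u n).comp continuous_subtype_val⟩)
    (hκ.tendsto_retract hu hyp hθ h0 (abs_le_one_of_nonneg hu hα hθ h0 hρ hnn))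
  have hmeas : Measurable (Subtype.val : unitSimplex m → Fin (m + 1) → ℝ) := measurable_subtype_coe
  refine ⟨ν.map Subtype.val, Measure.isProbabilityMeasure_map hmeas.aemeasurable, ?_, fun n => ?_⟩
  · exact (ae_map_iff hmeas.aemeasurable (p := fun ξ => ξ ∈ unitSimplex m) hc.measurableSet).2
      (Filter.Eventually.of_forall fun ξ => ξ.2)
  · rw [hL n, integral_map hmeas.aemeasurable (continuous_rhoMonomial u n).aestronglyMeasurable]
    rfl

end MomentRepresentation

end MultivariateMeixner

/-! ### The theorem, assembled from the preceding parts. -/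

theorem theorem5 (m : ℕ) (p : Fin (m + 1) → ℝ) (u : Fin (m + 1) → Fin (m + 1) → ℝ)
    (hu : IsOrthogonalBasis p u) (hyp : IsHypergroup p u) (θ : ℝ) (hθ : 0 < θ) :
    -- a non-negative expansion is a proper bivariate distribution
    (∀ (ρ : (Fin (m + 1) →₀ ℕ) → ℝ), ρ 0 = 1 → ∀ α : ℝ, 0 < α →
      MeanSquareConvergent α θ p u ρ → IsNonnegExpansion α θ p u ρ →
        IsLancasterDistribution α θ p u ρ) ∧
    -- non-negativity for all `α` forces the moment representation
    (∀ (ρ : (Fin (m + 1) →₀ ℕ) → ℝ), ρ 0 = 1 →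
      (∀ α : ℝ, 0 < α → MeanSquareConvergent α θ p u ρ ∧ IsNonnegExpansion α θ p u ρ) →
        ∃ ν : Measure (Fin (m + 1) → ℝ), IsProbabilityMeasure ν ∧
          (∀ᵐ ξ ∂ν, ξ ∈ unitSimplex m) ∧
          ∀ n, ρ n = ∫ ξ, rhoMonomial u n ξ ∂ν) ∧
    -- the expansion converges for every random `ξ` in the simplex
    (∀ ν : Measure (Fin (m + 1) → ℝ), IsProbabilityMeasure ν → (∀ᵐ ξ ∂ν, ξ ∈ unitSimplex m) →
      ∀ α : ℝ, 0 < α → MeanSquareConvergent α θ p u (fun n => ∫ ξ, rhoMonomial u n ξ ∂ν)) ∧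
    -- for non-random `ξ` the condition is necessary and sufficient
    (∀ ξ ∈ unitSimplex m,
      (∀ α : ℝ, 0 < α → IsNonnegExpansion α θ p u (fun n => rhoMonomial u n ξ)) ↔
        ExtremeCondition θ p u ξ) ∧
    -- for random `ξ` the condition is sufficient
    (∀ ν : Measure (Fin (m + 1) → ℝ), IsProbabilityMeasure ν → (∀ᵐ ξ ∂ν, ξ ∈ unitSimplex m) →
      (∀ᵐ ξ ∂ν, ExtremeCondition θ p u ξ) →
        ∀ α : ℝ, 0 < α →
          IsLancasterDistribution α θ p u (fun n => ∫ ξ, rhoMonomial u n ξ ∂ν)) := by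
  refine ⟨fun ρ h0 α hα hρ hnn => isLancasterDistribution_of_nonneg hu hα hθ h0 hρ hnn,
    -- A single `α` suffices for the moment representation, since the normalized leading terms do
    -- not see `α`; the value `1` is arbitrary.
    fun ρ h0 h => exists_moment_representation hu hyp one_pos hθ h0
      (h 1 one_pos).1 (h 1 one_pos).2,
    fun ν _ hν α hα => meanSquareConvergent_of_abs_le_one hu hα hθ
      (abs_integral_rhoMonomial_le_one hu hyp hν),
    fun ξ hξ => ⟨fun h => (extremeCondition_iff hξ).2
        (excess_nonneg_of_isNonnegExpansion hu hyp hθ hξ h),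
      fun h α hα => isNonnegExpansion_of_excess_nonneg hu hyp hθ hξ
        ((extremeCondition_iff hξ).1 h) hα⟩,
    fun ν _ hν hE α hα => isLancasterDistribution_of_nonneg hu hα hθ (by simp [rhoMonomial])
      (meanSquareConvergent_of_abs_le_one hu hα hθ (abs_integral_rhoMonomial_le_one hu hyp hν))
      (isNonnegExpansion_integral hu hyp hα hθ hν ?_)⟩
  filter_upwards [hν, hE] with ξ hξ h using
    isNonnegExpansion_of_excess_nonneg hu hyp hθ hξ ((extremeCondition_iff hξ).1 h) hα
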